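/- **Theorem 2.3 (atomic characterization).** Let $n\ge 1$, $0<u<\infty$, $\theta>0$, $0\le\Gamma<\infty$. For an exponent $p(\cdot)$ let $\|f\|_{p(\cdot)}=\inf\{\eta>0:\int_{\mathbb R^n}(|f(x)|/\eta)^{p(x)}\,dx\le 1\}$. Let $p(\cdot)\in\mathfrak B(\mathbb R^n)$, i.e. $p:\mathbb R^n\to\mathbb R$ is measurable with $1<\operatorname{ess\,inf}p\le\operatorname{ess\,sup}p<\infty$ and the Hardy–Littlewood maximal operator is bounded on $L^{p(\cdot)}(\mathbb R^n)$. Put $p'(\cdot)=p(\cdot)/(p(\cdot)-1)$ and let $\delta_2\in(0,1)$ be such that, for some constant $C$, $\|\chi_S\|_{p'(\cdot)}\le C(|S|/|B|)^{\delta_2}\|\chi_B\|_{p'(\cdot)}$ for all balls $B$ and all measurable $S\subset B$. Let $\alpha(\cdot)\in L^\infty(\mathbb R^n)$ be real-valued and log-Hölder continuous at the origin and at infinity: for some constants $C$ and $\alpha_\infty\in\mathbb R$, $|\alpha(x)-\alpha(0)|\le C/(-\ln|x|)$ for $0<|x|\le 1/2$ and $|\alpha(x)-\alpha_\infty|\le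 C/\ln(e+|x|)$ for all $x$. Assume $2\Gamma\le\alpha(\cdot)$ a.e., $n\delta_2\le\alpha(0)$ and $n\delta_2\le\alpha_\infty$ (both finite). Let $s$ be a nonnegative integer with $s\ge[\alpha(0)-n\delta_2]$ and $s\ge[\alpha_\infty-n\delta_2]$, where $[\cdot]$ is the integer part, and let $N$ be an integer with $N>n+1$, $N>n+\alpha(0)-n\delta_2$ and $N>n+\alpha_\infty-n\delta_2$. *Spaces.* For a sequence $c=(c_k)_{k\in\mathbb Z}$ put $$\|c\|_{*}=\sup_{\vartheta>0}\ \sup_{m_0\in\mathbb Z}2^{-m_0\Gamma}\Big(\vartheta^{\theta}\sum_{k=-\infty}^{m_0}|c_k|^{u(1+\vartheta)}\Big)^{1/(u(1+\vartheta))}\in[0,\infty].$$ Let $B_k=B(0,2^k)$ and $\chi_k=\chi_{B_k\setminus B_{k-1}}$. The grand variable Herz–Morrey norm of $f$ is $\|f\|_{M\dot K^{\alpha(\cdot),u),\theta}_{\Gamma,p(\cdot)}}=\big\|\big(\|2^{k\alpha(\cdot)}f\chi_k\|_{p(\cdot)}\big)_{k\in\mathbb Z}\big\|_*$. For $g\in\mathcal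 S'(\mathbb R^n)$ let $$G_Ng(x)=\sup_{\phi\in\mathcal A_N}\ \sup_{t>0,\ |y-x|<t}|\phi_t*g(y)|,\qquad \phi_t(z)=t^{-n}\phi(z/t),$$ where $\mathcal A_N$ is the set of Schwartz functions with $|x^\beta D^\gamma\phi(x)|\le 1$ for all $x$ and all multi-indices with $|\beta|,|\gamma|\le N$. The grand variable Herz–Morrey–Hardy space $HM\dot K^{\alpha(\cdot),u),\theta}_{\Gamma,p(\cdot)}(\mathbb R^n)$ consists of all $g\in\mathcal S'(\mathbb R^n)$ with $\|g\|_{HM\dot K^{\alpha(\cdot),u),\theta}_{\Gamma,p(\cdot)}}:=\|G_Ng\|_{M\dot K^{\alpha(\cdot),u),\theta}_{\Gamma,p(\cdot)}}<\infty$. *Atoms.* Put $\alpha_r=\alpha(0)$ if $0<r<1$ and $\alpha_r=\alpha_\infty$ if $r\ge 1$. A central $(\alpha(\cdot),p(\cdot))$-atom for the ball $B(0,r)$ is a measurable function $a:\mathbb R^n\to\mathbb C$ with $\operatorname{supp}a\subset B(0,r)$, $\|a\|_{p(\cdot)}\le|B(0,r)|^{-\alpha_r/n}$ and $\int a(x)x^\beta\,dx=0$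 for all $|\beta|\le s$. *Conclusion.* A distribution $g\in\mathcal S'(\mathbb R^n)$ belongs to $HM\dot K^{\alpha(\cdot),u),\theta}_{\Gamma,p(\cdot)}(\mathbb R^n)$ if and only if $g=\sum_{k=-\infty}^{\infty}\lambda_ka_k$ in $\mathcal S'(\mathbb R^n)$ for some complex numbers $\lambda_k$ with $\|(\lambda_k)\|_*<\infty$ and some central $(\alpha(\cdot),p(\cdot))$-atoms $a_k$ for the balls $B_k$. Moreover, there is a constant $C>0$, independent of $g$, such that for all $g$ in this space $$C^{-1}\inf\|(\lambda_k)\|_*\le\|g\|_{HM\dot K^{\alpha(\cdot),u),\theta}_{\Gamma,p(\cdot)}}\le C\inf\|(\lambda_k)\|_*,$$ where the infimum is over all such decompositions of $g$. -/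

import Mathlib

open MeasureTheory Metric
open scoped ENNReal NNReal SchwartzMap

namespace HerzMorreyHardy

noncomputable section

/-- The Euclidean space `ℝⁿ`. -/
abbrev E (n : ℕ) : Type := EuclideanSpace ℝ (Fin n)

/-- The monomial `x ^ β` for a multi-index `β`. -/
def monom {n : ℕ} (β : Fin n → ℕ) (x : E n) : ℝ := ∏ i, x i ^ β i

/-! ### Variable exponent Lebesgue spaces -/

/-- The Luxemburg norm `‖f‖_{p(·)}`, as an extended nonnegative number, of (the modulus of) a
function. -/
def luxNorm {n : ℕ} (p : E n → ℝ) (f : E n → ℝ≥0∞) : ℝ≥0∞ :=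
  ⨅ (η : ℝ≥0) (_ : 0 < η) (_ : ∫⁻ x, (f x / η) ^ p x ≤ 1), (η : ℝ≥0∞)

/-- The class `𝒫(ℝⁿ)`: measurable exponents with `1 < ess inf p` and `ess sup p < ∞`. -/
def ClassP {n : ℕ} (p : E n → ℝ) : Prop :=
  Measurable p ∧ ∃ a b : ℝ, 1 < a ∧ ∀ᵐ x, a ≤ p x ∧ p x ≤ b

/-- The Hardy–Littlewood maximal function (centred balls). -/
def maximalFn {n : ℕ} (f : E n → ℂ) (x : E n) : ℝ≥0∞ :=
  ⨆ (r : ℝ) (_ : 0 < r), (volume (ball x r))⁻¹ * ∫⁻ y in ball x r, ‖f y‖ₑ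

/-- The class `𝔅(ℝⁿ)`: exponents in `𝒫(ℝⁿ)` for which the Hardy–Littlewood maximal operator is
bounded on `L^{p(·)}(ℝⁿ)`. -/
def ClassB {n : ℕ} (p : E n → ℝ) : Prop :=
  ClassP p ∧ ∃ C : ℝ≥0, ∀ f : E n → ℂ, AEStronglyMeasurable f volume →
    luxNorm p (maximalFn f) ≤ C * luxNorm p (fun x => ‖f x‖ₑ)

/-- The conjugate exponent `p'(·) = p(·) / (p(·) - 1)`. -/
def conjExp {n : ℕ} (p : E n → ℝ) (x : E n) : ℝ := p x / (p x - 1)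

/-- The characteristic function of a set, with values in `[0, ∞]`. -/
def chi {n : ℕ} (S : Set (E n)) : E n → ℝ≥0∞ := S.indicator 1

/-- `δ₂ ∈ (0, 1)` and `‖χ_S‖_{p'(·)} / ‖χ_B‖_{p'(·)} ≤ C (|S| / |B|)^{δ₂}` for all balls `B` and
all measurable subsets `S` of `B`. -/
def IsDeltaTwo {n : ℕ} (p : E n → ℝ) (δ₂ : ℝ) : Prop :=
  0 < δ₂ ∧ δ₂ < 1 ∧ ∃ C : ℝ≥0, ∀ (x : E n) (r : ℝ), 0 < r →
    ∀ S : Set (E n), MeasurableSet S → S ⊆ ball x r →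
      luxNorm (conjExp p) (chi S) ≤
        C * (volume S / volume (ball x r)) ^ δ₂ * luxNorm (conjExp p) (chi (ball x r))

/-! ### Log-Hölder continuity at the origin and at infinity -/

def LogHolderAtOrigin {n : ℕ} (α : E n → ℝ) : Prop :=
  ∃ C : ℝ, ∀ x : E n, x ≠ 0 → ‖x‖ ≤ 1 / 2 → |α x - α 0| ≤ C / (-Real.log ‖x‖)

/-- `α` is log-Hölder continuous at infinity, with limit `α_∞`. -/
def LogHolderAtInfinity {n : ℕ} (α : E n → ℝ) (αinf : ℝ) : Prop :=
  ∃ C : ℝ, ∀ x : E n, |α x - αinf| ≤ C / Real.log (Real.exp 1 + ‖x‖)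

/-! ### Grand variable Herz–Morrey quasi-norms -/

/-- The grand Morrey-type quasi-norm of a sequence indexed by `ℤ`:
`sup_{ϑ > 0} sup_{m₀ ∈ ℤ} 2^{-m₀Γ} (ϑ^θ ∑_{k ≤ m₀} c_k^{u(1+ϑ)})^{1/(u(1+ϑ))}`. -/
def grandMorreyNorm (u θ Γ : ℝ) (c : ℤ → ℝ≥0∞) : ℝ≥0∞ :=
  ⨆ (ϑ : ℝ) (_ : 0 < ϑ) (m₀ : ℤ), (2 : ℝ≥0∞) ^ (-(m₀ : ℝ) * Γ) *
    (ENNReal.ofReal (ϑ ^ θ) * ∑' k : Set.Iic m₀, c k ^ (u * (1 + ϑ))) ^ (1 / (u * (1 + ϑ)))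

/-- The dyadic ball `B_k = B(0, 2^k)`. -/
def dyadicBall (n : ℕ) (k : ℤ) : Set (E n) := ball 0 ((2 : ℝ) ^ k)

/-- The dyadic annulus `F_k = B_k \ B_{k-1}`. -/
def annulus (n : ℕ) (k : ℤ) : Set (E n) := dyadicBall n k \ dyadicBall n (k - 1)

/-- The quasi-norm of the grand variable Herz–Morrey space, of (the modulus of) a function. -/
def herzMorreyNorm {n : ℕ} (α p : E n → ℝ) (u θ Γ : ℝ) (f : E n → ℝ≥0∞) : ℝ≥0∞ :=
  grandMorreyNorm u θ Γ fun k =>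
    luxNorm p fun x => (2 : ℝ≥0∞) ^ ((k : ℝ) * α x) * f x * chi (annulus n k) x

/-! ### The grand maximal function and the Hardy space -/

/-- For `t > 0`, the Schwartz function `z ↦ φ_t (y - z) = t⁻ⁿ φ ((y - z) / t)`. -/
def dilTrans {n : ℕ} (φ : 𝓢(E n, ℂ)) (t : ℝ) (ht : 0 < t) (y : E n) : 𝓢(E n, ℂ) :=
  ((t : ℂ) ^ n)⁻¹ •
    SchwartzMap.compSubConstCLM ℂ y
      (SchwartzMap.compCLMOfContinuousLinearEquiv ℂ
        (ContinuousLinearEquiv.smulLeft (R₁ := ℝ) (M₁ := E n)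
          (Units.mk0 (-t⁻¹) (neg_ne_zero.mpr (inv_ne_zero ht.ne')))) φ)

theorem dilTrans_apply {n : ℕ} (φ : 𝓢(E n, ℂ)) (t : ℝ) (ht : 0 < t) (y z : E n) :
    dilTrans φ t ht y z = ((t : ℂ) ^ n)⁻¹ * φ (t⁻¹ • (y - z)) := by
  have h : (-t⁻¹) • (z - y) = t⁻¹ • (y - z) := by
    rw [neg_smul, ← smul_neg, neg_sub]
  rw [← h]
  rfl

/-- The class `𝒜_N` of Schwartz functions with `|x^β D^γ φ(x)| ≤ 1` for all `x` and all
multi-indices `β`, `γ` of order at most `N`. The derivative `D^γ` is the iterated partial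
derivative along the coordinate directions `d 0, …, d (j - 1)`, where `j = |γ|`. -/
def testClass (n N : ℕ) : Set 𝓢(E n, ℂ) :=
  {φ | ∀ β : Fin n → ℕ, ∑ i, β i ≤ N → ∀ j ≤ N, ∀ (d : Fin j → Fin n) (x : E n),
    |monom β x| *
      ‖iteratedFDeriv ℝ j φ x (fun l => EuclideanSpace.single (d l) (1 : ℝ))‖ ≤ 1}

/-- The nontangential maximal function `φ*_∇(g)(x) = sup_{|y - x| < t} |φ_t * g (y)|`, where
`φ_t * g (y) = ⟨g, φ_t (y - ·)⟩`. -/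
def nontangential {n : ℕ} (φ : 𝓢(E n, ℂ)) (g : 𝓢'(E n, ℂ)) (x : E n) : ℝ≥0∞ :=
  ⨆ (t : ℝ) (ht : 0 < t) (y : E n) (_ : ‖y - x‖ < t), ‖g (dilTrans φ t ht y)‖ₑ

/-- The grand maximal function `G_N g`. -/
def grandMaximal {n : ℕ} (N : ℕ) (g : 𝓢'(E n, ℂ)) (x : E n) : ℝ≥0∞ :=
  ⨆ φ ∈ testClass n N, nontangential φ g x

/-- The quasi-norm of the grand variable Herz–Morrey–Hardy space. -/
def hardyNorm {n : ℕ} (N : ℕ) (α p : E n → ℝ) (u θ Γ : ℝ) (g : 𝓢'(E n, ℂ)) : ℝ≥0∞ :=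
  herzMorreyNorm α p u θ Γ (grandMaximal N g)

/-- The grand variable Herz–Morrey–Hardy space. -/
def hardySpace {n : ℕ} (N : ℕ) (α p : E n → ℝ) (u θ Γ : ℝ) : Set 𝓢'(E n, ℂ) :=
  {g | hardyNorm N α p u θ Γ g < ∞}

/-! ### Atoms and atomic decompositions -/

/-- `α_r = α(0)` if `r < 1` and `α_r = α_∞` if `r ≥ 1`. -/
def alphaAt {n : ℕ} (α : E n → ℝ) (αinf r : ℝ) : ℝ := if r < 1 then α 0 else αinf

/-- Central `(α(·), p(·))`-atoms for the ball `B(0, r)`, with vanishing moments up to order `s`. -/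
structure IsCentralAtom {n : ℕ} (α : E n → ℝ) (αinf : ℝ) (p : E n → ℝ) (s : ℕ) (r : ℝ)
    (a : E n → ℂ) : Prop where
  aestronglyMeasurable : AEStronglyMeasurable a volume
  tsupport_subset : tsupport a ⊆ ball 0 r
  norm_le : luxNorm p (fun x => ‖a x‖ₑ) ≤
    volume (ball (0 : E n) r) ^ (-alphaAt α αinf r / (n : ℝ))
  moment_eq_zero : ∀ β : Fin n → ℕ, ∑ i, β i ≤ s → ∫ x, a x * (monom β x : ℂ) = 0

/-- `g = ∑_{k ∈ ℤ} c_k a_k` in `𝒮'(ℝⁿ)`, each `a_k` being a central atom for the ball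
`B(0, 2^k)`. -/
structure IsAtomicDecomposition {n : ℕ} (α : E n → ℝ) (αinf : ℝ) (p : E n → ℝ) (s : ℕ)
    (g : 𝓢'(E n, ℂ)) (c : ℤ → ℂ) (a : ℤ → E n → ℂ) : Prop where
  atom : ∀ k, IsCentralAtom α αinf p s ((2 : ℝ) ^ k) (a k)
  hasSum : ∀ φ : 𝓢(E n, ℂ), HasSum (fun k => c k * ∫ x, a k x * φ x) (g φ)

/-- The grand Morrey-type quasi-norm of a sequence of complex coefficients. -/
def coeffNorm (u θ Γ : ℝ) (c : ℤ → ℂ) : ℝ≥0∞ := grandMorreyNorm u θ Γ fun k => ‖c k‖ₑ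

/-- The infimum of the coefficient quasi-norms over all atomic decompositions of `g`. -/
def atomicNorm {n : ℕ} (α : E n → ℝ) (αinf : ℝ) (p : E n → ℝ) (s : ℕ) (u θ Γ : ℝ)
    (g : 𝓢'(E n, ℂ)) : ℝ≥0∞ :=
  ⨅ (c : ℤ → ℂ) (a : ℤ → E n → ℂ) (_ : IsAtomicDecomposition α αinf p s g c a),
    coeffNorm u θ Γ c

end

end HerzMorreyHardy

/-! Log-Hölder continuity makes the variable weight `2 ^ (k * α x)` comparable on the `k`-th annulus
to the constant `2 ^ (k * α_k)`, where `α_k` is `α 0` for `k < 0` and `αinf` for `k ≥ 0`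
(`exists_two_rpow_mul_comparable`). Both directions thus become estimates on sequences indexed by
dyadic scales, with `Γ < α 0` and `Γ < αinf`.

Atoms to Hardy space. On annuli of index at most `k + 1`, the grand maximal function of an atom
`a_k` is bounded by the Hardy–Littlewood maximal function (`exists_luxNorm_maximalOf_atom_le`).
Farther out, the vanishing moments allow a Taylor polynomial to be subtracted from the test
function, and the resulting decay combines with the exponent `δ₂`
(`exists_luxNorm_maximalOf_atom_annulus_le`). The coefficient of `G_N g` at scale `j` is then at
most a sum over `l` of `2 ^ (-ε|l| - Γ l)` times the atomic coefficient at scale `j + l`. Such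
convolutions are bounded for the grand Morrey quasi-norm (`exists_grandMorreyNorm_conv_le`).

Hardy space to atoms. On a ring away from the origin `G_N g` is integrable, and there `|g(φ)|` is at
most a constant times `∫ |φ| G_N g` (`exists_enorm_apply_le_lintegral`). By duality the product of
`g` with a cutoff to the ring is therefore a function dominated by `G_N g` (`exists_localization`).
To create vanishing moments, let `P_k` be a bump combination with the same moments up to order `s`
as `g` cut off at radius about `2 ^ k`. The block at scale `k` is the localized function minus `P_k`
plus `P_{k-1}` (`IsDualSystem.exists_blocks`). The blocks telescope: each is `D_k - D_{k-1}`, where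
`D_k` is the cut-off distribution minus `P_k`.

As `k → ∞`, `D_k → g`, because Schwartz tails decay and `P_k` is small by `Γ < αinf`. As `k → -∞`,
`D_k → 0`: it kills polynomials of degree at most `s`, so only a Taylor remainder of order `s + 1`
survives, and `s + 1 > α 0 - n * δ₂` makes it summable (`IsDualSystem.hasSum_tailPart_sub`). In
particular no mass is left at the origin. Normalizing the blocks gives the atoms. -/

namespace HerzMorreyHardy

/-! ### Variable exponent Lebesgue norms: triangle inequality, Hölder, characteristic functions. -/

section Luxemburg

variable {n : ℕ} {p : E n → ℝ} {f g : E n → ℝ≥0∞}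

theorem luxNorm_le_of_lintegral_le {η : ℝ≥0} (hη : 0 < η)
    (h : ∫⁻ x, (f x / η) ^ p x ≤ 1) : luxNorm p f ≤ η :=
  iInf₂_le_of_le η hη (iInf_le _ h)

theorem exists_of_luxNorm_lt {c : ℝ≥0∞} (h : luxNorm p f < c) :
    ∃ η : ℝ≥0, 0 < η ∧ ∫⁻ x, (f x / η) ^ p x ≤ 1 ∧ (η : ℝ≥0∞) < c := by
  simpa only [luxNorm, iInf_lt_iff, exists_prop] using h

theorem luxNorm_mono_ae (hp : ∀ᵐ x, 0 ≤ p x) (h : ∀ᵐ x, f x ≤ g x) :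
    luxNorm p f ≤ luxNorm p g := by
  refine le_iInf₂ fun η hη => le_iInf fun hg => luxNorm_le_of_lintegral_le hη (le_trans ?_ hg)
  refine lintegral_mono_ae ?_
  filter_upwards [hp, h] with x hx hfg
  gcongr

theorem luxNorm_mono (hp : ∀ᵐ x, 0 ≤ p x) (h : ∀ x, f x ≤ g x) :
    luxNorm p f ≤ luxNorm p g :=
  luxNorm_mono_ae hp (.of_forall h)

/-- With a strict inequality some admissible scale lies below `η`, so it is never necessary to know
that the infimum is attained. -/
theorem lintegral_le_one_of_luxNorm_lt (hp : ∀ᵐ x, 0 ≤ p x) {η : ℝ≥0}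
    (h : luxNorm p f < η) : ∫⁻ x, (f x / η) ^ p x ≤ 1 := by
  obtain ⟨ζ, -, hζ, hlt⟩ := exists_of_luxNorm_lt h
  refine le_trans (lintegral_mono_ae ?_) hζ
  filter_upwards [hp] with x hx
  gcongr

theorem luxNorm_zero (hp : ∀ᵐ x, 0 < p x) : luxNorm p (fun _ => 0) = 0 := by
  refine le_antisymm (ENNReal.le_of_forall_pos_le_add fun ε hε _ => ?_) zero_le
  rw [zero_add]
  refine luxNorm_le_of_lintegral_le hε ?_
  rw [lintegral_congr_ae (g := fun _ => 0)]
  · simp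
  · filter_upwards [hp] with x hx
    simp [hx]

theorem luxNorm_const_mul_le (hp : ∀ᵐ x, 0 < p x) (c : ℝ≥0) (f : E n → ℝ≥0∞) :
    luxNorm p (fun x => c * f x) ≤ c * luxNorm p f := by
  rcases eq_or_ne c 0 with rfl | hc
  · simpa using luxNorm_zero hp
  have hc' : (c : ℝ≥0∞) ≠ 0 := by simpa using hc
  rw [← ENNReal.inv_mul_le_iff hc' ENNReal.coe_ne_top]
  refine le_iInf₂ fun η hη => le_iInf fun hf => ?_
  rw [ENNReal.inv_mul_le_iff hc' ENNReal.coe_ne_top, ← ENNReal.coe_mul]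
  refine luxNorm_le_of_lintegral_le (mul_pos (pos_iff_ne_zero.2 hc) hη) ?_
  rw [ENNReal.coe_mul]
  simpa only [ENNReal.mul_div_mul_left _ _ hc' ENNReal.coe_ne_top] using hf

theorem luxNorm_const_mul (hp : ∀ᵐ x, 0 < p x) {c : ℝ≥0} (hc : c ≠ 0) (f : E n → ℝ≥0∞) :
    luxNorm p (fun x => c * f x) = c * luxNorm p f := by
  refine le_antisymm (luxNorm_const_mul_le hp c f) ?_
  have hc' : (c : ℝ≥0∞) ≠ 0 := by simpa using hc
  have h : luxNorm p f ≤ (c : ℝ≥0∞)⁻¹ * luxNorm p (fun x => c * f x) := by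
    rw [← ENNReal.coe_inv hc]
    refine le_of_eq_of_le ?_ (luxNorm_const_mul_le hp c⁻¹ _)
    congr 1
    ext x
    rw [← mul_assoc, ← ENNReal.coe_mul, inv_mul_cancel₀ hc]
    simp
  calc (c : ℝ≥0∞) * luxNorm p f ≤ c * ((c : ℝ≥0∞)⁻¹ * luxNorm p (fun x => c * f x)) := by gcongr
    _ = _ := by rw [← mul_assoc, ENNReal.mul_inv_cancel hc' ENNReal.coe_ne_top, one_mul]

/-- Jensen's inequality for weights of total mass at most one: the missing mass is placed at an
extra point (`Finset.insertNone`) where the value is `0`. -/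
theorem rpow_tsum_mul_le {ι : Type*} (w z : ι → ℝ≥0∞) (hw : ∑' i, w i ≤ 1) {q : ℝ}
    (hq : 1 ≤ q) : (∑' i, w i * z i) ^ q ≤ ∑' i, w i * z i ^ q := by
  have hq0 : 0 < q := by linarith
  have key : ∀ s : Finset ι, (∑ i ∈ s, w i * z i) ^ q ≤ ∑ i ∈ s, w i * z i ^ q := by
    intro s
    have hs : ∑ i ∈ s, w i ≤ 1 := (ENNReal.sum_le_tsum s).trans hw
    have := ENNReal.rpow_arith_mean_le_arith_mean_rpow (s := Finset.insertNone s)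
      (fun o => o.elim (1 - ∑ i ∈ s, w i) w) (fun o => o.elim 0 z)
      (by simp [Finset.sum_insertNone, tsub_add_cancel_of_le hs]) hq
    simpa [Finset.sum_insertNone, hq0] using this
  have h1 : Filter.Tendsto (fun s : Finset ι => (∑ i ∈ s, w i * z i) ^ q) Filter.atTop
      (nhds ((∑' i, w i * z i) ^ q)) :=
    (ENNReal.continuous_rpow_const.tendsto _).comp ENNReal.summable.hasSum
  exact le_of_tendsto' h1 fun s => (key s).trans (ENNReal.sum_le_tsum s)

/-- With `η i` slightly above the norm of `f i` and `S` the sum of the `η i`, the quotient of the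
sum by `S` is the convex combination of the `f i / η i` with weights `η i / S`. Convexity of `t ^ p
x` bounds its modular by `1`. -/
theorem luxNorm_tsum_le {ι : Type*} [Countable ι] (hpm : Measurable p) (hp : ∀ᵐ x, 1 ≤ p x)
    (f : ι → E n → ℝ≥0∞) (hf : ∀ i, Measurable (f i)) :
    luxNorm p (fun x => ∑' i, f i x) ≤ ∑' i, luxNorm p (f i) := by
  have hp0 : ∀ᵐ x, 0 ≤ p x := hp.mono fun x hx => by linarith
  have hp0' : ∀ᵐ x, 0 < p x := hp.mono fun x hx => by linarith
  rcases isEmpty_or_nonempty ι with hι | ⟨⟨i₀⟩⟩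
  · simpa using luxNorm_zero hp0'
  refine ENNReal.le_of_forall_pos_le_add fun ε hε hfin => ?_
  obtain ⟨δ, hδ, hδε⟩ := ENNReal.exists_pos_sum_of_countable (ε := (ε : ℝ≥0∞))
    (by simpa using hε.ne') ι
  have hlt : ∀ i, luxNorm p (f i) ≠ ∞ := fun i => ENNReal.ne_top_of_tsum_ne_top hfin.ne i
  set η : ι → ℝ≥0 := fun i => (luxNorm p (f i)).toNNReal + δ i with hη
  have hηc : ∀ i, (η i : ℝ≥0∞) = luxNorm p (f i) + δ i := fun i => by
    rw [hη, ENNReal.coe_add, ENNReal.coe_toNNReal (hlt i)]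
  have hη0 : ∀ i, 0 < η i := fun i => lt_of_lt_of_le (hδ i) le_add_self
  have hsum : ∑' i, (η i : ℝ≥0∞) ≤ ∑' i, luxNorm p (f i) + ε := by
    simp_rw [hηc, ENNReal.tsum_add]
    gcongr
  have hfin' : ∑' i, (η i : ℝ≥0∞) ≠ ∞ :=
    (hsum.trans_lt (ENNReal.add_lt_top.2 ⟨hfin, ENNReal.coe_lt_top⟩)).ne
  refine le_trans ?_ hsum
  set S : ℝ≥0 := (∑' i, (η i : ℝ≥0∞)).toNNReal with hS
  have hSc : (S : ℝ≥0∞) = ∑' i, (η i : ℝ≥0∞) := ENNReal.coe_toNNReal hfin'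
  have hS0 : 0 < S := by
    have : (η i₀ : ℝ≥0∞) ≤ S := hSc ▸ ENNReal.le_tsum i₀
    exact lt_of_lt_of_le (hη0 i₀) (by exact_mod_cast this)
  have hS0' : (S : ℝ≥0∞) ≠ 0 := by simpa using hS0.ne'
  rw [← hSc]
  refine luxNorm_le_of_lintegral_le hS0 ?_
  have hw : ∑' i, (η i : ℝ≥0∞) / S = 1 := by
    simp_rw [div_eq_mul_inv]
    rw [ENNReal.tsum_mul_right, ← hSc, ENNReal.mul_inv_cancel hS0' ENNReal.coe_ne_top]
  calc ∫⁻ x, ((∑' i, f i x) / S) ^ p x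
      ≤ ∫⁻ x, ∑' i, (η i : ℝ≥0∞) / S * (f i x / η i) ^ p x := by
        refine lintegral_mono_ae ?_
        filter_upwards [hp] with x hx
        refine le_of_eq_of_le ?_ (rpow_tsum_mul_le _ _ hw.le hx)
        congr 1
        rw [div_eq_mul_inv, ← ENNReal.tsum_mul_right]
        congr 1
        ext i
        have h0 : (η i : ℝ≥0∞) ≠ 0 := by simpa using (hη0 i).ne'
        calc f i x * (S : ℝ≥0∞)⁻¹ = (η i * (η i : ℝ≥0∞)⁻¹) * (f i x * (S : ℝ≥0∞)⁻¹) := by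
              rw [ENNReal.mul_inv_cancel h0 ENNReal.coe_ne_top, one_mul]
          _ = (η i : ℝ≥0∞) / S * (f i x / η i) := by simp only [div_eq_mul_inv]; ring
    _ = ∑' i, (η i : ℝ≥0∞) / S * ∫⁻ x, (f i x / η i) ^ p x := by
        rw [lintegral_tsum]
        · congr 1
          ext i
          rw [lintegral_const_mul]
          exact ((hf i).div_const _).pow hpm
        · intro i
          exact ((((hf i).div_const _).pow hpm).const_mul _).aemeasurable
    _ ≤ ∑' i, (η i : ℝ≥0∞) / S * 1 := by
        refine ENNReal.tsum_le_tsum fun i => ?_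
        gcongr
        refine lintegral_le_one_of_luxNorm_lt hp0 ?_
        rw [hηc]
        exact ENNReal.lt_add_right (hlt i) (by simpa using (hδ i).ne')
    _ = 1 := by simpa using hw

theorem luxNorm_add_le (hpm : Measurable p) (hp : ∀ᵐ x, 1 ≤ p x)
    (hf : Measurable f) (hg : Measurable g) :
    luxNorm p (fun x => f x + g x) ≤ luxNorm p f + luxNorm p g := by
  have := luxNorm_tsum_le (ι := Bool) hpm hp (fun b => cond b f g) (by rintro (_ | _) <;> simpa)
  simpa [tsum_fintype] using this


theorem measurable_chi {S : Set (E n)} (hS : MeasurableSet S) : Measurable (chi S) :=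
  measurable_one.indicator hS

theorem chi_le_chi {S T : Set (E n)} (h : S ⊆ T) (x : E n) : chi S x ≤ chi T x :=
  Set.indicator_le_indicator_of_subset h (fun _ => zero_le) x

theorem chi_of_mem {S : Set (E n)} {x : E n} (h : x ∈ S) : chi S x = 1 := by
  simp [chi, h]

theorem chi_of_notMem {S : Set (E n)} {x : E n} (h : x ∉ S) : chi S x = 0 := by
  simp [chi, h]

theorem lintegral_chi_div_rpow {S : Set (E n)} (hS : MeasurableSet S) (hp : ∀ᵐ x, 0 < p x)
    (η : ℝ≥0) : ∫⁻ x, (chi S x / η) ^ p x = ∫⁻ x in S, ((η : ℝ≥0∞)⁻¹) ^ p x := by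
  rw [← lintegral_indicator hS]
  refine lintegral_congr_ae ?_
  filter_upwards [hp] with x hx
  by_cases h : x ∈ S
  · simp [chi, h]
  · simp [chi, h, hx]

theorem luxNorm_chi_ne_top {S : Set (E n)} (hS : MeasurableSet S) (hp : ∀ᵐ x, 1 ≤ p x)
    (hv : volume S ≠ ∞) : luxNorm p (chi S) ≠ ∞ := by
  have hp0 : ∀ᵐ x, 0 < p x := hp.mono fun x hx => by linarith
  set η : ℝ≥0 := max 1 (volume S).toNNReal with hη
  have h1 : 1 ≤ η := le_max_left _ _
  have h0 : 0 < η := zero_lt_one.trans_le h1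
  refine ((luxNorm_le_of_lintegral_le (p := p) (f := chi S) h0 ?_).trans_lt
    ENNReal.coe_lt_top).ne
  rw [lintegral_chi_div_rpow hS hp0]
  calc ∫⁻ x in S, ((η : ℝ≥0∞)⁻¹) ^ p x ≤ ∫⁻ x in S, (η : ℝ≥0∞)⁻¹ := by
        refine lintegral_mono_ae (ae_restrict_of_ae ?_)
        filter_upwards [hp] with x hx
        refine (ENNReal.rpow_le_rpow_of_exponent_ge ?_ hx).trans_eq (ENNReal.rpow_one _)
        simpa using h1
    _ = (η : ℝ≥0∞)⁻¹ * volume S := by simp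
    _ ≤ (η : ℝ≥0∞)⁻¹ * η := by
        gcongr
        rw [← ENNReal.coe_toNNReal hv]
        exact_mod_cast le_max_right _ _
    _ = 1 := ENNReal.inv_mul_cancel (by simpa using h0.ne') ENNReal.coe_ne_top

theorem luxNorm_chi_ne_zero {S : Set (E n)} (hS : MeasurableSet S) (hp : ∀ᵐ x, 1 ≤ p x)
    (hv : volume S ≠ 0) : luxNorm p (chi S) ≠ 0 := by
  have hp0 : ∀ᵐ x, 0 < p x := hp.mono fun x hx => by linarith
  intro h
  apply hv
  refine le_antisymm (ENNReal.le_of_forall_pos_le_add fun ε hε _ => ?_) zero_le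
  rw [zero_add]
  set η : ℝ≥0 := min ε 1 with hη
  have h0 : 0 < η := lt_min hε one_pos
  have h0' : (η : ℝ≥0∞) ≠ 0 := by simpa using h0.ne'
  have := lintegral_le_one_of_luxNorm_lt (p := p) (f := chi S) (η := η)
    (hp0.mono fun x hx => hx.le) (by rw [h]; exact_mod_cast h0)
  rw [lintegral_chi_div_rpow hS hp0] at this
  have h2 : (η : ℝ≥0∞)⁻¹ * volume S ≤ 1 := by
    refine le_trans ?_ this
    calc (η : ℝ≥0∞)⁻¹ * volume S = ∫⁻ x in S, (η : ℝ≥0∞)⁻¹ := by simp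
      _ ≤ _ := by
        refine lintegral_mono_ae (ae_restrict_of_ae ?_)
        filter_upwards [hp] with x hx
        refine (ENNReal.rpow_one _).symm.le.trans (ENNReal.rpow_le_rpow_of_exponent_le ?_ hx)
        rw [ENNReal.one_le_inv]
        exact_mod_cast min_le_right _ _
  rw [ENNReal.inv_mul_le_iff h0' ENNReal.coe_ne_top, mul_one] at h2
  exact h2.trans (by exact_mod_cast min_le_left _ _)

theorem ClassP.measurable (hp : ClassP p) : Measurable p := hp.1

theorem ClassP.one_lt (hp : ClassP p) : ∀ᵐ x, 1 < p x := by
  obtain ⟨-, a, b, ha, h⟩ := hp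
  exact h.mono fun x hx => ha.trans_le hx.1

theorem ClassP.one_le (hp : ClassP p) : ∀ᵐ x, 1 ≤ p x := hp.one_lt.mono fun _ h => h.le

theorem ClassP.pos (hp : ClassP p) : ∀ᵐ x, 0 < p x :=
  hp.one_lt.mono fun _ h => zero_lt_one.trans h

theorem ClassP.nonneg (hp : ClassP p) : ∀ᵐ x, 0 ≤ p x := hp.pos.mono fun _ h => h.le

theorem holderConjugate_conjExp {x : E n} (hx : 1 < p x) :
    (p x).HolderConjugate (conjExp p x) :=
  Real.HolderConjugate.conjExponent hx

theorem ClassP.conjExp (hp : ClassP p) : ClassP (conjExp p) := by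
  obtain ⟨hm, a, b, ha, h⟩ := hp
  have hb : a ≤ b := by
    obtain ⟨x, hx⟩ := h.exists
    exact hx.1.trans hx.2
  refine ⟨hm.div (hm.sub_const 1), b / (b - 1), a / (a - 1), ?_, ?_⟩
  · rw [lt_div_iff₀ (by linarith)]
    linarith
  · filter_upwards [h] with x hx
    have h1 : 1 < p x := ha.trans_le hx.1
    unfold HerzMorreyHardy.conjExp
    constructor
    · rw [div_le_div_iff₀ (by linarith) (by linarith)]
      nlinarith [hx.2]
    · rw [div_le_div_iff₀ (by linarith) (by linarith)]
      nlinarith [hx.1]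

/-- Hölder's inequality against a characteristic function. -/
theorem setLIntegral_le_luxNorm_mul (hp : ClassP p) {S : Set (E n)} (hS : MeasurableSet S)
    (hv : volume S ≠ ∞) (f : E n → ℝ≥0∞) (hf : luxNorm p f ≠ ∞) :
    ∫⁻ x in S, f x ≤ 2 * luxNorm p f * luxNorm (HerzMorreyHardy.conjExp p) (chi S) := by
  have hS' := luxNorm_chi_ne_top hS hp.conjExp.one_le hv
  -- Strict upper bounds `η`, `ζ` replace the norms, which may vanish; they are sent to the norms at
  -- the end.
  have key : ∀ η ζ : ℝ≥0, 0 < η → 0 < ζ → luxNorm p f < η →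
      luxNorm (HerzMorreyHardy.conjExp p) (chi S) < ζ → ∫⁻ x in S, f x ≤ 2 * η * ζ := by
    intro η ζ h0 h0' h1 h2
    have i1 := lintegral_le_one_of_luxNorm_lt hp.nonneg h1
    have i2 := lintegral_le_one_of_luxNorm_lt hp.conjExp.nonneg h2
    have hη : (η : ℝ≥0∞) ≠ 0 := by simpa using h0.ne'
    have hζ : (ζ : ℝ≥0∞) ≠ 0 := by simpa using h0'.ne'
    calc ∫⁻ x in S, f x = ∫⁻ x, f x * chi S x := by
          rw [← lintegral_indicator hS]
          congr 1
          ext x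
          by_cases h : x ∈ S <;> simp [chi, h]
      _ = ∫⁻ x, (η * ζ) * ((f x / η) * (chi S x / ζ)) := by
          congr 1
          ext x
          calc f x * chi S x = (η * (η : ℝ≥0∞)⁻¹) * (ζ * (ζ : ℝ≥0∞)⁻¹) * (f x * chi S x) := by
                rw [ENNReal.mul_inv_cancel hη ENNReal.coe_ne_top,
                  ENNReal.mul_inv_cancel hζ ENNReal.coe_ne_top, one_mul, one_mul]
            _ = _ := by simp only [div_eq_mul_inv]; ring
      _ = (η * ζ) * ∫⁻ x, (f x / η) * (chi S x / ζ) :=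
          lintegral_const_mul' _ _ (ENNReal.mul_ne_top ENNReal.coe_ne_top ENNReal.coe_ne_top)
      _ ≤ (η * ζ) * ∫⁻ x, (f x / η) ^ p x +
            (chi S x / ζ) ^ HerzMorreyHardy.conjExp p x := by
          refine mul_le_mul_right (lintegral_mono_ae ?_) _
          filter_upwards [hp.one_lt] with x hx
          have hc := holderConjugate_conjExp hx
          -- The factors `1 / p` and `1 / p'` are at most `1`; dropping them produces the constant
          -- `2`.
          refine (ENNReal.young_inequality _ _ hc).trans ?_
          gcongr <;> refine ENNReal.div_le_of_le_mul (le_mul_of_one_le_right' ?_)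
          · simpa using hx.le
          · simpa using hc.symm.lt.le
      _ ≤ (η * ζ) * (1 + 1) := by
          gcongr
          rw [lintegral_add_right]
          · gcongr
          · exact ((measurable_chi hS).div_const _).pow hp.conjExp.measurable
      _ = 2 * η * ζ := by rw [one_add_one_eq_two]; ring
  set A := (luxNorm p f).toNNReal with hA
  set B := (luxNorm (HerzMorreyHardy.conjExp p) (chi S)).toNNReal with hB
  have hAc : (A : ℝ≥0∞) = luxNorm p f := ENNReal.coe_toNNReal hf
  have hBc : (B : ℝ≥0∞) = luxNorm (HerzMorreyHardy.conjExp p) (chi S) :=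
    ENNReal.coe_toNNReal hS'
  rw [← hAc, ← hBc]
  have hlim : Filter.Tendsto (fun t : ℝ≥0 => ((2 * (A + t) * (B + t) : ℝ≥0) : ℝ≥0∞))
      (nhdsWithin 0 (Set.Ioi 0)) (nhds ((2 * (A + 0) * (B + 0) : ℝ≥0) : ℝ≥0∞)) := by
    refine Filter.Tendsto.mono_left ?_ nhdsWithin_le_nhds
    refine ENNReal.tendsto_coe.2 (Continuous.tendsto ?_ 0)
    fun_prop
  have := ge_of_tendsto hlim (b := ∫⁻ x in S, f x) ?_
  · simpa using this
  · filter_upwards [self_mem_nhdsWithin] with t ht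
    have ht : 0 < t := ht
    refine (key (A + t) (B + t) (by positivity) (by positivity) ?_ ?_).trans_eq (by simp)
    · rw [← hAc]; exact_mod_cast lt_add_of_pos_right A ht
    · rw [← hBc]; exact_mod_cast lt_add_of_pos_right B ht

theorem volume_ball_eq (x : E n) {r : ℝ} (hr : 0 < r) :
    volume (ball x r) = ENNReal.ofReal (r ^ n) * volume (ball (0 : E n) 1) := by
  rw [Measure.addHaar_ball_of_pos volume x hr]
  simp

theorem volume_unitBall_ne_zero : volume (ball (0 : E n) 1) ≠ 0 :=
  (measure_ball_pos volume _ one_pos).ne'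

theorem volume_unitBall_ne_top : volume (ball (0 : E n) 1) ≠ ∞ := measure_ball_lt_top.ne

end Luxemburg

/-! ### Consequences of the boundedness of the maximal operator for norms of balls. -/

section MaximalBound

variable {n : ℕ} {p : E n → ℝ}

/-- For `x` in `B(0, R)` the ball `B(x, 2R)` contains `B(0, R)` and has `2 ^ n` times its volume. -/
theorem chi_ball_mul_le_maximalFn {R : ℝ} (hR : 0 < R) (f : E n → ℂ) (x : E n) :
    (2 ^ n * volume (ball (0 : E n) R))⁻¹ * (∫⁻ y in ball 0 R, ‖f y‖ₑ) * chi (ball 0 R) x ≤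
      maximalFn f x := by
  by_cases hx : x ∈ ball (0 : E n) R
  · rw [chi_of_mem hx, mul_one]
    refine le_trans ?_ (le_iSup₂ (f := fun (r : ℝ) (_ : 0 < r) =>
      (volume (ball x r))⁻¹ * ∫⁻ y in ball x r, ‖f y‖ₑ) (2 * R) (by positivity))
    have hv : volume (ball x (2 * R)) = 2 ^ n * volume (ball (0 : E n) R) := by
      rw [volume_ball_eq _ hR, volume_ball_eq _ (by positivity), mul_pow,
        ENNReal.ofReal_mul (by positivity), mul_assoc]
      congr 1
      rw [ENNReal.ofReal_pow (by norm_num)]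
      norm_num
    rw [hv]
    gcongr
    refine ball_subset_ball' ?_
    rw [mem_ball] at hx
    rw [dist_comm]
    linarith
  · rw [chi_of_notMem hx, mul_zero]
    exact zero_le

theorem ClassB.exists_luxNorm_chi_ball_mul_lintegral_le (hp : ClassB p) :
    ∃ C : ℝ≥0, ∀ R : ℝ, 0 < R → ∀ f : E n → ℂ, AEStronglyMeasurable f volume →
      ∫⁻ y in ball 0 R, ‖f y‖ₑ ≠ ∞ →
      luxNorm p (chi (ball 0 R)) * ∫⁻ y in ball 0 R, ‖f y‖ₑ ≤
        C * volume (ball (0 : E n) R) * luxNorm p (fun x => ‖f x‖ₑ) := by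
  obtain ⟨hP, C, hC⟩ := hp
  refine ⟨2 ^ n * C, fun R hR f hf hfin => ?_⟩
  set V := 2 ^ n * volume (ball (0 : E n) R) with hV
  have hV0 : V ≠ 0 := mul_ne_zero (by positivity) (measure_ball_pos _ _ hR).ne'
  have hVt : V ≠ ∞ := ENNReal.mul_ne_top (by simp) measure_ball_lt_top.ne
  set I := ∫⁻ y in ball 0 R, ‖f y‖ₑ with hI
  have hc : V⁻¹ * I ≠ ∞ := ENNReal.mul_ne_top (ENNReal.inv_ne_top.2 hV0) hfin
  rcases eq_or_ne I 0 with h0 | h0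
  · simp [h0]
  have hc0 : V⁻¹ * I ≠ 0 := mul_ne_zero (ENNReal.inv_ne_zero.2 hVt) h0
  have h1 : (V⁻¹ * I) * luxNorm p (chi (ball 0 R)) ≤ C * luxNorm p (fun x => ‖f x‖ₑ) := by
    refine le_trans ?_ (hC f hf)
    rw [← ENNReal.coe_toNNReal hc, ← luxNorm_const_mul hP.pos (by
      rw [ne_eq, ENNReal.toNNReal_eq_zero_iff]; tauto), ENNReal.coe_toNNReal hc]
    exact luxNorm_mono hP.nonneg fun x => chi_ball_mul_le_maximalFn hR f x
  calc luxNorm p (chi (ball 0 R)) * I = V * ((V⁻¹ * I) * luxNorm p (chi (ball 0 R))) := by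
        rw [← mul_assoc, ← mul_assoc, ENNReal.mul_inv_cancel hV0 hVt, one_mul, mul_comm]
    _ ≤ V * (C * luxNorm p (fun x => ‖f x‖ₑ)) := by gcongr
    _ = _ := by rw [hV]; push_cast; ring

/-- The maximal bound is tested on the characteristic function of `S`. When `S` fills a fixed
proportion of the ball, as an annulus does, the two norms are comparable. -/
theorem ClassB.exists_luxNorm_chi_ball_mul_volume_le (hp : ClassB p) :
    ∃ C : ℝ≥0, ∀ R : ℝ, 0 < R → ∀ S : Set (E n), MeasurableSet S → S ⊆ ball 0 R →
      luxNorm p (chi (ball 0 R)) * volume S ≤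
        C * volume (ball (0 : E n) R) * luxNorm p (chi S) := by
  obtain ⟨C, hC⟩ := hp.exists_luxNorm_chi_ball_mul_lintegral_le
  refine ⟨C, fun R hR S hS hSR => ?_⟩
  have he : (fun y => ‖S.indicator (1 : E n → ℂ) y‖ₑ) = chi S := by
    ext y
    by_cases h : y ∈ S <;> simp [chi, h]
  have hv : ∫⁻ y in ball 0 R, ‖S.indicator (1 : E n → ℂ) y‖ₑ = volume S := by
    rw [he, chi, lintegral_indicator_one hS, Measure.restrict_apply hS,
      Set.inter_eq_left.2 hSR]
  have := hC R hR (S.indicator 1) (aestronglyMeasurable_one.indicator hS) (by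
    rw [hv]; exact ((measure_mono hSR).trans_lt measure_ball_lt_top).ne)
  rwa [hv, he] at this

/-- The maximal bound is tested on a near-extremal function for the duality between `p` and `p'`: it
has `p`-norm at most `1`, and its integral over the ball is at least a fixed fraction of the
`p'`-norm of the characteristic function. -/
theorem ClassB.exists_luxNorm_chi_mul_conj_le (hp : ClassB p) :
    ∃ C : ℝ≥0, ∀ R : ℝ, 0 < R →
      luxNorm p (chi (ball 0 R)) * luxNorm (conjExp p) (chi (ball 0 R)) ≤
        C * volume (ball (0 : E n) R) := by
  obtain ⟨C, hC⟩ := hp.exists_luxNorm_chi_ball_mul_lintegral_le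
  have hP := hp.1
  obtain ⟨hqm, a, b, ha, hab⟩ := hP.conjExp
  refine ⟨4 ^ b.toNNReal.1 * C, fun R hR => ?_⟩
  have hb0 : 0 ≤ b := by
    obtain ⟨x, hx⟩ := hab.exists
    linarith [hx.1, hx.2]
  have hbb : b.toNNReal.1 = b := Real.coe_toNNReal _ hb0
  set B := ball (0 : E n) R with hB
  have hBm : MeasurableSet B := measurableSet_ball
  set Λ := luxNorm (conjExp p) (chi B) with hΛ
  have hΛt : Λ ≠ ∞ := luxNorm_chi_ne_top hBm hP.conjExp.one_le measure_ball_lt_top.ne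
  have hΛ0 : Λ ≠ 0 := luxNorm_chi_ne_zero hBm hP.conjExp.one_le (measure_ball_pos _ _ hR).ne'
  set l := Λ.toNNReal with hl
  have hlc : (l : ℝ≥0∞) = Λ := ENNReal.coe_toNNReal hΛt
  have hl0 : 0 < l := ENNReal.toNNReal_pos hΛ0 hΛt
  have hz0 : (2 * l : ℝ≥0) ≠ 0 := (by positivity : (0 : ℝ≥0) < 2 * l).ne'
  -- Since `p (p' - 1) = p'`, the `p`-modular of `F` is `∫_B (2l)^{-p'}`, which is at most `1`
  -- because `2l` exceeds the norm `l`.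
  set F : E n → ℝ≥0 := B.indicator fun x => (2 * l) ^ (-(conjExp p x - 1)) with hF
  have hFm : Measurable F :=
    (measurable_const.pow (hqm.sub_const 1).neg).indicator hBm
  have hFe : ∀ t : ℝ≥0, ‖((t : ℝ) : ℂ)‖ₑ = t := fun t => by
    rw [← ofReal_norm, Complex.norm_real]
    simp
  have hup : ∫⁻ x in B, (((2 * l : ℝ≥0) : ℝ≥0∞)⁻¹) ^ conjExp p x ≤ 1 := by
    rw [← lintegral_chi_div_rpow hBm hP.conjExp.pos]
    refine lintegral_le_one_of_luxNorm_lt hP.conjExp.nonneg ?_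
    rw [← hΛ, ← hlc]
    have : l < 2 * l := by rw [two_mul]; exact lt_add_of_pos_left l hl0
    exact_mod_cast this
  -- The scale `l / 2` is below the norm, so its modular exceeds `1`. Passing to `2l = 4 (l / 2)`
  -- costs at most `4 ^ b`, with `b` an upper bound for `p'`.
  have hlow : 1 < ∫⁻ x in B, (((l / 2 : ℝ≥0) : ℝ≥0∞)⁻¹) ^ conjExp p x := by
    by_contra! h
    rw [← lintegral_chi_div_rpow hBm hP.conjExp.pos] at h
    have h2 := luxNorm_le_of_lintegral_le (by positivity) h
    rw [← hΛ, ← hlc] at h2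
    have h3 : l ≤ l / 2 := by exact_mod_cast h2
    exact absurd h3 (not_le.2 (NNReal.half_lt_self hl0.ne'))
  have hFint : ∫⁻ x in B, ‖((F x : ℝ) : ℂ)‖ₑ =
      ((2 * l : ℝ≥0) : ℝ≥0∞) * ∫⁻ x in B, (((2 * l : ℝ≥0) : ℝ≥0∞)⁻¹) ^ conjExp p x := by
    rw [← lintegral_const_mul' _ _ ENNReal.coe_ne_top]
    refine setLIntegral_congr_fun hBm fun x hx => ?_
    simp only [hFe, hF, Set.indicator_of_mem hx]
    rw [← ENNReal.coe_inv hz0, ← ENNReal.coe_rpow_of_ne_zero (inv_ne_zero hz0), ← ENNReal.coe_mul]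
    congr 1
    rw [neg_sub, NNReal.rpow_sub hz0, NNReal.rpow_one, NNReal.inv_rpow, div_eq_mul_inv]
  have hFnorm : luxNorm p (fun x => ‖((F x : ℝ) : ℂ)‖ₑ) ≤ 1 := by
    refine (luxNorm_le_of_lintegral_le (η := 1) one_pos ?_).trans_eq ENNReal.coe_one
    refine le_trans (le_of_eq ?_) hup
    rw [← lintegral_indicator hBm]
    refine lintegral_congr_ae ?_
    filter_upwards [hP.one_lt] with x hx
    by_cases hxB : x ∈ B
    · simp only [hFe, hF, Set.indicator_of_mem hxB]
      rw [ENNReal.coe_one, div_one, ← ENNReal.coe_inv hz0,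
        ← ENNReal.coe_rpow_of_ne_zero (inv_ne_zero hz0),
        ENNReal.coe_rpow_of_ne_zero hz0, ← ENNReal.rpow_mul,
        ENNReal.coe_rpow_of_ne_zero (inv_ne_zero hz0), ENNReal.coe_inv hz0, ENNReal.inv_rpow,
        ← ENNReal.rpow_neg]
      congr 1
      have : p x - 1 ≠ 0 := by linarith
      unfold conjExp
      field_simp
      ring
    · simp [hF, hxB, zero_lt_one.trans hx]
  have hFlow : (4 ^ b : ℝ≥0∞)⁻¹ * Λ ≤ ∫⁻ x in B, ‖((F x : ℝ) : ℂ)‖ₑ := by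
    rw [hFint]
    have : ∀ᵐ x ∂(volume.restrict B), (4 ^ b : ℝ≥0∞)⁻¹ *
        (((l / 2 : ℝ≥0) : ℝ≥0∞)⁻¹) ^ conjExp p x ≤
          (((2 * l : ℝ≥0) : ℝ≥0∞)⁻¹) ^ conjExp p x := by
      refine ae_restrict_of_ae ?_
      filter_upwards [hab] with x hx
      have h4 : (2 * l : ℝ≥0) = 4 * (l / 2) := by
        rw [show (4 : ℝ≥0) = 2 * 2 by norm_num, mul_assoc, mul_div_cancel₀ _ two_ne_zero]
      have hx0 : 0 ≤ conjExp p x := by linarith [hx.1]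
      rw [h4, ENNReal.coe_mul, ENNReal.mul_inv (by simp) (by simp),
        ENNReal.mul_rpow_of_nonneg _ _ hx0]
      gcongr
      rw [ENNReal.inv_rpow]
      gcongr
      exact ENNReal.rpow_le_rpow_of_exponent_le (by norm_num) hx.2
    calc (4 ^ b : ℝ≥0∞)⁻¹ * Λ ≤ ((2 * l : ℝ≥0) : ℝ≥0∞) * ((4 ^ b : ℝ≥0∞)⁻¹ * 1) := by
          rw [mul_one, mul_comm]
          gcongr
          rw [← hlc]
          exact_mod_cast le_mul_of_one_le_left' one_le_two
      _ ≤ ((2 * l : ℝ≥0) : ℝ≥0∞) * ((4 ^ b : ℝ≥0∞)⁻¹ *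
            ∫⁻ x in B, (((l / 2 : ℝ≥0) : ℝ≥0∞)⁻¹) ^ conjExp p x) := by gcongr
      _ ≤ _ := by
          rw [← lintegral_const_mul' _ _ (by simp)]
          exact mul_le_mul_right (lintegral_mono_ae this) _
  have hfin : ∫⁻ x in B, ‖((F x : ℝ) : ℂ)‖ₑ ≠ ∞ := by
    rw [hFint]
    exact ENNReal.mul_ne_top ENNReal.coe_ne_top (hup.trans_lt ENNReal.one_lt_top).ne
  have hmain := hC R hR (fun x => ((F x : ℝ) : ℂ))
    (Complex.measurable_ofReal.comp (measurable_coe_nnreal_real.comp hFm)).aestronglyMeasurable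
    hfin
  have h4 : (4 ^ b : ℝ≥0∞) ≠ 0 := by simp
  have h4' : (4 ^ b : ℝ≥0∞) ≠ ∞ := by simp
  calc luxNorm p (chi B) * Λ = 4 ^ b * (luxNorm p (chi B) * ((4 ^ b : ℝ≥0∞)⁻¹ * Λ)) := by
        rw [mul_left_comm (luxNorm p (chi B)), ← mul_assoc, ENNReal.mul_inv_cancel h4 h4', one_mul]
    _ ≤ 4 ^ b * (C * volume B * 1) := by
        refine mul_le_mul_right ((mul_le_mul_right hFlow _).trans (hmain.trans ?_)) _
        exact mul_le_mul_right hFnorm _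
    _ = _ := by
        rw [mul_one, hbb, ENNReal.coe_mul, ENNReal.coe_rpow_of_nonneg _ hb0, mul_assoc]
        norm_num

end MaximalBound

/-! ### Powers of two and the grand Morrey quasi-norm of sequences. -/

section Sequences

theorem two_rpow_ne_zero (a : ℝ) : (2 : ℝ≥0∞) ^ a ≠ 0 := by simp

theorem two_rpow_ne_top (a : ℝ) : (2 : ℝ≥0∞) ^ a ≠ ∞ := by simp

theorem two_rpow_add (a b : ℝ) : (2 : ℝ≥0∞) ^ (a + b) = 2 ^ a * 2 ^ b :=
  ENNReal.rpow_add _ _ (by simp) (by simp)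

theorem two_rpow_le {a b : ℝ} (h : a ≤ b) : (2 : ℝ≥0∞) ^ a ≤ 2 ^ b :=
  ENNReal.rpow_le_rpow_of_exponent_le (by norm_num) h

theorem two_rpow_neg_mul_self (a : ℝ) : (2 : ℝ≥0∞) ^ (-a) * 2 ^ a = 1 := by
  rw [← two_rpow_add, neg_add_cancel, ENNReal.rpow_zero]

theorem ofReal_two_rpow (a : ℝ) : ENNReal.ofReal ((2 : ℝ) ^ a) = (2 : ℝ≥0∞) ^ a := by
  rw [← ENNReal.ofReal_rpow_of_pos (by norm_num)]
  norm_num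

theorem ofReal_two_zpow (k : ℤ) : ENNReal.ofReal ((2 : ℝ) ^ k) = (2 : ℝ≥0∞) ^ (k : ℝ) := by
  rw [← ofReal_two_rpow, Real.rpow_intCast]

theorem tsum_two_rpow_neg_abs_ne_top {a : ℝ} (ha : 0 < a) :
    ∑' l : ℤ, (2 : ℝ≥0∞) ^ (-(a * |(l : ℝ)|)) ≠ ∞ := by
  have hr : (2 : ℝ) ^ (-a) < 1 := Real.rpow_lt_one_of_one_lt_of_neg (by norm_num) (by linarith)
  have hs : Summable fun l : ℤ => (2 : ℝ) ^ (-(a * |(l : ℝ)|)) := by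
    have h : Summable fun m : ℕ => (2 : ℝ) ^ (-(a * (m : ℝ))) := by
      simp_rw [← neg_mul, Real.rpow_mul (by norm_num : (0 : ℝ) ≤ 2), Real.rpow_natCast]
      exact summable_geometric_of_lt_one (by positivity) hr
    refine Summable.of_nat_of_neg ?_ ?_ <;> simpa using h
  simp_rw [← ofReal_two_rpow]
  exact hs.tsum_ofReal_lt_top.ne

variable {u θ Γ : ℝ}

theorem grandMorreyNorm_mono {c d : ℤ → ℝ≥0∞} (hu : 0 < u) (h : ∀ k, c k ≤ d k) :
    grandMorreyNorm u θ Γ c ≤ grandMorreyNorm u θ Γ d := by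
  refine iSup_mono fun ϑ => iSup_mono fun hϑ => iSup_mono fun m₀ => ?_
  gcongr with k
  exact h k

theorem grandMorreyNorm_const_mul_le (hu : 0 < u) (A : ℝ≥0∞) (c : ℤ → ℝ≥0∞) :
    grandMorreyNorm u θ Γ (fun k => A * c k) ≤ A * grandMorreyNorm u θ Γ c := by
  refine iSup_le fun ϑ => iSup_le fun hϑ => iSup_le fun m₀ => ?_
  have hq : 0 < u * (1 + ϑ) := by positivity
  refine le_of_eq_of_le ?_ (mul_le_mul_right (le_iSup_of_le ϑ (le_iSup_of_le hϑ
    (le_iSup_of_le m₀ le_rfl))) A)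
  simp_rw [ENNReal.mul_rpow_of_nonneg _ _ hq.le]
  rw [ENNReal.tsum_mul_left, mul_left_comm (ENNReal.ofReal _), ENNReal.mul_rpow_of_nonneg _ _
    (by positivity), one_div, ENNReal.rpow_rpow_inv hq.ne', mul_left_comm]

theorem ofReal_mul_tsum_rpow_le (c : ℤ → ℝ≥0∞) (hu : 0 < u) {ϑ : ℝ} (hϑ : 0 < ϑ) (m₀ : ℤ) :
    ENNReal.ofReal (ϑ ^ θ) * ∑' k : Set.Iic m₀, c k ^ (u * (1 + ϑ)) ≤
      (2 ^ ((m₀ : ℝ) * Γ) * grandMorreyNorm u θ Γ c) ^ (u * (1 + ϑ)) := by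
  have hq : 0 < u * (1 + ϑ) := by positivity
  rw [← ENNReal.rpow_inv_le_iff hq, ← one_div]
  have h : (2 : ℝ≥0∞) ^ (-(m₀ : ℝ) * Γ) *
      (ENNReal.ofReal (ϑ ^ θ) * ∑' k : Set.Iic m₀, c k ^ (u * (1 + ϑ))) ^ (1 / (u * (1 + ϑ))) ≤
        grandMorreyNorm u θ Γ c :=
    le_iSup_of_le ϑ (le_iSup_of_le hϑ (le_iSup_of_le m₀ le_rfl))
  refine le_trans ?_ (mul_le_mul_right h _)
  rw [← mul_assoc, neg_mul, mul_comm (_ ^ _) (2 ^ (-_)), two_rpow_neg_mul_self, one_mul]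

theorem le_two_rpow_mul_grandMorreyNorm (hu : 0 < u) (c : ℤ → ℝ≥0∞) (k : ℤ) :
    c k ≤ 2 ^ ((k : ℝ) * Γ) * grandMorreyNorm u θ Γ c := by
  -- Taking `ϑ = 1` makes `ϑ ^ θ` equal to `1`, and `m₀ = k` keeps the `k`-th term in the sum.
  have h := ofReal_mul_tsum_rpow_le (θ := θ) (Γ := Γ) c hu one_pos k
  have hq : 0 < u * (1 + 1) := by positivity
  rw [Real.one_rpow, ENNReal.ofReal_one, one_mul] at h
  have h2 := (ENNReal.le_tsum (f := fun j : Set.Iic k => c j ^ (u * (1 + 1))) ⟨k, Set.mem_Iic.2 le_rfl⟩).trans h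
  exact (ENNReal.rpow_le_rpow_iff hq).1 h2

theorem tsum_shift_Iic (c : ℤ → ℝ≥0∞) (m₀ l : ℤ) :
    ∑' k : Set.Iic m₀, c (k + l) = ∑' k : Set.Iic (m₀ + l), c k := by
  let e : Set.Iic m₀ ≃ Set.Iic (m₀ + l) :=
    (Equiv.addRight l).subtypeEquiv fun a => by simp
  exact e.tsum_eq (fun k : Set.Iic (m₀ + l) => c k)

/-- Each `x i` is at most `w i` times the `ℓ^q` norm of `x / w`. No convexity enters, so every `q >
0` is allowed, including `q < 1`. -/
theorem rpow_tsum_le_mul_tsum_rpow {ι : Type*} (w x : ι → ℝ≥0∞) (hw : ∀ i, w i ≠ 0)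
    (hw' : ∀ i, w i ≠ ∞) {q : ℝ} (hq : 0 < q) :
    (∑' i, x i) ^ q ≤ (∑' i, w i) ^ q * ∑' i, ((w i)⁻¹ * x i) ^ q := by
  set M := (∑' i, ((w i)⁻¹ * x i) ^ q) ^ q⁻¹ with hM
  have hMq : M ^ q = ∑' i, ((w i)⁻¹ * x i) ^ q := ENNReal.rpow_inv_rpow hq.ne' _
  have h1 : ∀ i, x i ≤ w i * M := fun i => by
    have : (w i)⁻¹ * x i ≤ M := by
      rw [hM, ENNReal.le_rpow_inv_iff hq]
      exact ENNReal.le_tsum (f := fun i => ((w i)⁻¹ * x i) ^ q) i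
    rwa [ENNReal.inv_mul_le_iff (hw i) (hw' i)] at this
  rw [← hMq, ← ENNReal.mul_rpow_of_nonneg _ _ hq.le, ← ENNReal.tsum_mul_right]
  gcongr with i
  exact h1 i

/-- Discrete convolution with an exponentially decaying kernel is bounded for the grand Morrey
quasi-norm. -/
theorem exists_grandMorreyNorm_conv_le (hu : 0 < u) {ε : ℝ} (hε : 0 < ε) :
    ∃ C : ℝ≥0, ∀ c d : ℤ → ℝ≥0∞,
      (∀ j, d j ≤ ∑' l : ℤ, 2 ^ (-(ε * |(l : ℝ)|) - Γ * l) * c (j + l)) →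
        grandMorreyNorm u θ Γ d ≤ C * grandMorreyNorm u θ Γ c := by
  set S := ∑' l : ℤ, (2 : ℝ≥0∞) ^ (-(ε / 2 * |(l : ℝ)|)) with hS
  have hSt : S ≠ ∞ := tsum_two_rpow_neg_abs_ne_top (by positivity)
  set Su := ∑' l : ℤ, (2 : ℝ≥0∞) ^ (-(ε / 2 * u * |(l : ℝ)|)) with hSu
  have hSut : Su ≠ ∞ := tsum_two_rpow_neg_abs_ne_top (by positivity)
  -- This makes `Su ^ (1 / q) ≤ Su ^ (1 / u)` for every `q = u (1 + ϑ)`, hence a constant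
  -- independent of `ϑ`.
  have hSu1 : 1 ≤ Su := by
    refine le_trans ?_ (ENNReal.le_tsum (0 : ℤ))
    simp
  have hCt : S * Su ^ (1 / u) ≠ ∞ :=
    ENNReal.mul_ne_top hSt (ENNReal.rpow_ne_top_of_nonneg (by positivity) hSut)
  refine ⟨(S * Su ^ (1 / u)).toNNReal, fun c d hcd => ?_⟩
  rw [ENNReal.coe_toNNReal hCt]
  refine iSup_le fun ϑ => iSup_le fun hϑ => iSup_le fun m₀ => ?_
  set q := u * (1 + ϑ) with hq
  have hq0 : 0 < q := by positivity
  have huq : u ≤ q := le_mul_of_one_le_right hu.le (by linarith)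
  set K := grandMorreyNorm u θ Γ c with hK
  have key : ENNReal.ofReal (ϑ ^ θ) * ∑' k : Set.Iic m₀, d k ^ q ≤
      (S * (2 ^ ((m₀ : ℝ) * Γ) * K)) ^ q * Su := by
    calc ENNReal.ofReal (ϑ ^ θ) * ∑' k : Set.Iic m₀, d k ^ q
        ≤ ENNReal.ofReal (ϑ ^ θ) * ∑' k : Set.Iic m₀, S ^ q * ∑' l : ℤ,
            ((2 ^ (-(ε / 2 * |(l : ℝ)|)))⁻¹ *
              (2 ^ (-(ε * |(l : ℝ)|) - Γ * l) * c (k + l))) ^ q := by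
          refine mul_le_mul_right (ENNReal.tsum_le_tsum fun k => ?_) _
          -- Half of the exponential decay serves as the weight `w`; the other half remains for the
          -- sum over `l`.
          refine (ENNReal.rpow_le_rpow (hcd k) hq0.le).trans ?_
          exact rpow_tsum_le_mul_tsum_rpow _ _ (fun l => two_rpow_ne_zero _)
            (fun l => two_rpow_ne_top _) hq0
      _ = S ^ q * ∑' l : ℤ, (2 ^ (-(ε / 2 * |(l : ℝ)|) - Γ * l)) ^ q *
            (ENNReal.ofReal (ϑ ^ θ) * ∑' k : Set.Iic m₀, c (k + l) ^ q) := by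
          rw [ENNReal.tsum_mul_left, ENNReal.tsum_comm, mul_left_comm, ← ENNReal.tsum_mul_left]
          refine congrArg (S ^ q * ·) (tsum_congr fun l : ℤ => ?_)
          rw [mul_left_comm (_ ^ q), ← ENNReal.tsum_mul_left (a := (_ ^ q : ℝ≥0∞))]
          refine congrArg (ENNReal.ofReal (ϑ ^ θ) * ·) (tsum_congr fun k : Set.Iic m₀ => ?_)
          rw [← ENNReal.mul_rpow_of_nonneg _ _ hq0.le, ← mul_assoc, ← ENNReal.rpow_neg,
            ← two_rpow_add]
          congr 3
          ring
      _ ≤ S ^ q * ∑' l : ℤ, (2 ^ (-(ε / 2 * |(l : ℝ)|) - Γ * l)) ^ q *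
            (2 ^ (((m₀ + l : ℤ) : ℝ) * Γ) * K) ^ q := by
          gcongr with l
          -- The shift moves the cutoff from `m₀` to `m₀ + l`; the resulting factor `2 ^ (lΓ)` is
          -- what the `-Γ * l` in the kernel compensates.
          rw [tsum_shift_Iic (fun k => c k ^ q)]
          exact ofReal_mul_tsum_rpow_le c hu hϑ (m₀ + l)
      _ = S ^ q * ∑' l : ℤ, (2 ^ (-(ε / 2 * |(l : ℝ)|))) ^ q * (2 ^ ((m₀ : ℝ) * Γ) * K) ^ q := by
          congr 2
          ext l
          rw [← ENNReal.mul_rpow_of_nonneg _ _ hq0.le, ← ENNReal.mul_rpow_of_nonneg _ _ hq0.le,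
            ← mul_assoc, ← mul_assoc, ← two_rpow_add, ← two_rpow_add]
          congr 3
          push_cast
          ring
      _ ≤ S ^ q * (Su * (2 ^ ((m₀ : ℝ) * Γ) * K) ^ q) := by
          rw [ENNReal.tsum_mul_right]
          refine mul_le_mul_right (mul_le_mul_left (ENNReal.tsum_le_tsum fun l => ?_) _) _
          rw [← ENNReal.rpow_mul]
          refine two_rpow_le ?_
          nlinarith [mul_nonneg (mul_nonneg hε.le (abs_nonneg (l : ℝ))) (sub_nonneg.2 huq)]
      _ = _ := by rw [ENNReal.mul_rpow_of_nonneg S _ hq0.le]; ring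
  calc (2 : ℝ≥0∞) ^ (-(m₀ : ℝ) * Γ) *
        (ENNReal.ofReal (ϑ ^ θ) * ∑' k : Set.Iic m₀, d k ^ q) ^ (1 / q)
      ≤ (2 : ℝ≥0∞) ^ (-(m₀ : ℝ) * Γ) * ((S * (2 ^ ((m₀ : ℝ) * Γ) * K)) ^ q * Su) ^ (1 / q) := by
        gcongr
    _ = (2 ^ (-((m₀ : ℝ) * Γ)) * 2 ^ ((m₀ : ℝ) * Γ)) * (S * Su ^ (1 / q) * K) := by
        rw [ENNReal.mul_rpow_of_nonneg _ _ (by positivity), one_div, ENNReal.rpow_rpow_inv hq0.ne',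
          neg_mul]
        ring
    _ ≤ S * Su ^ (1 / u) * K := by
        rw [two_rpow_neg_mul_self, one_mul]
        gcongr

end Sequences

/-! ### Log-Hölder exponents on dyadic annuli. -/

section Exponents

variable {n : ℕ} {α : E n → ℝ} {αinf : ℝ}

theorem alphaAt_two_zpow (α : E n → ℝ) (αinf : ℝ) (k : ℤ) :
    alphaAt α αinf ((2 : ℝ) ^ k) = if k < 0 then α 0 else αinf := by
  unfold alphaAt
  congr 1
  exact propext (zpow_lt_one_iff_right₀ (by norm_num))

theorem mem_annulus {k : ℤ} {x : E n} :
    x ∈ annulus n k ↔ (2 : ℝ) ^ (k - 1) ≤ ‖x‖ ∧ ‖x‖ < (2 : ℝ) ^ k := by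
  simp [annulus, dyadicBall, and_comm]

/-- On the `k`-th annulus the logarithms in both continuity conditions are at least of the order of
`|k|`, so multiplying the oscillation by `|k|` leaves a bounded quantity. -/
theorem exists_abs_mul_sub_alphaAt_le (h0 : LogHolderAtOrigin α)
    (hinf : LogHolderAtInfinity α αinf) :
    ∃ B : ℝ, 0 ≤ B ∧ ∀ (k : ℤ) (x : E n), x ∈ annulus n k →
      |(k : ℝ)| * |α x - alphaAt α αinf ((2 : ℝ) ^ k)| ≤ B := by
  obtain ⟨C₀, hC₀⟩ := h0
  obtain ⟨C₁, hC₁⟩ := hinf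
  have hl2 : 0 < Real.log 2 := Real.log_pos (by norm_num)
  refine ⟨|C₀| / Real.log 2 + |C₁| * (1 / Real.log 2 + 1), by positivity, fun k x hx => ?_⟩
  rw [mem_annulus] at hx
  have hx0 : 0 < ‖x‖ := lt_of_lt_of_le (by positivity) hx.1
  rw [alphaAt_two_zpow]
  split_ifs with hk
  · have hk' : (k : ℝ) ≤ -1 := by exact_mod_cast Int.le_sub_one_of_lt hk
    have hxh : ‖x‖ ≤ 1 / 2 := by
      refine hx.2.le.trans ?_
      rw [show (1 / 2 : ℝ) = 2 ^ (-1 : ℤ) by norm_num]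
      exact zpow_le_zpow_right₀ (by norm_num) (by omega)
    have h := hC₀ x (norm_pos_iff.1 hx0) hxh
    have hlog : -(k : ℝ) * Real.log 2 ≤ -Real.log ‖x‖ := by
      have := Real.log_le_log hx0 hx.2.le
      rw [Real.log_zpow] at this
      linarith
    have hpos : 0 < -(k : ℝ) * Real.log 2 := mul_pos (by linarith) hl2
    have h2 : |α x - α 0| ≤ |C₀| / (-(k : ℝ) * Real.log 2) := by
      refine h.trans ?_
      refine (div_le_div_of_nonneg_right (le_abs_self C₀) (hpos.le.trans hlog)).trans ?_
      gcongr
    rw [abs_of_neg (by linarith : (k : ℝ) < 0)]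
    calc -(k : ℝ) * |α x - α 0| ≤ -(k : ℝ) * (|C₀| / (-(k : ℝ) * Real.log 2)) := by
          gcongr
          linarith
      _ = |C₀| / Real.log 2 := by
          have : (k : ℝ) ≠ 0 := by linarith
          field_simp
      _ ≤ _ := le_add_of_nonneg_right (by positivity)
  · have hk' : (0 : ℝ) ≤ k := by exact_mod_cast not_lt.1 hk
    have h := hC₁ x
    set L := Real.log (Real.exp 1 + ‖x‖) with hL
    have hL1 : 1 ≤ L := by
      have := Real.log_le_log (Real.exp_pos 1) (le_add_of_nonneg_right hx0.le : Real.exp 1 ≤ _)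
      rwa [Real.log_exp] at this
    have hLk : ((k : ℝ) - 1) * Real.log 2 ≤ L := by
      have := Real.log_le_log (by positivity)
        (hx.1.trans (le_add_of_nonneg_left (Real.exp_pos 1).le))
      rw [Real.log_zpow] at this
      push_cast at this
      exact this
    have hkL : (k : ℝ) ≤ L * (1 / Real.log 2 + 1) := by
      have : (k : ℝ) - 1 ≤ L / Real.log 2 := by rwa [le_div_iff₀ hl2]
      calc (k : ℝ) ≤ L / Real.log 2 + 1 := by linarith
        _ ≤ L / Real.log 2 + L := by linarith
        _ = _ := by ring
    rw [abs_of_nonneg hk']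
    calc (k : ℝ) * |α x - αinf| ≤ L * (1 / Real.log 2 + 1) * (|C₁| / L) := by
          gcongr
          exact h.trans (div_le_div_of_nonneg_right (le_abs_self _) (by linarith))
      _ = |C₁| * (1 / Real.log 2 + 1) := by
          have : L ≠ 0 := by linarith
          field_simp
      _ ≤ _ := le_add_of_nonneg_left (by positivity)

theorem exists_two_rpow_mul_comparable (h0 : LogHolderAtOrigin α)
    (hinf : LogHolderAtInfinity α αinf) :
    ∃ A : ℝ≥0, A ≠ 0 ∧ ∀ (k : ℤ) (x : E n), x ∈ annulus n k →
      (2 : ℝ≥0∞) ^ ((k : ℝ) * α x) ≤ A * 2 ^ ((k : ℝ) * alphaAt α αinf ((2 : ℝ) ^ k)) ∧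
      (2 : ℝ≥0∞) ^ ((k : ℝ) * alphaAt α αinf ((2 : ℝ) ^ k)) ≤ A * 2 ^ ((k : ℝ) * α x) := by
  obtain ⟨B, hB0, hB⟩ := exists_abs_mul_sub_alphaAt_le h0 hinf
  refine ⟨2 ^ B, by positivity, fun k x hx => ?_⟩
  have h := hB k x hx
  rw [← abs_mul, mul_sub, abs_le] at h
  rw [ENNReal.coe_rpow_of_nonneg _ hB0, ENNReal.coe_ofNat, ← two_rpow_add, ← two_rpow_add]
  exact ⟨two_rpow_le (by linarith), two_rpow_le (by linarith)⟩

theorem measurableSet_annulus (k : ℤ) : MeasurableSet (annulus n k) :=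
  measurableSet_ball.diff measurableSet_ball

theorem volume_dyadicBall (k : ℤ) :
    volume (dyadicBall n k) = 2 ^ ((k : ℝ) * n) * volume (ball (0 : E n) 1) := by
  rw [dyadicBall, volume_ball_eq _ (by positivity), ENNReal.ofReal_pow (by positivity),
    ofReal_two_zpow, ENNReal.rpow_mul, ENNReal.rpow_natCast]

theorem annulus_subset (k : ℤ) : annulus n k ⊆ dyadicBall n k := Set.sdiff_subset

theorem dyadicBall_subset {j k : ℤ} (h : j ≤ k) : dyadicBall n j ⊆ dyadicBall n k :=
  ball_subset_ball (zpow_le_zpow_right₀ (by norm_num) h)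

/-- Because `n ≥ 1`, the inner ball takes up at most half of the volume of the outer one. -/
theorem volume_dyadicBall_le_volume_annulus (hn : 1 ≤ n) (k : ℤ) :
    volume (dyadicBall n k) ≤ 2 * volume (annulus n k) := by
  have h1 : volume (dyadicBall n k) ≤ volume (annulus n k) + volume (dyadicBall n (k - 1)) := by
    refine le_trans (measure_mono ?_) (measure_union_le _ _)
    intro x hx
    by_cases h : x ∈ dyadicBall n (k - 1)
    · exact Or.inr h
    · exact Or.inl ⟨hx, h⟩
  have h2 : 2 * volume (dyadicBall n (k - 1)) ≤ volume (dyadicBall n k) := by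
    rw [volume_dyadicBall, volume_dyadicBall, ← mul_assoc]
    gcongr
    nth_rewrite 1 [← ENNReal.rpow_one 2]
    rw [← two_rpow_add]
    refine two_rpow_le ?_
    have : (1 : ℝ) ≤ n := by exact_mod_cast hn
    push_cast
    nlinarith
  have hf : volume (dyadicBall n k) ≠ ∞ := measure_ball_lt_top.ne
  have h3 : 2 * volume (dyadicBall n k) ≤ 2 * volume (annulus n k) + volume (dyadicBall n k) := by
    calc 2 * volume (dyadicBall n k) ≤ 2 * (volume (annulus n k) + volume (dyadicBall n (k - 1))) :=
          by gcongr
      _ ≤ _ := by rw [mul_add]; gcongr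
  rw [two_mul (volume (dyadicBall n k))] at h3
  exact (ENNReal.add_le_add_iff_right hf).1 h3

theorem volume_annulus_ne_zero (hn : 1 ≤ n) (k : ℤ) : volume (annulus n k) ≠ 0 := by
  intro h
  have := volume_dyadicBall_le_volume_annulus hn k
  rw [h, mul_zero] at this
  exact (measure_ball_pos volume (0 : E n) (by positivity : (0 : ℝ) < 2 ^ k)).ne'
    (le_antisymm this zero_le)

/-- An a.e. bound says nothing directly about the value at `0`. But each annulus has positive
measure, hence contains a point where the bound holds, and there `α` differs from `α_k` by
`O(1/|k|)`; let `k → ±∞`. -/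
theorem le_alphaAt_of_ae_le (hn : 1 ≤ n) (h0 : LogHolderAtOrigin α)
    (hinf : LogHolderAtInfinity α αinf) {β : ℝ} (hβ : ∀ᵐ x, β ≤ α x) :
    β ≤ α 0 ∧ β ≤ αinf := by
  obtain ⟨B, hB0, hB⟩ := exists_abs_mul_sub_alphaAt_le h0 hinf
  have key : ∀ k : ℤ, |(k : ℝ)| * (β - alphaAt α αinf ((2 : ℝ) ^ k)) ≤ B := by
    intro k
    have hex : ∃ x ∈ annulus n k, β ≤ α x := by
      by_contra! hcon
      refine volume_annulus_ne_zero hn k (measure_mono_null (fun x hx => ?_) hβ)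
      exact not_le.2 (hcon x hx)
    obtain ⟨x, hx, hβx⟩ := hex
    refine le_trans ?_ (hB k x hx)
    gcongr
    exact (sub_le_sub_right hβx _).trans (le_abs_self _)
  have lim : ∀ a : ℝ, (∀ m : ℕ, ((m : ℝ) + 1) * (β - a) ≤ B) → β ≤ a := by
    intro a h
    by_contra! hlt
    obtain ⟨m, hm⟩ := exists_nat_gt (B / (β - a))
    rw [div_lt_iff₀ (by linarith)] at hm
    linarith [h m]
  constructor
  · refine lim _ fun m => ?_
    have := key (-((m : ℤ) + 1))
    rw [alphaAt_two_zpow, if_pos (by omega)] at this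
    push_cast at this
    rwa [abs_neg, abs_of_nonneg (by positivity)] at this
  · refine lim _ fun m => ?_
    have := key ((m : ℤ) + 1)
    rw [alphaAt_two_zpow, if_neg (by omega)] at this
    push_cast at this
    rwa [abs_of_nonneg (by positivity)] at this

end Exponents

/-! ### Multilinear maps evaluated on the coordinate basis. -/

section Multilinear

variable {n : ℕ}

/-- The multi-index recording how often each direction occurs in `d`. -/
def countIndex {j : ℕ} (d : Fin j → Fin n) (i : Fin n) : ℕ :=
  (Finset.univ.filter fun l => d l = i).card

theorem sum_countIndex {j : ℕ} (d : Fin j → Fin n) : ∑ i, countIndex d i = j := by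
  unfold countIndex
  rw [← Finset.card_eq_sum_card_fiberwise (fun _ _ => Finset.mem_coe.2 (Finset.mem_univ _))]
  simp

theorem monom_countIndex {j : ℕ} (d : Fin j → Fin n) (x : E n) :
    monom (countIndex d) x = ∏ l, x (d l) := by
  unfold monom countIndex
  rw [← Finset.prod_fiberwise Finset.univ d]
  refine Finset.prod_congr rfl fun i _ => ?_
  rw [Finset.prod_congr rfl (g := fun _ => x i), Finset.prod_const]
  intro l hl
  rw [(Finset.mem_filter.1 hl).2]

theorem sum_smul_single (x : E n) : ∑ i, x i • EuclideanSpace.single i (1 : ℝ) = x := by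
  ext k
  simp [Finset.sum_apply, Pi.single_apply]

theorem map_eq_sum_basis {j : ℕ} {F : Type*} [NormedAddCommGroup F] [NormedSpace ℝ F]
    (L : (E n) [×j]→L[ℝ] F) (v : Fin j → E n) :
    L v = ∑ d : Fin j → Fin n, (∏ l, v l (d l)) •
      L (fun l => EuclideanSpace.single (d l) (1 : ℝ)) := by
  have h : v = fun l => ∑ i, v l i • EuclideanSpace.single i (1 : ℝ) := by
    ext1 l
    rw [sum_smul_single]
  conv_lhs => rw [h]
  rw [L.map_sum]
  exact Finset.sum_congr rfl fun d _ => L.map_smul_univ _ _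

theorem abs_apply_le_norm (x : E n) (i : Fin n) : |x i| ≤ ‖x‖ := by
  simpa using PiLp.norm_apply_le x i

/-- The test class controls only partial derivatives along coordinate directions; expanding in the
basis into `n ^ j` terms turns this into control of the full derivative. -/
theorem norm_le_of_basis {j : ℕ} (L : (E n) [×j]→L[ℝ] ℂ) {A : ℝ} (hA : 0 ≤ A)
    (h : ∀ d : Fin j → Fin n, ‖L (fun l => EuclideanSpace.single (d l) (1 : ℝ))‖ ≤ A) :
    ‖L‖ ≤ (n : ℝ) ^ j * A := by
  refine L.opNorm_le_bound (by positivity) fun v => ?_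
  rw [map_eq_sum_basis L v]
  refine (norm_sum_le _ _).trans ?_
  have : ∀ d ∈ (Finset.univ : Finset (Fin j → Fin n)), ‖(∏ l, v l (d l)) •
      L (fun l => EuclideanSpace.single (d l) (1 : ℝ))‖ ≤ (∏ l, ‖v l‖) * A := by
    intro d _
    rw [norm_smul, norm_prod]
    gcongr with l
    · exact abs_apply_le_norm _ _
    · exact h d
  refine (Finset.sum_le_card_nsmul _ _ _ this).trans_eq ?_
  simp
  ring

theorem norm_le_sum_abs (x : E n) : ‖x‖ ≤ ∑ i, |x i| := by
  conv_lhs => rw [← sum_smul_single x]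
  refine (norm_sum_le _ _).trans_eq (Finset.sum_congr rfl fun i _ => ?_)
  simp [norm_smul]

theorem exists_norm_le_mul_abs (hn : 1 ≤ n) (x : E n) : ∃ i, ‖x‖ ≤ n * |x i| := by
  have : Nonempty (Fin n) := ⟨⟨0, hn⟩⟩
  obtain ⟨i, hi⟩ := Finite.exists_max fun i => |x i|
  refine ⟨i, (norm_le_sum_abs x).trans ?_⟩
  refine (Finset.sum_le_card_nsmul _ _ _ fun k _ => hi k).trans_eq ?_
  simp

end Multilinear

/-! ### Decay of test functions and of their dilates. -/

section TestClass

variable {n N : ℕ}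

/-- For `‖x‖ ≤ 1` the multi-index `0` suffices. Otherwise the pure power `x i ^ N` of the largest
coordinate is used, with `1 + ‖x‖ ≤ 2‖x‖ ≤ 2n|x i|`. The extra `n ^ N` counts coordinate directions.
-/
theorem one_add_pow_mul_norm_iteratedFDeriv_le (hn : 1 ≤ n) {φ : 𝓢(E n, ℂ)}
    (hφ : φ ∈ testClass n N) {j : ℕ} (hj : j ≤ N) (x : E n) :
    (1 + ‖x‖) ^ N * ‖iteratedFDeriv ℝ j φ x‖ ≤ (2 * n : ℝ) ^ N * n ^ N := by
  have hn' : (1 : ℝ) ≤ n := by exact_mod_cast hn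
  have hnj : (n : ℝ) ^ j ≤ n ^ N := pow_le_pow_right₀ hn' hj
  have hpos : 0 < (1 + ‖x‖) ^ N := by positivity
  suffices hall : ∀ d : Fin j → Fin n, (1 + ‖x‖) ^ N *
      ‖iteratedFDeriv ℝ j φ x (fun l => EuclideanSpace.single (d l) (1 : ℝ))‖ ≤
        (2 * n : ℝ) ^ N by
    have := norm_le_of_basis (iteratedFDeriv ℝ j φ x) (A := (2 * n) ^ N / (1 + ‖x‖) ^ N)
      (by positivity) fun d => by rw [le_div_iff₀' hpos]; exact hall d
    calc (1 + ‖x‖) ^ N * ‖iteratedFDeriv ℝ j φ x‖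
        ≤ (1 + ‖x‖) ^ N * (n ^ j * ((2 * n) ^ N / (1 + ‖x‖) ^ N)) := by gcongr
      _ = (2 * n) ^ N * n ^ j := by field_simp
      _ ≤ _ := by gcongr
  intro d
  rcases le_total ‖x‖ 1 with hx | hx
  · have h2 : (1 + ‖x‖) ^ N ≤ (2 * n : ℝ) ^ N := by
      gcongr
      linarith
    have := hφ 0 (by simp) j hj d x
    simp only [monom, Pi.zero_apply, pow_zero, Finset.prod_const_one, abs_one, one_mul] at this
    calc _ ≤ (2 * n : ℝ) ^ N * 1 := by gcongr
      _ = _ := mul_one _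
  · obtain ⟨i, hi⟩ := exists_norm_le_mul_abs hn x
    have hm : |x i| ^ N *
        ‖iteratedFDeriv ℝ j φ x (fun l => EuclideanSpace.single (d l) (1 : ℝ))‖ ≤ 1 := by
      have := hφ (Pi.single i N) (by simp) j hj d x
      have he : monom (Pi.single i N) x = x i ^ N := by
        unfold monom
        rw [Finset.prod_eq_single i]
        · simp
        · intro k _ hk
          simp [hk]
        · simp
      rwa [he, abs_pow] at this
    have h1 : (1 + ‖x‖) ^ N ≤ (2 * n) ^ N * |x i| ^ N := by
      rw [← mul_pow]
      gcongr
      nlinarith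
    calc _ ≤ (2 * n) ^ N * |x i| ^ N *
          ‖iteratedFDeriv ℝ j φ x (fun l => EuclideanSpace.single (d l) (1 : ℝ))‖ := by gcongr
      _ ≤ (2 * n : ℝ) ^ N * 1 := by
          rw [mul_assoc]
          gcongr
      _ = _ := mul_one _

theorem norm_iteratedFDeriv_comp_affine_le {F : Type*} [NormedAddCommGroup F] [NormedSpace ℝ F]
    {f : E n → F} {j : ℕ} (hf : ContDiff ℝ j f) (c : ℝ) (b x : E n) :
    ‖iteratedFDeriv ℝ j (fun w => f (c • w + b)) x‖ ≤
      |c| ^ j * ‖iteratedFDeriv ℝ j f (c • x + b)‖ := by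
  set L : E n →L[ℝ] E n := c • ContinuousLinearMap.id ℝ (E n) with hL
  have h1 : (fun w => f (c • w + b)) = (fun z => f (z + b)) ∘ L := by
    ext w
    simp [hL]
  have hf' : ContDiff ℝ j fun z => f (z + b) := hf.comp (contDiff_id.add contDiff_const)
  rw [h1, L.iteratedFDeriv_comp_right hf' x le_rfl, iteratedFDeriv_comp_add_right]
  refine (ContinuousMultilinearMap.norm_compContinuousLinearMap_le _ _).trans ?_
  rw [mul_comm, Finset.prod_const, Finset.card_univ, Fintype.card_fin]
  have hLn : ‖L‖ ≤ |c| := by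
    refine L.opNorm_le_bound (abs_nonneg c) fun v => ?_
    simp [hL, norm_smul]
  have hx : L x = c • x := by simp [hL]
  rw [hx]
  gcongr

theorem norm_iteratedFDeriv_dilTrans_le (φ : 𝓢(E n, ℂ)) {t : ℝ} (ht : 0 < t) (y z : E n) (j : ℕ) :
    ‖iteratedFDeriv ℝ j (dilTrans φ t ht y) z‖ ≤
      (t ^ (n + j))⁻¹ * ‖iteratedFDeriv ℝ j φ (t⁻¹ • (y - z))‖ := by
  have h1 : (dilTrans φ t ht y : E n → ℂ) =
      fun z => ((t : ℂ) ^ n)⁻¹ • (fun z => φ ((-t⁻¹) • z + t⁻¹ • y)) z := by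
    ext z
    rw [dilTrans_apply, smul_eq_mul]
    congr 2
    rw [smul_sub, neg_smul]
    abel
  have hφ : ContDiff ℝ j φ := φ.smooth j
  have hc : ContDiff ℝ j fun z => φ ((-t⁻¹) • z + t⁻¹ • y) :=
    hφ.comp ((contDiff_id.const_smul _).add contDiff_const)
  rw [h1, iteratedFDeriv_const_smul_apply' hc.contDiffAt, norm_smul]
  have h2 := norm_iteratedFDeriv_comp_affine_le hφ (-t⁻¹) (t⁻¹ • y) z
  have h3 : (-t⁻¹) • z + t⁻¹ • y = t⁻¹ • (y - z) := by
    rw [smul_sub, neg_smul]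
    abel
  rw [h3, abs_neg, abs_of_pos (by positivity)] at h2
  have h4 : ‖((t : ℂ) ^ n)⁻¹‖ = (t ^ n)⁻¹ := by
    rw [norm_inv, norm_pow, Complex.norm_real, Real.norm_of_nonneg ht.le]
  rw [h4]
  calc _ ≤ (t ^ n)⁻¹ * (t⁻¹ ^ j * ‖iteratedFDeriv ℝ j φ (t⁻¹ • (y - z))‖) := by gcongr
    _ = _ := by rw [pow_add, inv_pow, mul_inv, mul_assoc]

theorem norm_iteratedFDeriv_dilTrans_le_of_mem (hn : 1 ≤ n) {φ : 𝓢(E n, ℂ)}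
    (hφ : φ ∈ testClass n N) {t : ℝ} (ht : 0 < t) (y z : E n) {j : ℕ} (hj : j ≤ N) :
    ‖iteratedFDeriv ℝ j (dilTrans φ t ht y) z‖ ≤
      (2 * n : ℝ) ^ N * n ^ N * (t ^ (n + j))⁻¹ * ((1 + ‖y - z‖ / t) ^ N)⁻¹ := by
  refine (norm_iteratedFDeriv_dilTrans_le φ ht y z j).trans ?_
  have h := one_add_pow_mul_norm_iteratedFDeriv_le hn hφ hj (t⁻¹ • (y - z))
  have h1 : ‖t⁻¹ • (y - z)‖ = ‖y - z‖ / t := by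
    rw [norm_smul, norm_inv, Real.norm_of_nonneg ht.le]
    ring
  rw [h1] at h
  have hpos : 0 < (1 + ‖y - z‖ / t) ^ N := by positivity
  rw [← le_div_iff₀' hpos] at h
  calc _ ≤ (t ^ (n + j))⁻¹ * ((2 * n : ℝ) ^ N * n ^ N / (1 + ‖y - z‖ / t) ^ N) := by gcongr
    _ = _ := by ring

end TestClass

/-! ### Pairing a function with dilated test functions: maximal bound and moment decay. -/

section Pairing

variable {n N : ℕ}

theorem one_add_norm_div_le {t : ℝ} (ht : 0 < t) {x y z : E n} (hxy : ‖y - x‖ < t) :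
    1 + ‖x - z‖ / t ≤ 2 * (1 + ‖y - z‖ / t) := by
  have h1 : ‖x - z‖ ≤ ‖y - z‖ + t := by
    have : x - z = (y - z) - (y - x) := by abel
    rw [this]
    exact (norm_sub_le _ _).trans (by linarith)
  have h2 : ‖x - z‖ / t ≤ ‖y - z‖ / t + 1 := by
    rw [div_le_iff₀ ht, add_mul, div_mul_cancel₀ _ ht.ne', one_mul]
    exact h1
  have : 0 ≤ ‖y - z‖ / t := by positivity
  linarith

/-- A dyadic layering of the kernel. For the least `l` with `‖x - z‖ / t < 2 ^ l` one has `2 ^ l ≤ 2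
(1 + ‖x - z‖ / t)`, so that single term already dominates. -/
theorem ofReal_inv_one_add_pow_le_tsum {t : ℝ} (ht : 0 < t) (x z : E n) (N : ℕ) :
    ENNReal.ofReal ((1 + ‖x - z‖ / t) ^ N)⁻¹ ≤
      ∑' l : ℕ, 2 ^ N * ENNReal.ofReal (((2 : ℝ) ^ l) ^ N)⁻¹ * chi (ball x (2 ^ l * t)) z := by
  set w := ‖x - z‖ / t with hw
  have hw0 : 0 ≤ w := by positivity
  have hex : ∃ l : ℕ, w < 2 ^ l := pow_unbounded_of_one_lt w (by norm_num)
  classical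
  set l := Nat.find hex with hl
  have hlw : w < 2 ^ l := Nat.find_spec hex
  refine le_trans ?_ (ENNReal.le_tsum l)
  rw [chi_of_mem, mul_one]
  · have h2 : (2 : ℝ≥0∞) ^ N = ENNReal.ofReal (2 ^ N) := by
      rw [ENNReal.ofReal_pow (by norm_num)]
      norm_num
    rw [h2, ← ENNReal.ofReal_mul (by positivity)]
    refine ENNReal.ofReal_le_ofReal ?_
    have hle : (2 : ℝ) ^ l ≤ 2 * (1 + w) := by
      rcases Nat.eq_zero_or_pos l with h0 | h0
      · rw [h0, pow_zero]
        linarith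
      · have := Nat.find_min hex (m := l - 1) (by omega)
        push Not at this
        calc (2 : ℝ) ^ l = 2 * 2 ^ (l - 1) := by
              rw [← pow_succ', Nat.sub_add_cancel h0]
          _ ≤ _ := by linarith
    rw [← div_eq_mul_inv, ← div_pow, ← inv_pow]
    gcongr
    rw [inv_le_comm₀ (by positivity) (by positivity), inv_div, div_le_iff₀ (by norm_num)]
    linarith
  · rw [mem_ball, dist_comm, dist_eq_norm]
    rwa [hw, div_lt_iff₀ ht] at hlw

/-- The pairing with a dilated test function is controlled by the maximal function. -/
theorem exists_enorm_integral_dilTrans_le_maximalFn (hn : 1 ≤ n) (hN : n + 1 ≤ N) :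
    ∃ K : ℝ≥0, ∀ a : E n → ℂ, AEStronglyMeasurable a volume → ∀ φ ∈ testClass n N,
      ∀ (t : ℝ) (ht : 0 < t) (x y : E n), ‖y - x‖ < t →
        ‖∫ z, a z * dilTrans φ t ht y z‖ₑ ≤ K * maximalFn a x := by
  set K₀ : ℝ := (2 * n : ℝ) ^ N * n ^ N with hK₀
  set V := volume (ball (0 : E n) 1) with hV
  have hKt : ENNReal.ofReal (K₀ * 2 ^ N) * 2 ^ N * V * 2 ≠ ∞ :=
    ENNReal.mul_ne_top (ENNReal.mul_ne_top (ENNReal.mul_ne_top ENNReal.ofReal_ne_top (by simp))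
      volume_unitBall_ne_top) (by simp)
  refine ⟨(ENNReal.ofReal (K₀ * 2 ^ N) * 2 ^ N * V * 2).toNNReal,
    fun a ha φ hφ t ht x y hxy => ?_⟩
  rw [ENNReal.coe_toNNReal hKt]
  have hpt : ∀ z, ‖dilTrans φ t ht y z‖ₑ ≤ ENNReal.ofReal (K₀ * 2 ^ N) *
      ENNReal.ofReal (t ^ n)⁻¹ * ENNReal.ofReal ((1 + ‖x - z‖ / t) ^ N)⁻¹ := by
    intro z
    rw [← ofReal_norm, ← ENNReal.ofReal_mul (by positivity), ← ENNReal.ofReal_mul (by positivity)]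
    refine ENNReal.ofReal_le_ofReal ?_
    have h := norm_iteratedFDeriv_dilTrans_le_of_mem hn hφ ht y z (Nat.zero_le N)
    rw [norm_iteratedFDeriv_zero, add_zero] at h
    refine h.trans ?_
    have h2 : ((1 + ‖y - z‖ / t) ^ N)⁻¹ ≤ 2 ^ N * ((1 + ‖x - z‖ / t) ^ N)⁻¹ := by
      rw [← div_eq_mul_inv, ← div_pow, ← inv_pow]
      gcongr
      rw [inv_le_comm₀ (by positivity) (by positivity), inv_div, div_le_iff₀ (by norm_num),
        mul_comm]
      exact one_add_norm_div_le ht hxy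
    calc _ ≤ K₀ * (t ^ n)⁻¹ * (2 ^ N * ((1 + ‖x - z‖ / t) ^ N)⁻¹) := by gcongr
      _ = _ := by ring
  have hball : ∀ l : ℕ, ∫⁻ z, ‖a z‖ₑ * chi (ball x (2 ^ l * t)) z ≤
      ENNReal.ofReal ((2 ^ l) ^ n) * ENNReal.ofReal (t ^ n) * V * maximalFn a x := by
    intro l
    have hr : (0 : ℝ) < 2 ^ l * t := by positivity
    have h1 : ∫⁻ z, ‖a z‖ₑ * chi (ball x (2 ^ l * t)) z = ∫⁻ z in ball x (2 ^ l * t), ‖a z‖ₑ := by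
      rw [← lintegral_indicator measurableSet_ball]
      congr 1
      ext z
      by_cases h : z ∈ ball x (2 ^ l * t)
      · rw [chi_of_mem h, mul_one, Set.indicator_of_mem h]
      · rw [chi_of_notMem h, mul_zero, Set.indicator_of_notMem h]
    have h2 : (volume (ball x (2 ^ l * t)))⁻¹ * ∫⁻ z in ball x (2 ^ l * t), ‖a z‖ₑ ≤
        maximalFn a x :=
      le_iSup₂ (f := fun (r : ℝ) (_ : 0 < r) =>
        (volume (ball x r))⁻¹ * ∫⁻ y in ball x r, ‖a y‖ₑ) _ hr
    rw [ENNReal.inv_mul_le_iff (measure_ball_pos _ _ hr).ne' measure_ball_lt_top.ne,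
      volume_ball_eq _ hr, mul_pow, ENNReal.ofReal_mul (by positivity)] at h2
    rwa [h1]
  -- Averages over balls of radius `2 ^ l * t` cost `2 ^ (l n)`; as `N ≥ n + 1`, a factor `2 ^ (-l)`
  -- is left over.
  have hgeo : ∑' l : ℕ, ENNReal.ofReal (((2 : ℝ) ^ l) ^ N)⁻¹ * ENNReal.ofReal ((2 ^ l) ^ n) ≤ 2 := by
    calc _ ≤ ∑' l : ℕ, (2⁻¹ : ℝ≥0∞) ^ l := by
          refine ENNReal.tsum_le_tsum fun l => ?_
          rw [← ENNReal.ofReal_mul (by positivity)]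
          have h2 : (2⁻¹ : ℝ≥0∞) ^ l = ENNReal.ofReal ((2 : ℝ) ^ l)⁻¹ := by
            rw [ENNReal.ofReal_inv_of_pos (by positivity), ENNReal.ofReal_pow (by norm_num),
              ENNReal.inv_pow]
            norm_num
          rw [h2]
          refine ENNReal.ofReal_le_ofReal ?_
          have h1 : (1 : ℝ) ≤ 2 ^ l := one_le_pow₀ (by norm_num)
          rw [inv_mul_le_iff₀ (by positivity), ← div_eq_mul_inv, le_div_iff₀ (by positivity),
            ← pow_succ]
          exact pow_le_pow_right₀ h1 hN
      _ = 2 := ENNReal.tsum_geometric_two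
  have htn : ENNReal.ofReal (t ^ n)⁻¹ * ENNReal.ofReal (t ^ n) = 1 := by
    rw [← ENNReal.ofReal_mul (by positivity), inv_mul_cancel₀ (by positivity), ENNReal.ofReal_one]
  calc ‖∫ z, a z * dilTrans φ t ht y z‖ₑ ≤ ∫⁻ z, ‖a z * dilTrans φ t ht y z‖ₑ :=
        enorm_integral_le_lintegral_enorm _
    _ ≤ ∫⁻ z, (ENNReal.ofReal (K₀ * 2 ^ N) * ENNReal.ofReal (t ^ n)⁻¹) *
          ∑' l : ℕ, 2 ^ N * ENNReal.ofReal (((2 : ℝ) ^ l) ^ N)⁻¹ *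
            (‖a z‖ₑ * chi (ball x (2 ^ l * t)) z) := by
        refine lintegral_mono fun z => ?_
        rw [enorm_mul]
        calc _ ≤ ‖a z‖ₑ * (ENNReal.ofReal (K₀ * 2 ^ N) * ENNReal.ofReal (t ^ n)⁻¹ *
              ∑' l : ℕ, 2 ^ N * ENNReal.ofReal (((2 : ℝ) ^ l) ^ N)⁻¹ *
                chi (ball x (2 ^ l * t)) z) := by
              refine mul_le_mul_right ((hpt z).trans (mul_le_mul_right ?_ _)) _
              exact ofReal_inv_one_add_pow_le_tsum ht x z N
          _ = _ := by
              rw [mul_left_comm, ← ENNReal.tsum_mul_left]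
              refine congrArg _ (tsum_congr fun l => ?_)
              ring
    _ = (ENNReal.ofReal (K₀ * 2 ^ N) * ENNReal.ofReal (t ^ n)⁻¹) *
          ∑' l : ℕ, 2 ^ N * ENNReal.ofReal (((2 : ℝ) ^ l) ^ N)⁻¹ *
            ∫⁻ z, ‖a z‖ₑ * chi (ball x (2 ^ l * t)) z := by
        rw [lintegral_const_mul' _ _ (ENNReal.mul_ne_top ENNReal.ofReal_ne_top
          ENNReal.ofReal_ne_top), lintegral_tsum]
        · refine congrArg _ (tsum_congr fun l => ?_)
          rw [lintegral_const_mul' _ _ (ENNReal.mul_ne_top (by simp) ENNReal.ofReal_ne_top)]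
        · exact fun l => (ha.enorm.mul (measurable_chi measurableSet_ball).aemeasurable).const_mul _
    _ ≤ (ENNReal.ofReal (K₀ * 2 ^ N) * ENNReal.ofReal (t ^ n)⁻¹) *
          ∑' l : ℕ, 2 ^ N * ENNReal.ofReal (((2 : ℝ) ^ l) ^ N)⁻¹ *
            (ENNReal.ofReal ((2 ^ l) ^ n) * ENNReal.ofReal (t ^ n) * V * maximalFn a x) := by
        gcongr with l
        exact hball l
    _ = ENNReal.ofReal (K₀ * 2 ^ N) * 2 ^ N * V * maximalFn a x *
          (ENNReal.ofReal (t ^ n)⁻¹ * ENNReal.ofReal (t ^ n)) *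
          ∑' l : ℕ, ENNReal.ofReal (((2 : ℝ) ^ l) ^ N)⁻¹ * ENNReal.ofReal ((2 ^ l) ^ n) := by
        rw [← ENNReal.tsum_mul_left, ← ENNReal.tsum_mul_left]
        refine tsum_congr fun l => ?_
        ring
    _ ≤ _ := by
        rw [htn, mul_one]
        calc _ ≤ ENNReal.ofReal (K₀ * 2 ^ N) * 2 ^ N * V * maximalFn a x * 2 := by gcongr
          _ = _ := by ring

theorem integrable_mul_of_support {a : E n → ℂ} (ha : Integrable a) {R : ℝ}
    (hR : ∀ z, R < ‖z‖ → a z = 0) {h : E n → ℂ} (hh : Continuous h) :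
    Integrable fun z => a z * h z := by
  obtain ⟨C, hC⟩ := (isCompact_closedBall (0 : E n) R).exists_bound_of_continuousOn hh.continuousOn
  refine (ha.norm.mul_const C).mono' (ha.1.mul hh.aestronglyMeasurable) (.of_forall fun z => ?_)
  rw [norm_mul]
  by_cases hz : ‖z‖ ≤ R
  · gcongr
    exact hC z (by simpa using hz)
  · simp [hR z (not_le.1 hz)]

theorem continuous_monom (β : Fin n → ℕ) : Continuous (monom β) := by
  unfold monom
  fun_prop

theorem multilinear_diag_eq {j : ℕ} (L : (E n) [×j]→L[ℝ] ℂ) (z : E n) :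
    L (fun _ => z) = ∑ d : Fin j → Fin n, (monom (countIndex d) z : ℂ) *
      L (fun l => EuclideanSpace.single (d l) (1 : ℝ)) := by
  rw [map_eq_sum_basis L]
  refine Finset.sum_congr rfl fun d _ => ?_
  rw [monom_countIndex, Complex.real_smul]

theorem integral_mul_multilinear_eq_zero {a : E n → ℂ} (ha : Integrable a) {R : ℝ}
    (hR : ∀ z, R < ‖z‖ → a z = 0) {s : ℕ}
    (hmom : ∀ β : Fin n → ℕ, ∑ i, β i ≤ s → ∫ x, a x * (monom β x : ℂ) = 0) {j : ℕ} (hj : j ≤ s)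
    (L : (E n) [×j]→L[ℝ] ℂ) : ∫ z, a z * L (fun _ => z) = 0 := by
  simp_rw [multilinear_diag_eq L, Finset.mul_sum, ← mul_assoc]
  rw [integral_finsetSum]
  · refine Finset.sum_eq_zero fun d _ => ?_
    rw [integral_mul_const, hmom _ ((sum_countIndex d).trans_le hj), zero_mul]
  · intro d _
    exact (integrable_mul_of_support ha hR
      (Complex.continuous_ofReal.comp (continuous_monom _))).mul_const _

theorem norm_taylor_remainder_le {f : E n → ℂ} {m : ℕ} (hf : ContDiff ℝ (m + 1) f) (z : E n)
    {A : ℝ} (hA : ∀ w, ‖w‖ ≤ ‖z‖ → ‖iteratedFDeriv ℝ (m + 1) f w‖ ≤ A) :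
    ‖f z - ∑ k ∈ Finset.range (m + 1),
      (k.factorial : ℝ)⁻¹ • (iteratedFDeriv ℝ k f 0 (fun _ => z))‖ ≤ A * ‖z‖ ^ (m + 1) := by
  have h := map_add_eq_sum_add_integral_iteratedFDeriv (f := f) (x := 0) (y := z) (n := m)
    fun t _ => hf.contDiffAt
  have hA0 : 0 ≤ A := (norm_nonneg _).trans (hA 0 (by simp))
  rw [zero_add] at h
  rw [h, add_sub_cancel_left, norm_smul]
  have h1 : ‖∫ t in (0 : ℝ)..1, (1 - t) ^ m • iteratedFDeriv ℝ (m + 1) f (0 + t • z) fun _ => z‖ ≤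
      A * ‖z‖ ^ (m + 1) * |1 - 0| := by
    refine intervalIntegral.norm_integral_le_of_norm_le_const fun t ht => ?_
    rw [Set.uIoc_of_le zero_le_one] at ht
    rw [norm_smul, norm_pow, zero_add]
    have ht1 : ‖1 - t‖ ^ m ≤ 1 := by
      refine pow_le_one₀ (norm_nonneg _) ?_
      rw [Real.norm_of_nonneg (by linarith [ht.2])]
      linarith [ht.1]
    have ht2 : ‖iteratedFDeriv ℝ (m + 1) f (t • z) fun _ => z‖ ≤ A * ‖z‖ ^ (m + 1) := by
      refine (ContinuousMultilinearMap.le_opNorm _ _).trans ?_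
      rw [Finset.prod_const, Finset.card_univ, Fintype.card_fin]
      gcongr
      refine hA _ ?_
      rw [norm_smul, Real.norm_of_nonneg ht.1.le]
      exact mul_le_of_le_one_left (norm_nonneg _) ht.2
    calc _ ≤ 1 * (A * ‖z‖ ^ (m + 1)) := by gcongr
      _ = _ := one_mul _
  have h2 : ‖((m.factorial : ℝ))⁻¹‖ ≤ 1 := by
    rw [norm_inv, Real.norm_natCast]
    exact inv_le_one_of_one_le₀ (by exact_mod_cast Nat.one_le_iff_ne_zero.2 m.factorial_ne_zero)
  calc _ ≤ 1 * (A * ‖z‖ ^ (m + 1) * |1 - 0|) := by gcongr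
    _ = _ := by simp

/-- The moments kill the Taylor polynomial of `f` at `0` of degree `m`, so only the remainder, of
size `A * R ^ (m + 1)` on the support, is integrated. -/
theorem norm_integral_mul_le_of_moments {a : E n → ℂ} (ha : Integrable a) {R : ℝ}
    (hR : ∀ z, R < ‖z‖ → a z = 0) {m : ℕ}
    (hmom : ∀ β : Fin n → ℕ, ∑ i, β i ≤ m → ∫ x, a x * (monom β x : ℂ) = 0) {f : E n → ℂ}
    (hf : ContDiff ℝ (m + 1) f) {A : ℝ}
    (hA : ∀ w, ‖w‖ ≤ R → ‖iteratedFDeriv ℝ (m + 1) f w‖ ≤ A) :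
    ‖∫ z, a z * f z‖ ≤ A * R ^ (m + 1) * ∫ z, ‖a z‖ := by
  set T : E n → ℂ := fun z => ∑ k ∈ Finset.range (m + 1),
      (k.factorial : ℝ)⁻¹ • (iteratedFDeriv ℝ k f 0 (fun _ => z)) with hT
  have hLc : ∀ k, Continuous fun z : E n => iteratedFDeriv ℝ k f 0 (fun _ => z) := fun k =>
    (iteratedFDeriv ℝ k f 0).cont.comp (continuous_pi fun _ => continuous_id)
  have hTc : Continuous T :=
    continuous_finsetSum _ fun k _ => (hLc k).const_smul (k.factorial : ℝ)⁻¹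
  have hT0 : ∫ z, a z * T z = 0 := by
    simp_rw [hT, Finset.mul_sum, mul_smul_comm]
    rw [integral_finsetSum]
    · refine Finset.sum_eq_zero fun k hk => ?_
      rw [integral_smul, integral_mul_multilinear_eq_zero ha hR hmom
        (Nat.lt_succ_iff.1 (Finset.mem_range.1 hk)), smul_zero]
    · intro k _
      have := integrable_mul_of_support ha hR (hLc k)
      exact this.smul (k.factorial : ℝ)⁻¹
  have h1 : ∫ z, a z * f z = ∫ z, a z * (f z - T z) := by
    simp_rw [mul_sub]
    rw [integral_sub (integrable_mul_of_support ha hR hf.continuous)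
      (integrable_mul_of_support ha hR hTc), hT0, sub_zero]
  rw [h1]
  refine (norm_integral_le_integral_norm _).trans ?_
  rw [← integral_const_mul]
  refine integral_mono_of_nonneg (.of_forall fun z => norm_nonneg _) (ha.norm.const_mul _)
    (.of_forall fun z => ?_)
  simp only [norm_mul]
  by_cases hz : ‖z‖ ≤ R
  · rw [mul_comm]
    have hA0 : 0 ≤ A := (norm_nonneg _).trans (hA 0 (by simpa using (norm_nonneg z).trans hz))
    gcongr
    refine (norm_taylor_remainder_le hf z fun w hw => hA w (hw.trans hz)).trans ?_
    gcongr
  · simp [hR z (not_le.1 hz)]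

/-- Decay of the pairing with a dilated test function away from the support, for functions with
vanishing moments. -/
theorem norm_integral_dilTrans_le_of_moments (hn : 1 ≤ n) {a : E n → ℂ} (ha : Integrable a)
    {R : ℝ} (hR : ∀ z, R < ‖z‖ → a z = 0) {m : ℕ}
    (hmom : ∀ β : Fin n → ℕ, ∑ i, β i ≤ m → ∫ x, a x * (monom β x : ℂ) = 0)
    (hmN : n + (m + 1) ≤ N) {φ : 𝓢(E n, ℂ)} (hφ : φ ∈ testClass n N) {t : ℝ} (ht : 0 < t)
    {x y : E n} (hxy : ‖y - x‖ < t) (hx0 : 0 < ‖x‖) (hx : 2 * R ≤ ‖x‖) :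
    ‖∫ z, a z * dilTrans φ t ht y z‖ ≤
      (2 * n : ℝ) ^ N * n ^ N * (2 / ‖x‖) ^ (n + (m + 1)) * R ^ (m + 1) * ∫ z, ‖a z‖ := by
  refine norm_integral_mul_le_of_moments ha hR hmom ((dilTrans φ t ht y).smooth _) fun w hw => ?_
  refine (norm_iteratedFDeriv_dilTrans_le_of_mem hn hφ ht y w (by omega)).trans ?_
  rw [mul_assoc]
  gcongr
  have h1 : ‖x‖ / 2 ≤ ‖x - w‖ := by
    have := norm_sub_norm_le x w
    linarith
  have h2 : ‖x - w‖ ≤ ‖y - w‖ + t := by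
    have : x - w = (y - w) - (y - x) := by abel
    rw [this]
    exact (norm_sub_le _ _).trans (by linarith)
  -- Spending exactly `n + m + 1` of the `N` available powers of `1 + ‖y - w‖ / t` cancels the
  -- powers of `t`, so the bound does not depend on the scale of the test function.
  have h3 : ‖x‖ / (2 * t) ≤ 1 + ‖y - w‖ / t := by
    rw [div_le_iff₀ (by positivity), add_mul]
    have : ‖y - w‖ / t * (2 * t) = 2 * ‖y - w‖ := by field_simp
    rw [this]
    linarith
  have h4 : (‖x‖ / (2 * t)) ^ (n + (m + 1)) ≤ (1 + ‖y - w‖ / t) ^ N := by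
    refine (pow_le_pow_left₀ (by positivity) h3 _).trans (pow_le_pow_right₀ ?_ hmN)
    have : 0 ≤ ‖y - w‖ / t := by positivity
    linarith
  calc (t ^ (n + (m + 1)))⁻¹ * ((1 + ‖y - w‖ / t) ^ N)⁻¹
      ≤ (t ^ (n + (m + 1)))⁻¹ * ((‖x‖ / (2 * t)) ^ (n + (m + 1)))⁻¹ := by gcongr
    _ = (2 / ‖x‖) ^ (n + (m + 1)) := by
        rw [← mul_inv, ← mul_pow, ← inv_pow]
        congr 1
        field_simp

end Pairing

/-! ### From atomic decompositions to the Hardy quasi-norm. -/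

section AtomsToHardy

variable {n N : ℕ}

/-- The grand maximal function of an arbitrary function on the Schwartz space. -/
noncomputable def maximalOf (N : ℕ) (ℓ : 𝓢(E n, ℂ) → ℂ) (x : E n) : ℝ≥0∞ :=
  ⨆ φ ∈ testClass n N, ⨆ (t : ℝ) (ht : 0 < t) (y : E n) (_ : ‖y - x‖ < t),
    ‖ℓ (dilTrans φ t ht y)‖ₑ

/-- The maximal function is a supremum of multiples of indicators of open balls, hence lower
semicontinuous, whatever `ℓ` is. -/
theorem measurable_maximalOf (ℓ : 𝓢(E n, ℂ) → ℂ) : Measurable (maximalOf N ℓ) := by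
  refine LowerSemicontinuous.measurable ?_
  unfold maximalOf
  refine lowerSemicontinuous_iSup fun φ => lowerSemicontinuous_iSup fun _ =>
    lowerSemicontinuous_iSup fun t => lowerSemicontinuous_iSup fun ht =>
    lowerSemicontinuous_iSup fun y => ?_
  have h : (fun x : E n => ⨆ (_ : ‖y - x‖ < t), ‖ℓ (dilTrans φ t ht y)‖ₑ) =
      (ball y t).indicator fun _ => ‖ℓ (dilTrans φ t ht y)‖ₑ := by
    ext x
    by_cases hx : ‖y - x‖ < t
    · rw [Set.indicator_of_mem (by rwa [mem_ball, dist_comm, dist_eq_norm])]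
      simp [hx]
    · rw [Set.indicator_of_notMem (by rwa [mem_ball, dist_comm, dist_eq_norm])]
      simp [hx]
  rw [h]
  exact isOpen_ball.lowerSemicontinuous_indicator zero_le

theorem measurable_grandMaximal (g : 𝓢'(E n, ℂ)) : Measurable (grandMaximal N g) :=
  measurable_maximalOf g

theorem maximalOf_le {ℓ : 𝓢(E n, ℂ) → ℂ} {x : E n} {A : ℝ≥0∞}
    (h : ∀ φ ∈ testClass n N, ∀ (t : ℝ) (ht : 0 < t) (y : E n), ‖y - x‖ < t →
      ‖ℓ (dilTrans φ t ht y)‖ₑ ≤ A) : maximalOf N ℓ x ≤ A :=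
  iSup₂_le fun φ hφ => iSup₂_le fun t ht => iSup₂_le fun y hy => h φ hφ t ht y hy

theorem le_maximalOf (ℓ : 𝓢(E n, ℂ) → ℂ) {φ : 𝓢(E n, ℂ)} (hφ : φ ∈ testClass n N) {t : ℝ}
    (ht : 0 < t) {x y : E n} (hxy : ‖y - x‖ < t) :
    ‖ℓ (dilTrans φ t ht y)‖ₑ ≤ maximalOf N ℓ x :=
  le_iSup₂_of_le φ hφ (le_iSup₂_of_le t ht (le_iSup₂_of_le y hxy le_rfl))

theorem grandMaximal_le_tsum {g : 𝓢'(E n, ℂ)} {c : ℤ → ℂ} {a : ℤ → E n → ℂ}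
    (h : ∀ φ : 𝓢(E n, ℂ), HasSum (fun k => c k * ∫ x, a k x * φ x) (g φ)) (x : E n) :
    grandMaximal N g x ≤ ∑' k, ‖c k‖ₑ * maximalOf N (fun φ => ∫ x, a k x * φ x) x := by
  refine maximalOf_le fun φ hφ t ht y hy => ?_
  have h1 := h (dilTrans φ t ht y)
  calc ‖g (dilTrans φ t ht y)‖ₑ ≤ ∑' k, ‖c k * ∫ x, a k x * dilTrans φ t ht y x‖ₑ := by
        rw [← h1.tsum_eq]
        refine enorm_tsum_le_tsum_enorm
    _ ≤ _ := by
        refine ENNReal.tsum_le_tsum fun k => ?_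
        rw [enorm_mul]
        gcongr
        exact le_maximalOf (fun φ => ∫ x, a k x * φ x) hφ ht hy

variable {p α : E n → ℝ} {αinf δ₂ : ℝ} {s : ℕ}

theorem exists_volume_rpow_alphaAt_comparable (hn : 1 ≤ n) (α : E n → ℝ) (αinf : ℝ) :
    ∃ K : ℝ≥0, K ≠ 0 ∧ ∀ k : ℤ,
      volume (ball (0 : E n) ((2 : ℝ) ^ k)) ^ (-alphaAt α αinf ((2 : ℝ) ^ k) / (n : ℝ)) ≤
        K * 2 ^ (-((k : ℝ) * alphaAt α αinf ((2 : ℝ) ^ k))) ∧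
      2 ^ (-((k : ℝ) * alphaAt α αinf ((2 : ℝ) ^ k))) ≤ K *
        volume (ball (0 : E n) ((2 : ℝ) ^ k)) ^ (-alphaAt α αinf ((2 : ℝ) ^ k) / (n : ℝ)) := by
  have hn' : (n : ℝ) ≠ 0 := by exact_mod_cast (Nat.one_le_iff_ne_zero.1 hn)
  set V := volume (ball (0 : E n) 1) with hV
  have hV0 : V ≠ 0 := volume_unitBall_ne_zero
  have hVt : V ≠ ∞ := volume_unitBall_ne_top
  have hfin : ∀ b : ℝ, V ^ b ≠ ∞ := fun b => ENNReal.rpow_ne_top_of_ne_zero hV0 hVt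
  -- The exponent takes only two values, so four powers of the volume of the unit ball cover both
  -- inequalities for all `k`.
  set K : ℝ≥0∞ := V ^ (-α 0 / n) + V ^ (-αinf / n) + V ^ (α 0 / n) + V ^ (αinf / n) with hK
  have hKt : K ≠ ∞ := by simp [hK, hfin]
  have hK0 : K ≠ 0 := by
    simp [hK, hVt, hV0, ENNReal.rpow_eq_zero_iff]
  refine ⟨K.toNNReal, by simp [ENNReal.toNNReal_eq_zero_iff, hK0, hKt], fun k => ?_⟩
  rw [ENNReal.coe_toNNReal hKt]
  have hk : alphaAt α αinf ((2 : ℝ) ^ k) = α 0 ∨ alphaAt α αinf ((2 : ℝ) ^ k) = αinf := by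
    rw [alphaAt]
    split_ifs <;> simp
  set ak := alphaAt α αinf ((2 : ℝ) ^ k) with hak
  have hvol : volume (ball (0 : E n) ((2 : ℝ) ^ k)) ^ (-ak / (n : ℝ)) =
      2 ^ (-((k : ℝ) * ak)) * V ^ (-ak / n) := by
    have := volume_dyadicBall (n := n) k
    rw [dyadicBall] at this
    rw [this, ENNReal.mul_rpow_of_ne_zero (two_rpow_ne_zero _) hV0, ← ENNReal.rpow_mul]
    congr 2
    field_simp
  have h1 : V ^ (-ak / n) ≤ K := by
    rcases hk with h | h <;> rw [h, hK, add_assoc, add_assoc]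
    · exact le_self_add
    · exact le_self_add.trans le_add_self
  have h2 : V ^ (ak / n) ≤ K := by
    rcases hk with h | h <;> rw [h, hK]
    · exact le_add_self.trans le_self_add
    · exact le_add_self
  rw [hvol]
  constructor
  · rw [mul_comm]
    gcongr
  · calc (2 : ℝ≥0∞) ^ (-((k : ℝ) * ak)) = V ^ (ak / n) * (2 ^ (-((k : ℝ) * ak)) * V ^ (-ak / n)) := by
          rw [mul_left_comm, ← ENNReal.rpow_add _ _ hV0 hVt]
          simp [neg_div]
      _ ≤ _ := by gcongr

theorem IsCentralAtom.eq_zero {r : ℝ} {a : E n → ℂ} (ha : IsCentralAtom α αinf p s r a) {z : E n}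
    (hz : r ≤ ‖z‖) : a z = 0 := by
  by_contra h
  have := ha.tsupport_subset (subset_tsupport a h)
  rw [mem_ball_zero_iff] at this
  linarith

theorem IsCentralAtom.luxNorm_ne_top {r : ℝ} (hr : 0 < r) {a : E n → ℂ}
    (ha : IsCentralAtom α αinf p s r a) : luxNorm p (fun x => ‖a x‖ₑ) ≠ ∞ :=
  (ha.norm_le.trans_lt (ENNReal.rpow_ne_top_of_ne_zero (measure_ball_pos _ _ hr).ne'
    measure_ball_lt_top.ne).lt_top).ne

theorem IsCentralAtom.lintegral_le (hp : ClassP p) {r : ℝ} (hr : 0 < r) {a : E n → ℂ}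
    (ha : IsCentralAtom α αinf p s r a) :
    ∫⁻ x, ‖a x‖ₑ ≤ 2 * luxNorm p (fun x => ‖a x‖ₑ) * luxNorm (conjExp p) (chi (ball 0 r)) := by
  refine le_of_eq_of_le ?_ (setLIntegral_le_luxNorm_mul hp measurableSet_ball
    measure_ball_lt_top.ne _ (ha.luxNorm_ne_top hr))
  rw [← lintegral_indicator measurableSet_ball]
  congr 1
  ext x
  by_cases hx : x ∈ ball (0 : E n) r
  · rw [Set.indicator_of_mem hx]
  · rw [Set.indicator_of_notMem hx, ha.eq_zero (by simpa using hx), enorm_zero]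

theorem IsCentralAtom.integrable (hp : ClassP p) {r : ℝ} (hr : 0 < r) {a : E n → ℂ}
    (ha : IsCentralAtom α αinf p s r a) : Integrable a := by
  refine ⟨ha.aestronglyMeasurable, (ha.lintegral_le hp hr).trans_lt ?_⟩
  refine ENNReal.mul_lt_top (ENNReal.mul_lt_top (by simp) (ha.luxNorm_ne_top hr).lt_top) ?_
  exact (luxNorm_chi_ne_top measurableSet_ball hp.conjExp.one_le measure_ball_lt_top.ne).lt_top

/-- The estimate near the atom: its maximal function is dominated by the Hardy–Littlewood maximal
function, and no cancellation is used. -/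
theorem exists_luxNorm_maximalOf_atom_le (hn : 1 ≤ n) (hp : ClassB p) (hN : n + 1 ≤ N) :
    ∃ K : ℝ≥0, ∀ (k : ℤ) (a : E n → ℂ), IsCentralAtom α αinf p s ((2 : ℝ) ^ k) a →
      luxNorm p (maximalOf N (fun φ => ∫ x, a x * φ x)) ≤
        K * 2 ^ (-((k : ℝ) * alphaAt α αinf ((2 : ℝ) ^ k))) := by
  obtain ⟨K₁, hK₁⟩ := exists_enorm_integral_dilTrans_le_maximalFn (N := N) hn hN
  obtain ⟨K₂, -, hK₂⟩ := exists_volume_rpow_alphaAt_comparable hn α αinf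
  obtain ⟨hP, K₃, hK₃⟩ := hp
  refine ⟨K₁ * K₃ * K₂, fun k a ha => ?_⟩
  calc luxNorm p (maximalOf N (fun φ => ∫ x, a x * φ x))
      ≤ luxNorm p (fun x => K₁ * maximalFn a x) :=
        luxNorm_mono hP.nonneg fun x => maximalOf_le fun φ hφ t ht y hy =>
          hK₁ a ha.aestronglyMeasurable φ hφ t ht x y hy
    _ ≤ K₁ * luxNorm p (maximalFn a) := luxNorm_const_mul_le hP.pos _ _
    _ ≤ K₁ * (K₃ * (K₂ * 2 ^ (-((k : ℝ) * alphaAt α αinf ((2 : ℝ) ^ k))))) := by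
        gcongr
        refine (hK₃ a ha.aestronglyMeasurable).trans ?_
        gcongr
        exact ha.norm_le.trans (hK₂ k).1
    _ = _ := by push_cast; ring

/-- The estimate far from the atom. The moments give a constant bound `D` on the annulus,
proportional to `∫ |a|`. Hölder bounds this integral by the `p'`-norm of the ball `B_k`, which `δ₂`
compares with that of `B_j`, gaining `2 ^ ((k - j) n δ₂)`. The product of the `p`- and `p'`-norms of
`B_j` is then of order `2 ^ (j n)`. -/
theorem exists_luxNorm_maximalOf_atom_annulus_le (hn : 1 ≤ n) (hp : ClassB p)
    (hδ₂ : IsDeltaTwo p δ₂) {m : ℕ} (hms : m ≤ s) (hmN : n + (m + 1) ≤ N) :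
    ∃ K : ℝ≥0, ∀ (j k : ℤ) (a : E n → ℂ), k + 2 ≤ j →
      IsCentralAtom α αinf p s ((2 : ℝ) ^ k) a →
      luxNorm p (fun x => maximalOf N (fun φ => ∫ x, a x * φ x) x * chi (annulus n j) x) ≤
        K * 2 ^ (((k : ℝ) - j) * ((m + 1) + n * δ₂) -
          (k : ℝ) * alphaAt α αinf ((2 : ℝ) ^ k)) := by
  obtain ⟨hδ0, -, K₁, hK₁⟩ := hδ₂
  obtain ⟨K₂, -, hK₂⟩ := exists_volume_rpow_alphaAt_comparable hn α αinf
  obtain ⟨K₃, hK₃⟩ := hp.exists_luxNorm_chi_mul_conj_le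
  have hP := hp.1
  set V := volume (ball (0 : E n) 1) with hV
  have hV0 : V ≠ 0 := volume_unitBall_ne_zero
  have hVt : V ≠ ∞ := volume_unitBall_ne_top
  set K₀ : ℝ := (2 * n : ℝ) ^ N * n ^ N * 4 ^ (n + (m + 1)) with hK₀
  have hK₀0 : 0 ≤ K₀ := by positivity
  refine ⟨K₀.toNNReal * 2 * K₂ * K₁ * K₃ * V.toNNReal, fun j k a hjk ha => ?_⟩
  have h2k : (0 : ℝ) < 2 ^ k := by positivity
  have hfi := ha.integrable hP h2k
  set ak := alphaAt α αinf ((2 : ℝ) ^ k) with hak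
  set D : ℝ≥0∞ := ENNReal.ofReal K₀ * 2 ^ (-((j : ℝ) * (n + (m + 1)))) *
    2 ^ ((k : ℝ) * (m + 1)) * ∫⁻ x, ‖a x‖ₑ with hD
  have hDt : D ≠ ∞ := ENNReal.mul_ne_top (ENNReal.mul_ne_top (ENNReal.mul_ne_top
    ENNReal.ofReal_ne_top (two_rpow_ne_top _)) (two_rpow_ne_top _)) hfi.2.ne
  have hpt : ∀ x, maximalOf N (fun φ => ∫ x, a x * φ x) x * chi (annulus n j) x ≤
      D.toNNReal * chi (dyadicBall n j) x := by
    intro x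
    rw [ENNReal.coe_toNNReal hDt]
    by_cases hx : x ∈ annulus n j
    swap
    · rw [chi_of_notMem hx, mul_zero]
      exact zero_le
    rw [chi_of_mem hx, chi_of_mem (annulus_subset j hx), mul_one, mul_one]
    rw [mem_annulus] at hx
    have hx0 : 0 < ‖x‖ := lt_of_lt_of_le (by positivity) hx.1
    refine maximalOf_le fun φ hφ t ht y hy => ?_
    -- The gap of two indices is needed because the annulus `j` begins at radius `2 ^ (j - 1)`.
    have h2R : 2 * (2 : ℝ) ^ k ≤ ‖x‖ := by
      refine le_trans ?_ hx.1
      rw [← zpow_one_add₀ two_ne_zero]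
      exact zpow_le_zpow_right₀ (by norm_num) (by omega)
    have h := norm_integral_dilTrans_le_of_moments (N := N) hn hfi (R := (2 : ℝ) ^ k)
      (fun z hz => ha.eq_zero hz.le) (m := m)
      (fun β hβ => ha.moment_eq_zero β (hβ.trans hms)) hmN hφ ht hy hx0 h2R
    rw [← ofReal_norm]
    refine (ENNReal.ofReal_le_ofReal h).trans ?_
    have hx2 : 2 / ‖x‖ ≤ 4 * ((2 : ℝ) ^ j)⁻¹ := by
      rw [div_le_iff₀ hx0]
      have : (2 : ℝ) ^ j = 2 * 2 ^ (j - 1) := by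
        rw [← zpow_one_add₀ two_ne_zero]
        congr 1
        ring
      have h3 : 4 * ((2 : ℝ) ^ j)⁻¹ * 2 ^ (j - 1) = 2 := by
        rw [this]
        have : (2 : ℝ) ^ (j - 1) ≠ 0 := by positivity
        field_simp
        norm_num
      calc (2 : ℝ) = 4 * ((2 : ℝ) ^ j)⁻¹ * 2 ^ (j - 1) := h3.symm
        _ ≤ _ := by gcongr; exact hx.1
    have hI : 0 ≤ ∫ z, ‖a z‖ := integral_nonneg fun _ => norm_nonneg _
    calc _ ≤ ENNReal.ofReal ((2 * n : ℝ) ^ N * n ^ N * (4 * ((2 : ℝ) ^ j)⁻¹) ^ (n + (m + 1)) *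
          (2 ^ k) ^ (m + 1) * ∫ z, ‖a z‖) := by
          refine ENNReal.ofReal_le_ofReal ?_
          gcongr
      _ = ENNReal.ofReal (K₀ * (((2 : ℝ) ^ j)⁻¹) ^ (n + (m + 1)) *
          (2 ^ k) ^ (m + 1) * ∫ z, ‖a z‖) := by
          rw [hK₀, mul_pow 4]
          congr 1
          ring
      _ = D := by
          rw [ENNReal.ofReal_mul (by positivity), ENNReal.ofReal_mul (by positivity),
            ENNReal.ofReal_mul hK₀0, ENNReal.ofReal_pow (by positivity),
            ENNReal.ofReal_pow (by positivity), ENNReal.ofReal_inv_of_pos (by positivity),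
            ofReal_two_zpow, ofReal_two_zpow, hD, ofReal_integral_norm_eq_lintegral_enorm hfi,
            ← ENNReal.rpow_neg, ← ENNReal.rpow_natCast, ← ENNReal.rpow_natCast,
            ← ENNReal.rpow_mul, ← ENNReal.rpow_mul]
          congr 4
          · push_cast
            ring
          · push_cast
            ring
  have hratio : volume (dyadicBall n k) / volume (dyadicBall n j) = 2 ^ (((k : ℝ) - j) * n) := by
    rw [volume_dyadicBall, volume_dyadicBall, ENNReal.mul_div_mul_right _ _ hV0 hVt,
      div_eq_mul_inv, ← ENNReal.rpow_neg, ← two_rpow_add]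
    congr 1
    ring
  have hδ : luxNorm (conjExp p) (chi (dyadicBall n k)) ≤
      K₁ * 2 ^ (((k : ℝ) - j) * n * δ₂) * luxNorm (conjExp p) (chi (dyadicBall n j)) := by
    have := hK₁ 0 (2 ^ j) (by positivity) (dyadicBall n k) measurableSet_ball
      (dyadicBall_subset (by omega))
    rw [← dyadicBall, hratio, ← ENNReal.rpow_mul] at this
    exact this
  calc luxNorm p (fun x => maximalOf N (fun φ => ∫ x, a x * φ x) x * chi (annulus n j) x)
      ≤ luxNorm p (fun x => D.toNNReal * chi (dyadicBall n j) x) := luxNorm_mono hP.nonneg hpt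
    _ ≤ D * luxNorm p (chi (dyadicBall n j)) := by
        refine (luxNorm_const_mul_le hP.pos _ _).trans_eq ?_
        rw [ENNReal.coe_toNNReal hDt]
    _ ≤ ENNReal.ofReal K₀ * 2 ^ (-((j : ℝ) * (n + (m + 1)))) * 2 ^ ((k : ℝ) * (m + 1)) *
          (2 * (K₂ * 2 ^ (-((k : ℝ) * ak))) * (K₁ * 2 ^ (((k : ℝ) - j) * n * δ₂) *
            luxNorm (conjExp p) (chi (dyadicBall n j)))) *
          luxNorm p (chi (dyadicBall n j)) := by
        rw [hD]
        gcongr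
        refine (ha.lintegral_le hP h2k).trans ?_
        gcongr
        · exact ha.norm_le.trans (hK₂ k).1
        · exact hδ
    _ = ENNReal.ofReal K₀ * 2 ^ (-((j : ℝ) * (n + (m + 1)))) * 2 ^ ((k : ℝ) * (m + 1)) *
          (2 * (K₂ * 2 ^ (-((k : ℝ) * ak))) * (K₁ * 2 ^ (((k : ℝ) - j) * n * δ₂))) *
          (luxNorm p (chi (dyadicBall n j)) * luxNorm (conjExp p) (chi (dyadicBall n j))) := by
        ring
    _ ≤ ENNReal.ofReal K₀ * 2 ^ (-((j : ℝ) * (n + (m + 1)))) * 2 ^ ((k : ℝ) * (m + 1)) *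
          (2 * (K₂ * 2 ^ (-((k : ℝ) * ak))) * (K₁ * 2 ^ (((k : ℝ) - j) * n * δ₂))) *
          (K₃ * (2 ^ ((j : ℝ) * n) * V)) := by
        refine mul_le_mul_right ?_ _
        rw [hV, ← volume_dyadicBall]
        exact hK₃ _ (by positivity)
    _ = ENNReal.ofReal K₀ * 2 * K₂ * K₁ * K₃ * V *
          (2 ^ (-((j : ℝ) * (n + (m + 1)))) * 2 ^ ((k : ℝ) * (m + 1)) *
          2 ^ (-((k : ℝ) * ak)) * 2 ^ (((k : ℝ) - j) * n * δ₂) * 2 ^ ((j : ℝ) * n)) := by ring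
    _ = _ := by
        rw [← two_rpow_add, ← two_rpow_add, ← two_rpow_add, ← two_rpow_add]
        simp only [ENNReal.coe_mul, ENNReal.coe_toNNReal hVt, ENNReal.coe_ofNat]
        congr 2
        ring

/-- The sequence `k * α_k` is piecewise linear and vanishes at `0`, with slope `α 0` on the negative
side and `αinf` on the positive side. All its increments therefore have slope at most the larger of
the two. -/
theorem mul_alphaAt_sub_le_of_le {M : ℝ} (h0 : α 0 ≤ M) (hinf : αinf ≤ M) {j k : ℤ}
    (hkj : k ≤ j) :
    (j : ℝ) * alphaAt α αinf ((2 : ℝ) ^ j) - k * alphaAt α αinf ((2 : ℝ) ^ k) ≤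
      M * ((j : ℝ) - k) := by
  rw [alphaAt_two_zpow, alphaAt_two_zpow]
  have hkj' : (k : ℝ) ≤ j := by exact_mod_cast hkj
  split_ifs with hj hk hk
  · nlinarith
  · omega
  · have h1 : (0 : ℝ) ≤ j := by exact_mod_cast not_lt.1 hj
    have h2 : (k : ℝ) ≤ 0 := by exact_mod_cast hk.le
    nlinarith
  · nlinarith

theorem mul_alphaAt_sub_le_of_ge {μ : ℝ} (h0 : μ ≤ α 0) (hinf : μ ≤ αinf) {j k : ℤ}
    (hjk : j ≤ k) :
    (j : ℝ) * alphaAt α αinf ((2 : ℝ) ^ j) - k * alphaAt α αinf ((2 : ℝ) ^ k) ≤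
      -(μ * ((k : ℝ) - j)) := by
  rw [alphaAt_two_zpow, alphaAt_two_zpow]
  have hkj' : (j : ℝ) ≤ k := by exact_mod_cast hjk
  split_ifs with hj hk hk
  · nlinarith
  · have h1 : (0 : ℝ) ≤ k := by exact_mod_cast not_lt.1 hk
    have h2 : (j : ℝ) ≤ 0 := by exact_mod_cast hj.le
    nlinarith
  · omega
  · nlinarith

/-- Combines the two estimates into one kernel. For larger atoms (`l ≥ 0`) decay comes from `min (α
0) αinf > Γ`; for smaller ones (`l ≤ -2`) it comes from `m + 1 + n * δ₂ > max (α 0) αinf`. The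
number `ε` is the smaller of the two gaps. -/
theorem exists_weighted_luxNorm_maximalOf_atom_le {Γ : ℝ} (hn : 1 ≤ n) (hΓ : 0 ≤ Γ)
    (hp : ClassB p) (hδ₂ : IsDeltaTwo p δ₂) (hΓ_zero : Γ < α 0) (hΓ_inf : Γ < αinf)
    {m : ℕ} (hms : m ≤ s) (hmN : n + (m + 1) ≤ N)
    (hm_zero : α 0 - n * δ₂ < m + 1) (hm_inf : αinf - n * δ₂ < m + 1) :
    ∃ ε : ℝ, 0 < ε ∧ ∃ K : ℝ≥0, ∀ (j l : ℤ) (a : E n → ℂ),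
      IsCentralAtom α αinf p s ((2 : ℝ) ^ (j + l)) a →
      2 ^ ((j : ℝ) * alphaAt α αinf ((2 : ℝ) ^ j)) *
        luxNorm p (fun x => maximalOf N (fun φ => ∫ x, a x * φ x) x * chi (annulus n j) x) ≤
          K * 2 ^ (-(ε * |(l : ℝ)|) - Γ * l) := by
  have hP := hp.1
  obtain ⟨K₁, hK₁⟩ := exists_luxNorm_maximalOf_atom_le (α := α) (αinf := αinf) (s := s)
    (N := N) hn hp (by omega)
  obtain ⟨K₂, hK₂⟩ := exists_luxNorm_maximalOf_atom_annulus_le (α := α) (αinf := αinf) hn hp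
    hδ₂ hms hmN
  set M := max (α 0) αinf with hM
  set μ := min (α 0) αinf with hμ
  have hμΓ : Γ < μ := lt_min hΓ_zero hΓ_inf
  have hMm : M < m + 1 + n * δ₂ := by
    rw [hM, max_lt_iff]
    constructor <;> linarith
  set ε := min (μ - Γ) (m + 1 + n * δ₂ - M) with hε
  have hε0 : 0 < ε := lt_min (by linarith) (by linarith)
  have hε1 : ε ≤ μ - Γ := min_le_left _ _
  have hε2 : ε ≤ m + 1 + n * δ₂ - M := min_le_right _ _
  have hμM : μ ≤ M := min_le_max
  have hM0 : 0 ≤ M := by linarith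
  refine ⟨ε, hε0, K₁ * 2 ^ (M + ε) + K₂, fun j l a ha => ?_⟩
  have hKc : ((K₁ * 2 ^ (M + ε) + K₂ : ℝ≥0) : ℝ≥0∞) = K₁ * 2 ^ (M + ε) + K₂ := by
    push_cast
    rw [ENNReal.coe_rpow_of_ne_zero two_ne_zero, ENNReal.coe_ofNat]
  rw [hKc]
  -- The case `l = -1` is too close for the moment estimate; it joins the near case at the price of
  -- the constant `2 ^ (M + ε)`.
  rcases le_or_gt (-1) l with hl | hl
  · have h1 : luxNorm p (fun x => maximalOf N (fun φ => ∫ x, a x * φ x) x *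
        chi (annulus n j) x) ≤
        K₁ * 2 ^ (-(((j + l : ℤ) : ℝ) * alphaAt α αinf ((2 : ℝ) ^ (j + l)))) := by
      refine le_trans (luxNorm_mono hP.nonneg fun x => ?_) (hK₁ (j + l) a ha)
      by_cases hx : x ∈ annulus n j
      · rw [chi_of_mem hx, mul_one]
      · rw [chi_of_notMem hx, mul_zero]
        exact zero_le
    have hexp : (j : ℝ) * alphaAt α αinf ((2 : ℝ) ^ j) -
        ((j + l : ℤ) : ℝ) * alphaAt α αinf ((2 : ℝ) ^ (j + l)) ≤
          (M + ε) + (-(ε * |(l : ℝ)|) - Γ * l) := by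
      rcases le_or_gt 0 l with hl0 | hl0
      · have := mul_alphaAt_sub_le_of_ge (α := α) (αinf := αinf) (μ := μ) (min_le_left _ _)
          (min_le_right _ _) (j := j) (k := j + l) (by omega)
        have hl0' : (0 : ℝ) ≤ l := by exact_mod_cast hl0
        rw [abs_of_nonneg hl0']
        push_cast at this ⊢
        nlinarith
      · have hl1 : l = -1 := by omega
        have := mul_alphaAt_sub_le_of_le (α := α) (αinf := αinf) (M := M) (le_max_left _ _)
          (le_max_right _ _) (j := j) (k := j + l) (by omega)
        subst hl1
        push_cast at this ⊢
        rw [abs_neg, abs_one]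
        linarith
    calc (2 : ℝ≥0∞) ^ ((j : ℝ) * alphaAt α αinf ((2 : ℝ) ^ j)) * luxNorm p
          (fun x => maximalOf N (fun φ => ∫ x, a x * φ x) x * chi (annulus n j) x)
        ≤ 2 ^ ((j : ℝ) * alphaAt α αinf ((2 : ℝ) ^ j)) *
          (K₁ * 2 ^ (-(((j + l : ℤ) : ℝ) * alphaAt α αinf ((2 : ℝ) ^ (j + l))))) := by gcongr
      _ = K₁ * 2 ^ ((j : ℝ) * alphaAt α αinf ((2 : ℝ) ^ j) -
            ((j + l : ℤ) : ℝ) * alphaAt α αinf ((2 : ℝ) ^ (j + l))) := by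
          rw [sub_eq_add_neg, two_rpow_add]
          ring
      _ ≤ K₁ * 2 ^ ((M + ε) + (-(ε * |(l : ℝ)|) - Γ * l)) :=
          mul_le_mul_right (two_rpow_le hexp) _
      _ ≤ _ := by
          rw [two_rpow_add, ← mul_assoc]
          exact mul_le_mul_left le_self_add _
  · have h1 := hK₂ j (j + l) a (by omega) ha
    have hexp : (j : ℝ) * alphaAt α αinf ((2 : ℝ) ^ j) +
        ((((j + l : ℤ) : ℝ) - j) * ((m + 1) + n * δ₂) -
          ((j + l : ℤ) : ℝ) * alphaAt α αinf ((2 : ℝ) ^ (j + l))) ≤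
          -(ε * |(l : ℝ)|) - Γ * l := by
      have := mul_alphaAt_sub_le_of_le (α := α) (αinf := αinf) (M := M) (le_max_left _ _)
          (le_max_right _ _) (j := j) (k := j + l) (by omega)
      have hl0' : (l : ℝ) ≤ 0 := by exact_mod_cast (by omega : l ≤ 0)
      rw [abs_of_nonpos hl0']
      push_cast at this ⊢
      nlinarith
    calc (2 : ℝ≥0∞) ^ ((j : ℝ) * alphaAt α αinf ((2 : ℝ) ^ j)) * luxNorm p
          (fun x => maximalOf N (fun φ => ∫ x, a x * φ x) x * chi (annulus n j) x)
        ≤ 2 ^ ((j : ℝ) * alphaAt α αinf ((2 : ℝ) ^ j)) *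
          (K₂ * 2 ^ ((((j + l : ℤ) : ℝ) - j) * ((m + 1) + n * δ₂) -
            ((j + l : ℤ) : ℝ) * alphaAt α αinf ((2 : ℝ) ^ (j + l)))) := by gcongr
      _ ≤ K₂ * 2 ^ (-(ε * |(l : ℝ)|) - Γ * l) := by
          rw [mul_left_comm, ← two_rpow_add]
          exact mul_le_mul_right (two_rpow_le hexp) _
      _ ≤ _ := mul_le_mul_left le_add_self _

/-- The Hardy quasi-norm is controlled by the coefficients of any atomic decomposition. -/
theorem exists_hardyNorm_le_coeffNorm {u θ Γ : ℝ} (hn : 1 ≤ n) (hu : 0 < u) (hΓ : 0 ≤ Γ)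
    (hp : ClassB p) (hδ₂ : IsDeltaTwo p δ₂) (hα_zero : LogHolderAtOrigin α)
    (hα_inf : LogHolderAtInfinity α αinf) (hΓ_zero : Γ < α 0) (hΓ_inf : Γ < αinf)
    {m : ℕ} (hms : m ≤ s) (hmN : n + (m + 1) ≤ N)
    (hm_zero : α 0 - n * δ₂ < m + 1) (hm_inf : αinf - n * δ₂ < m + 1) :
    ∃ C : ℝ≥0, ∀ (g : 𝓢'(E n, ℂ)) (c : ℤ → ℂ) (a : ℤ → E n → ℂ),
      IsAtomicDecomposition α αinf p s g c a →
        hardyNorm N α p u θ Γ g ≤ C * coeffNorm u θ Γ c := by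
  have hP := hp.1
  obtain ⟨A, -, hA⟩ := exists_two_rpow_mul_comparable hα_zero hα_inf
  obtain ⟨ε, hε0, K, hK⟩ := exists_weighted_luxNorm_maximalOf_atom_le (N := N) (s := s) hn hΓ hp
    hδ₂ hΓ_zero hΓ_inf hms hmN hm_zero hm_inf
  obtain ⟨C₀, hC₀⟩ := exists_grandMorreyNorm_conv_le (u := u) (θ := θ) (Γ := Γ) hu hε0
  refine ⟨A * K * C₀, fun g c a hdec => ?_⟩
  set F : ℤ → E n → ℝ≥0∞ := fun k => maximalOf N (fun φ => ∫ x, a k x * φ x) with hF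
  have hFm : ∀ k, Measurable (F k) := fun k => measurable_maximalOf _
  have hcoef : ∀ j : ℤ,
      luxNorm p (fun x => 2 ^ ((j : ℝ) * α x) * grandMaximal N g x * chi (annulus n j) x) ≤
        ∑' l : ℤ, 2 ^ (-(ε * |(l : ℝ)|) - Γ * l) * ((A * K : ℝ≥0) * ‖c (j + l)‖ₑ) := by
    intro j
    obtain ⟨B, hBc⟩ : ∃ B : ℝ≥0, (B : ℝ≥0∞) = 2 ^ ((j : ℝ) * alphaAt α αinf ((2 : ℝ) ^ j)) :=
      ⟨_, ENNReal.coe_toNNReal (two_rpow_ne_top _)⟩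
    calc luxNorm p (fun x => 2 ^ ((j : ℝ) * α x) * grandMaximal N g x * chi (annulus n j) x)
        ≤ luxNorm p (fun x => ∑' l : ℤ, ((A * B * ‖c (j + l)‖₊ : ℝ≥0) : ℝ≥0∞) *
          (F (j + l) x * chi (annulus n j) x)) := by
          refine luxNorm_mono hP.nonneg fun x => ?_
          by_cases hx : x ∈ annulus n j
          swap
          · rw [chi_of_notMem hx, mul_zero]
            exact zero_le
          simp_rw [chi_of_mem hx, mul_one]
          calc 2 ^ ((j : ℝ) * α x) * grandMaximal N g x
              ≤ (A * 2 ^ ((j : ℝ) * alphaAt α αinf ((2 : ℝ) ^ j))) * ∑' k, ‖c k‖ₑ * F k x :=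
                mul_le_mul' (hA j x hx).1 (grandMaximal_le_tsum hdec.hasSum x)
            _ = _ := by
                rw [← (Equiv.addLeft j).tsum_eq, ← ENNReal.tsum_mul_left]
                refine tsum_congr fun l => ?_
                simp only [Equiv.coe_addLeft, ENNReal.coe_mul, hBc, enorm_eq_nnnorm]
                ring
      _ ≤ ∑' l : ℤ, luxNorm p (fun x => ((A * B * ‖c (j + l)‖₊ : ℝ≥0) : ℝ≥0∞) *
          (F (j + l) x * chi (annulus n j) x)) := by
          refine luxNorm_tsum_le hP.measurable hP.one_le _ fun l => ?_
          exact ((hFm _).mul (measurable_chi (measurableSet_annulus j))).const_mul _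
      _ ≤ _ := by
          refine ENNReal.tsum_le_tsum fun l => ?_
          refine (luxNorm_const_mul_le hP.pos _ _).trans ?_
          calc ((A * B * ‖c (j + l)‖₊ : ℝ≥0) : ℝ≥0∞) *
                luxNorm p (fun x => F (j + l) x * chi (annulus n j) x)
              = A * ‖c (j + l)‖ₑ * (2 ^ ((j : ℝ) * alphaAt α αinf ((2 : ℝ) ^ j)) *
                luxNorm p (fun x => F (j + l) x * chi (annulus n j) x)) := by
                rw [← hBc, enorm_eq_nnnorm]
                push_cast
                ring
            _ ≤ A * ‖c (j + l)‖ₑ * (K * 2 ^ (-(ε * |(l : ℝ)|) - Γ * l)) :=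
                mul_le_mul_right (hK j l _ (hdec.atom _)) _
            _ = _ := by
                push_cast
                ring
  unfold hardyNorm herzMorreyNorm coeffNorm
  refine (hC₀ (fun k => (A * K : ℝ≥0) * ‖c k‖ₑ) _ hcoef).trans ?_
  refine (mul_le_mul_right (grandMorreyNorm_const_mul_le hu _ _) _).trans_eq ?_
  rw [← mul_assoc, mul_comm (C₀ : ℝ≥0∞), ← ENNReal.coe_mul]

end AtomsToHardy

/-! ### Distributions tested on scaled bumps. -/

section Bump

variable {n N : ℕ}

theorem iteratedFDeriv_eq_zero_of_lt {F : Type*} [NormedAddCommGroup F] [NormedSpace ℝ F]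
    {f : E n → F} {y : E n} {R : ℝ} (hf : ∀ z, R < ‖z - y‖ → f z = 0) (j : ℕ) {z : E n}
    (hz : R < ‖z - y‖) : iteratedFDeriv ℝ j f z = 0 := by
  by_contra h
  have h1 : z ∈ tsupport f := support_iteratedFDeriv_subset j h
  have h2 : tsupport f ⊆ closedBall y R := by
    refine closure_minimal (fun w hw => ?_) isClosed_closedBall
    rw [mem_closedBall, dist_eq_norm]
    by_contra h3
    exact hw (hf w (not_le.1 h3))
  have := h2 h1
  rw [mem_closedBall, dist_eq_norm] at this
  linarith

theorem abs_monom_le (β : Fin n → ℕ) (x : E n) : |monom β x| ≤ ‖x‖ ^ ∑ i, β i := by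
  unfold monom
  rw [Finset.abs_prod, ← Finset.prod_pow_eq_pow_sum]
  refine Finset.prod_le_prod (fun i _ => abs_nonneg _) fun i _ => ?_
  rw [abs_pow]
  gcongr
  exact abs_apply_le_norm x i

theorem norm_apply_single_le {j : ℕ} {F : Type*} [NormedAddCommGroup F] [NormedSpace ℝ F]
    (L : (E n) [×j]→L[ℝ] F) (d : Fin j → Fin n) :
    ‖L (fun l => EuclideanSpace.single (d l) (1 : ℝ))‖ ≤ ‖L‖ := by
  refine (L.le_opNorm _).trans_eq ?_
  simp

/-- A bump of radius `R * t` whose derivatives have size `A * t ^ (-j)` is `A * R ^ N * t ^ n` times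
a dilate of a member of the test class: after rescaling to unit size, monomials of order at most `N`
are bounded by `R ^ N` on its support. -/
theorem enorm_apply_le_of_bump (g : 𝓢'(E n, ℂ)) (F : 𝓢(E n, ℂ)) {R t A : ℝ} (hR : 1 ≤ R)
    (ht : 0 < t) (hA : 0 < A) {x y : E n} (hxy : ‖y - x‖ < t)
    (hsupp : ∀ z, R * t < ‖z - y‖ → F z = 0)
    (hF : ∀ j ≤ N, ∀ z, ‖iteratedFDeriv ℝ j F z‖ ≤ A * (t ^ j)⁻¹) :
    ‖g F‖ₑ ≤ ENNReal.ofReal (A * R ^ N * t ^ n) * grandMaximal N g x := by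
  have hAR : 0 < A * R ^ N := by positivity
  -- The factor is `-t` because `dilTrans` reflects its argument.
  set ζ₀ : 𝓢(E n, ℂ) := SchwartzMap.compCLMOfContinuousLinearEquiv ℂ
    (ContinuousLinearEquiv.smulLeft (R₁ := ℝ) (M₁ := E n)
      (Units.mk0 (-t) (neg_ne_zero.mpr ht.ne'))) (SchwartzMap.compSubConstCLM ℂ (-y) F) with hζ₀
  have hζ₀_apply : ∀ w, ζ₀ w = F ((-t) • w + y) := by
    intro w
    have : F ((-t) • w - -y) = ζ₀ w := rfl
    rw [← this, sub_neg_eq_add]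
  have hζ₀_fun : (ζ₀ : E n → ℂ) = fun w => F ((-t) • w + y) := funext hζ₀_apply
  set κ : ℂ := ((A * R ^ N : ℝ) : ℂ)⁻¹ with hκ
  have hκn : ‖κ‖ = (A * R ^ N)⁻¹ := by
    rw [hκ, norm_inv, Complex.norm_real, Real.norm_of_nonneg hAR.le]
  set ζ : 𝓢(E n, ℂ) := κ • ζ₀ with hζ
  have hbd : ∀ j ≤ N, ∀ w, ‖iteratedFDeriv ℝ j ζ₀ w‖ ≤ A := by
    intro j hj w
    rw [hζ₀_fun]
    refine (norm_iteratedFDeriv_comp_affine_le (F.smooth j) (-t) y w).trans ?_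
    rw [abs_neg, abs_of_pos ht]
    calc _ ≤ t ^ j * (A * (t ^ j)⁻¹) := by gcongr; exact hF j hj _
      _ = A := by field_simp
  have hz : ∀ w : E n, R < ‖w - 0‖ → ζ₀ w = 0 := by
    intro w hw
    rw [hζ₀_apply]
    apply hsupp
    rw [add_sub_cancel_right, norm_smul, Real.norm_eq_abs, abs_neg, abs_of_pos ht]
    rw [sub_zero] at hw
    nlinarith
  have hmem : ζ ∈ testClass n N := by
    intro β hβ j hj d w
    have h1 : iteratedFDeriv ℝ j (ζ : E n → ℂ) w = κ • iteratedFDeriv ℝ j ζ₀ w :=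
      iteratedFDeriv_const_smul_apply ((ζ₀.smooth j).contDiffAt)
    refine (mul_le_mul_of_nonneg_left (norm_apply_single_le _ d) (abs_nonneg _)).trans ?_
    rw [h1, norm_smul, hκn]
    rcases le_or_gt ‖w‖ R with hw | hw
    · have h2 : |monom β w| ≤ R ^ N := by
        calc |monom β w| ≤ ‖w‖ ^ ∑ i, β i := abs_monom_le β w
          _ ≤ R ^ ∑ i, β i := by gcongr
          _ ≤ R ^ N := pow_le_pow_right₀ hR hβ
      calc |monom β w| * ((A * R ^ N)⁻¹ * ‖iteratedFDeriv ℝ j ζ₀ w‖)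
          ≤ R ^ N * ((A * R ^ N)⁻¹ * A) := by
            gcongr
            exact hbd j hj w
        _ = 1 := by field_simp
    · rw [iteratedFDeriv_eq_zero_of_lt hz j (by simpa using hw)]
      simp
  have hdil : F = ((t : ℂ) ^ n * ((A * R ^ N : ℝ) : ℂ)) • dilTrans ζ t ht y := by
    ext z
    have h1 : dilTrans ζ t ht y z = ((t : ℂ) ^ n)⁻¹ * (κ * F z) := by
      rw [dilTrans_apply]
      congr 1
      have : ζ (t⁻¹ • (y - z)) = κ * ζ₀ (t⁻¹ • (y - z)) := rfl
      rw [this, hζ₀_apply, smul_smul]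
      congr 2
      have : -t * t⁻¹ = -1 := by field_simp
      rw [this, neg_one_smul]
      abel_nf
    have h2 : ((t : ℂ) ^ n) ≠ 0 := pow_ne_zero _ (by exact_mod_cast ht.ne')
    have h3 : ((A * R ^ N : ℝ) : ℂ) ≠ 0 := by exact_mod_cast hAR.ne'
    change F z = ((t : ℂ) ^ n * ((A * R ^ N : ℝ) : ℂ)) * dilTrans ζ t ht y z
    rw [h1, hκ]
    field_simp
  have hle : ‖g (dilTrans ζ t ht y)‖ₑ ≤ grandMaximal N g x := by
    unfold grandMaximal nontangential
    refine le_trans ?_ (le_iSup₂ (f := fun φ (_ : φ ∈ testClass n N) =>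
      ⨆ (t : ℝ) (ht : 0 < t) (y : E n) (_ : ‖y - x‖ < t), ‖g (dilTrans φ t ht y)‖ₑ) ζ hmem)
    refine le_trans ?_ (le_iSup₂ (f := fun (t : ℝ) (ht : 0 < t) =>
      ⨆ (y : E n) (_ : ‖y - x‖ < t), ‖g (dilTrans ζ t ht y)‖ₑ) t ht)
    exact le_iSup₂ (f := fun (y : E n) (_ : ‖y - x‖ < t) => ‖g (dilTrans ζ t ht y)‖ₑ) y hxy
  conv_lhs => rw [hdil]
  rw [map_smul, smul_eq_mul, enorm_mul]
  have hc : ‖(t : ℂ) ^ n * ((A * R ^ N : ℝ) : ℂ)‖ₑ = ENNReal.ofReal (A * R ^ N * t ^ n) := by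
    rw [← ofReal_norm, norm_mul, norm_pow, Complex.norm_real, Complex.norm_real,
      Real.norm_of_nonneg ht.le, Real.norm_of_nonneg hAR.le, mul_comm]
  rw [hc]
  exact mul_le_mul_right hle _

theorem norm_iteratedFDeriv_mul_le_of_le {f h : E n → ℂ} {z : E n} {j : ℕ} {A B τ : ℝ}
    (hf : ContDiff ℝ j f) (hh : ContDiff ℝ j h) (hA : 0 ≤ A) (hτ : 0 ≤ τ)
    (hfb : ∀ i ≤ j, ‖iteratedFDeriv ℝ i f z‖ ≤ A * τ ^ i)
    (hhb : ∀ i ≤ j, ‖iteratedFDeriv ℝ i h z‖ ≤ B * τ ^ i) :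
    ‖iteratedFDeriv ℝ j (fun w => f w * h w) z‖ ≤ 2 ^ j * (A * B) * τ ^ j := by
  refine (norm_iteratedFDeriv_mul_le hf hh z le_rfl).trans ?_
  calc ∑ i ∈ Finset.range (j + 1), (j.choose i : ℝ) * ‖iteratedFDeriv ℝ i f z‖ *
        ‖iteratedFDeriv ℝ (j - i) h z‖
      ≤ ∑ i ∈ Finset.range (j + 1), (j.choose i : ℝ) * (A * B * τ ^ j) := by
        refine Finset.sum_le_sum fun i hi => ?_
        have hi' : i ≤ j := Nat.lt_succ_iff.1 (Finset.mem_range.1 hi)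
        have : A * B * τ ^ j = (A * τ ^ i) * (B * τ ^ (j - i)) := by
          rw [mul_mul_mul_comm, ← pow_add, Nat.add_sub_cancel' hi']
        rw [this, mul_assoc]
        gcongr
        · exact hfb i hi'
        · exact hhb _ (Nat.sub_le _ _)
    _ = 2 ^ j * (A * B) * τ ^ j := by
        rw [← Finset.sum_mul, ← Nat.cast_sum, Nat.sum_range_choose]
        push_cast
        ring

end Bump

/-! ### Lattice partition of unity and the bound of `g` by its grand maximal function in `L¹`. -/

section Partition

variable {n N : ℕ}

theorem exists_norm_iteratedFDeriv_le (φ : 𝓢(E n, ℂ)) (N : ℕ) :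
    ∃ L : ℝ, 0 < L ∧ ∀ j ≤ N, ∀ z, ‖iteratedFDeriv ℝ j φ z‖ ≤ L := by
  choose L hL using fun j => φ.decay 0 j
  refine ⟨∑ j ∈ Finset.range (N + 1), L j, ?_, fun j hj z => ?_⟩
  · exact Finset.sum_pos (fun j _ => (hL j).1) ⟨0, by simp⟩
  · have := (hL j).2 z
    rw [pow_zero, one_mul] at this
    exact this.trans (Finset.single_le_sum (fun i _ => (hL i).1.le)
      (Finset.mem_range.2 (Nat.lt_succ_of_le hj)))

theorem norm_sub_le_of_iteratedFDeriv_one_le {φ : 𝓢(E n, ℂ)} {L : ℝ}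
    (hL : ∀ z, ‖iteratedFDeriv ℝ 1 φ z‖ ≤ L) (x z : E n) : ‖φ z - φ x‖ ≤ L * ‖z - x‖ :=
  convex_univ.norm_image_sub_le_of_norm_fderiv_le (𝕜 := ℝ) (fun w _ => φ.differentiableAt)
    (fun w _ => by rw [← norm_iteratedFDeriv_one]; exact hL w) (Set.mem_univ _) (Set.mem_univ _)

/-- The lattice point with coordinates `z i - M`. -/
def latticePoint (M : ℕ) (z : Fin n → ℕ) : E n := WithLp.toLp 2 fun i => (z i : ℝ) - M

/-- `Θ` is a product over coordinates of differences `T (t + 1) - T t` of a smooth step. Its lattice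
translates telescope in each coordinate to `T (w i + M + 1) - T (w i - M) = 1`. A factor vanishes as
soon as its coordinate exceeds `1` in modulus. -/
theorem exists_partition (n : ℕ) : ∃ Θ : 𝓢(E n, ℂ), (∀ w, (n : ℝ) < ‖w‖ → Θ w = 0) ∧
    ∀ (M : ℕ) (w : E n), (∀ i, |w i| ≤ M) →
      ∑ z ∈ Fintype.piFinset (fun _ : Fin n => Finset.range (2 * M + 1)),
        Θ (w - latticePoint M z) = 1 := by
  set T := Real.smoothTransition with hT
  set f : E n → ℂ := fun w => ((∏ i, (T (w i + 1) - T (w i)) : ℝ) : ℂ) with hf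
  have hsm : ContDiff ℝ ((⊤ : ℕ∞) : WithTop ℕ∞) f := by
    refine Complex.ofRealCLM.contDiff.comp ?_
    have hf : ∀ i ∈ (Finset.univ : Finset (Fin n)), ContDiff ℝ ((⊤ : ℕ∞) : WithTop ℕ∞)
        fun w : E n => T (w i + 1) - T (w i) := by
      intro i _
      have h1 : ContDiff ℝ ((⊤ : ℕ∞) : WithTop ℕ∞) fun w : E n => w i :=
        (EuclideanSpace.proj i : E n →L[ℝ] ℝ).contDiff
      exact (Real.smoothTransition.contDiff.comp (h1.add contDiff_const)).sub
        (Real.smoothTransition.contDiff.comp h1)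
    exact contDiff_prod hf
  have hz : ∀ w : E n, (n : ℝ) < ‖w‖ → f w = 0 := by
    intro w hw
    obtain ⟨i, hi⟩ : ∃ i, 1 < |w i| := by
      by_contra! h
      have := (norm_le_sum_abs w).trans (Finset.sum_le_card_nsmul _ _ _ fun i _ => h i)
      simp at this
      linarith
    simp only [hf, Complex.ofReal_eq_zero]
    refine Finset.prod_eq_zero (Finset.mem_univ i) ?_
    rcases lt_abs.1 hi with h | h
    · rw [hT, Real.smoothTransition.one_of_one_le (by linarith),
        Real.smoothTransition.one_of_one_le h.le, sub_self]
    · rw [hT, Real.smoothTransition.zero_of_nonpos (by linarith),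
        Real.smoothTransition.zero_of_nonpos (by linarith), sub_self]
  have hc : HasCompactSupport f := by
    refine HasCompactSupport.of_support_subset_isCompact (isCompact_closedBall (0 : E n) n) ?_
    intro w hw
    rw [mem_closedBall, dist_zero_right]
    by_contra h
    exact hw (hz w (not_le.1 h))
  refine ⟨hc.toSchwartzMap hsm, hz, fun M w hw => ?_⟩
  change ∑ z ∈ Fintype.piFinset (fun _ : Fin n => Finset.range (2 * M + 1)),
    ((∏ i, (T ((w - latticePoint M z) i + 1) - T ((w - latticePoint M z) i)) : ℝ) : ℂ) = 1
  rw [← Complex.ofReal_sum]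
  have h1 := Finset.prod_univ_sum (κ := fun _ : Fin n => ℕ)
    (t := fun _ : Fin n => Finset.range (2 * M + 1))
    (f := fun i k => T (w i - ((k : ℝ) - M) + 1) - T (w i - ((k : ℝ) - M)))
  have h2 : ∀ i, ∑ k ∈ Finset.range (2 * M + 1),
      (T (w i - ((k : ℝ) - M) + 1) - T (w i - ((k : ℝ) - M))) = 1 := by
    intro i
    have h3 := Finset.sum_range_sub' (fun k : ℕ => T (w i - ((k : ℝ) - M) + 1)) (2 * M + 1)
    obtain ⟨h4, h5⟩ := abs_le.1 (hw i)
    rw [hT, Real.smoothTransition.one_of_one_le (x := w i - (((0 : ℕ) : ℝ) - M) + 1)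
      (by push_cast; linarith), Real.smoothTransition.zero_of_nonpos
      (x := w i - (((2 * M + 1 : ℕ) : ℝ) - M) + 1) (by push_cast; linarith)] at h3
    refine Eq.trans (Finset.sum_congr rfl fun k _ => ?_) (h3.trans (sub_zero 1))
    congr 2
    push_cast
    ring
  rw [Finset.prod_congr rfl fun i _ => h2 i, Finset.prod_const_one] at h1
  rw [Complex.ofReal_eq_one]
  exact h1.symm

/-- A piece of `φ` at scale `ε ≤ 1` is a bump of height nearly `‖φ x‖`: on it `φ` varies by at most
`(n + 1) * L * ε`, and for `i ≥ 1` the derivative bound satisfies `L ≤ L * ε * ε⁻¹ ^ i`, so it is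
absorbed into the same error. -/
theorem enorm_apply_mul_dilate_le (hn : 1 ≤ n) {Θ φ F : 𝓢(E n, ℂ)} {B L ε : ℝ} (hB : 0 < B)
    (hL : 0 < L) (hε : 0 < ε) (hε1 : ε ≤ 1) (hΘ : ∀ w, (n : ℝ) < ‖w‖ → Θ w = 0)
    (hΘB : ∀ j ≤ N, ∀ w, ‖iteratedFDeriv ℝ j Θ w‖ ≤ B)
    (hφL : ∀ j ≤ N + 1, ∀ w, ‖iteratedFDeriv ℝ j φ w‖ ≤ L) {y : E n}
    (hF : ∀ w, F w = φ w * Θ (ε⁻¹ • (w - y))) (g : 𝓢'(E n, ℂ)) {x : E n} (hx : ‖y - x‖ < ε) :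
    ‖g F‖ₑ ≤ ENNReal.ofReal (2 ^ N * B * n ^ N * ε ^ n) *
      ((‖φ x‖ₑ + ENNReal.ofReal ((n + 1) * L * ε)) * grandMaximal N g x) := by
  have hn' : (1 : ℝ) ≤ n := by exact_mod_cast hn
  set A : ℝ := ‖φ x‖ + (n + 1) * L * ε with hA
  have hApos : 0 < A := by positivity
  have hsupp : ∀ z, n * ε < ‖z - y‖ → F z = 0 := by
    intro z hz
    rw [hF, hΘ, mul_zero]
    rw [norm_smul, norm_inv, Real.norm_of_nonneg hε.le, lt_inv_mul_iff₀ hε]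
    linarith
  have hFfun : (F : E n → ℂ) = fun w => φ w * Θ (ε⁻¹ • w + (-(ε⁻¹ • y))) := by
    ext w
    rw [hF, smul_sub, sub_eq_add_neg]
  have hder : ∀ j ≤ N, ∀ z, ‖iteratedFDeriv ℝ j F z‖ ≤ 2 ^ N * (A * B) * (ε ^ j)⁻¹ := by
    intro j hj z
    rcases le_or_gt ‖z - y‖ (n * ε) with hz | hz
    · rw [hFfun, ← inv_pow]
      have hle : (2 : ℝ) ^ j * (A * B) * ε⁻¹ ^ j ≤ 2 ^ N * (A * B) * ε⁻¹ ^ j := by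
        gcongr
        norm_num
      refine le_trans (norm_iteratedFDeriv_mul_le_of_le (φ.smooth j)
        ((Θ.smooth j).comp ((contDiff_id.const_smul _).add contDiff_const)) hApos.le
        (by positivity) (fun i hi => ?_) (fun i hi => ?_)) hle
      · rcases Nat.eq_zero_or_pos i with rfl | hi0
        · rw [norm_iteratedFDeriv_zero, pow_zero, mul_one]
          have h1 := norm_sub_le_of_iteratedFDeriv_one_le (fun w => hφL 1 (by omega) w) x z
          have h2 : ‖z - x‖ ≤ (n + 1) * ε := by
            calc ‖z - x‖ ≤ ‖z - y‖ + ‖y - x‖ := norm_sub_le_norm_sub_add_norm_sub _ _ _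
              _ ≤ n * ε + ε := by linarith
              _ = _ := by ring
          calc ‖φ z‖ ≤ ‖φ x‖ + ‖φ z - φ x‖ := by
                rw [add_comm, ← sub_le_iff_le_add]; exact norm_sub_norm_le _ _
            _ ≤ ‖φ x‖ + L * ((n + 1) * ε) := by
                gcongr
                exact h1.trans (by gcongr)
            _ = A := by rw [hA]; ring
        · have h1 : L ≤ L * ε * ε⁻¹ ^ i := by
            obtain ⟨m, rfl⟩ := Nat.exists_eq_succ_of_ne_zero hi0.ne'
            rw [pow_succ']
            have : 1 ≤ ε⁻¹ ^ m := one_le_pow₀ ((one_le_inv₀ hε).2 hε1)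
            calc L ≤ L * ε⁻¹ ^ m := le_mul_of_one_le_right hL.le this
              _ = _ := by field_simp
          refine (hφL i (by omega) z).trans (h1.trans ?_)
          gcongr
          have : 0 ≤ ‖φ x‖ := norm_nonneg _
          rw [hA]
          nlinarith [mul_pos hL hε]
      · refine (norm_iteratedFDeriv_comp_affine_le (Θ.smooth i) ε⁻¹ _ z).trans ?_
        rw [abs_of_pos (by positivity), mul_comm]
        gcongr
        exact hΘB i (by omega) _
    · rw [iteratedFDeriv_eq_zero_of_lt hsupp j hz, norm_zero]
      positivity
  have h := enorm_apply_le_of_bump (N := N) g F hn' hε (A := 2 ^ N * (A * B)) (by positivity) hx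
    hsupp hder
  refine h.trans_eq ?_
  have h1 : 2 ^ N * (A * B) * (n : ℝ) ^ N * ε ^ n = 2 ^ N * B * n ^ N * ε ^ n * A := by ring
  rw [h1, ENNReal.ofReal_mul (by positivity), hA, ENNReal.ofReal_add (by positivity)
    (by positivity), ofReal_norm, mul_assoc]

theorem latticePoint_pairwiseDisjoint {ε : ℝ} (hε : 0 < ε) (M : ℕ) (S : Set (Fin n → ℕ)) :
    S.PairwiseDisjoint fun z => ball (ε • (latticePoint M z : E n)) (ε / 2) := by
  intro z _ z' _ hne
  obtain ⟨i, hi⟩ := Function.ne_iff.1 hne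
  refine ball_disjoint_ball ?_
  rw [dist_eq_norm, ← smul_sub, norm_smul, Real.norm_of_nonneg hε.le]
  have h1 : (1 : ℝ) ≤ |(z i : ℝ) - z' i| := by
    have : (1 : ℤ) ≤ |(z i : ℤ) - z' i| := Int.one_le_abs (by omega)
    exact_mod_cast this
  have h2 := abs_apply_le_norm ((latticePoint M z : E n) - latticePoint M z') i
  have h3 : ((latticePoint M z : E n) - latticePoint M z') i = (z i : ℝ) - z' i := by
    simp [latticePoint]
  rw [h3] at h2
  nlinarith

/-- Cut `φ` into pieces at scale `ε`. Each is bounded by `ε ^ n (‖φ x‖ + O(ε)) G_N g(x)` for every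
`x` in a small ball about its centre, so averaging over that ball gives an integral. The balls are
disjoint and lie in `K`, so the integrals add up; then `ε → 0`. -/
theorem exists_enorm_apply_le_lintegral (hn : 1 ≤ n) (N : ℕ) :
    ∃ C : ℝ≥0, ∀ (g : 𝓢'(E n, ℂ)) (K : Set (E n)), ∫⁻ x in K, grandMaximal N g x ≠ ∞ →
      ∀ φ : 𝓢(E n, ℂ), HasCompactSupport φ → ∀ ρ : ℝ, 0 < ρ → (∀ z, φ z ≠ 0 → ball z ρ ⊆ K) →
        ‖g φ‖ₑ ≤ C * ∫⁻ x in K, ‖φ x‖ₑ * grandMaximal N g x := by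
  obtain ⟨Θ, hΘ, hsum⟩ := exists_partition n
  obtain ⟨B, hB, hΘB⟩ := exists_norm_iteratedFDeriv_le Θ N
  have hV0 : volume (ball (0 : E n) 1) ≠ 0 := volume_unitBall_ne_zero
  have hVt : volume (ball (0 : E n) 1) ≠ ∞ := volume_unitBall_ne_top
  set C : ℝ≥0∞ := ENNReal.ofReal (2 ^ N * B * n ^ N * 2 ^ n) * (volume (ball (0 : E n) 1))⁻¹
    with hC
  have hCt : C ≠ ∞ := ENNReal.mul_ne_top ENNReal.ofReal_ne_top (ENNReal.inv_ne_top.2 hV0)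
  refine ⟨C.toNNReal, fun g K hK φ hφ ρ hρ hφK => ?_⟩
  rw [ENNReal.coe_toNNReal hCt]
  set G := grandMaximal N g with hG
  have hGm : Measurable G := measurable_grandMaximal g
  obtain ⟨L, hL, hφL⟩ := exists_norm_iteratedFDeriv_le φ (N + 1)
  obtain ⟨R, hR⟩ : ∃ R : ℝ, ∀ z, φ z ≠ 0 → ‖z‖ ≤ R := by
    obtain ⟨R, hR⟩ := hφ.isCompact.isBounded.subset_closedBall 0
    exact ⟨R, fun z hz => by simpa using hR (subset_tsupport _ hz)⟩
  have key : ∀ ε : ℝ, 0 < ε → ε ≤ 1 → (n + 1) * ε < ρ → ‖g φ‖ₑ ≤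
      C * ∫⁻ x in K, (‖φ x‖ₑ + ENNReal.ofReal ((n + 1) * L * ε)) * G x := by
    intro ε hε hε1 hερ
    obtain ⟨M, hM⟩ := exists_nat_ge (R / ε)
    set Z := Fintype.piFinset (fun _ : Fin n => Finset.range (2 * M + 1)) with hZ
    have hFs : ∀ z, ContDiff ℝ ((⊤ : ℕ∞) : WithTop ℕ∞) fun w => φ w * Θ (ε⁻¹ • (w - ε • latticePoint M z)) := fun z =>
      φ.smooth'.mul (Θ.smooth'.comp ((contDiff_id.sub contDiff_const).const_smul _))
    have hFc : ∀ z, HasCompactSupport fun w => φ w * Θ (ε⁻¹ • (w - ε • latticePoint M z)) :=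
      fun z => hφ.mul_right
    set F : (Fin n → ℕ) → 𝓢(E n, ℂ) := fun z => (hFc z).toSchwartzMap (hFs z) with hF
    have hFa : ∀ z w, F z w = φ w * Θ (ε⁻¹ • (w - ε • latticePoint M z)) := fun z w => rfl
    have hφsum : φ = ∑ z ∈ Z, F z := by
      ext w
      rw [sum_apply]
      simp_rw [hFa]
      rw [← Finset.mul_sum]
      by_cases hw : φ w = 0
      · rw [hw, zero_mul]
      · have h1 := hsum M (ε⁻¹ • w) fun i => by
          have h2 : |w i| ≤ R := (abs_apply_le_norm w i).trans (hR w hw)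
          rw [PiLp.smul_apply, smul_eq_mul, abs_mul, abs_of_pos (inv_pos.2 hε)]
          rw [div_le_iff₀ hε] at hM
          rw [inv_mul_le_iff₀ hε]
          linarith
        have h3 : ∀ z, ε⁻¹ • (w - ε • (latticePoint M z : E n)) = ε⁻¹ • w - latticePoint M z := by
          intro z
          rw [smul_sub, smul_smul, inv_mul_cancel₀ hε.ne', one_smul]
        simp_rw [h3]
        rw [h1, mul_one]
    classical
    -- Only nonzero pieces are kept: such a piece meets the support of `φ` within `n * ε` of its
    -- centre, so its ball lies within distance `(n + 1) * ε < ρ` of a point where `φ ≠ 0`, hence in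
    -- `K`.
    set S := Z.filter fun z => F z ≠ 0 with hS
    have hφsum' : φ = ∑ z ∈ S, F z := by
      rw [hS, Finset.sum_filter_ne_zero]
      exact hφsum
    set b : (Fin n → ℕ) → Set (E n) := fun z => ball (ε • (latticePoint M z : E n)) (ε / 2)
      with hb
    have hbK : ∀ z ∈ S, b z ⊆ K := by
      intro z hz
      have hne : F z ≠ 0 := (Finset.mem_filter.1 hz).2
      obtain ⟨w, hw⟩ : ∃ w, F z w ≠ 0 := by
        by_contra! h
        exact hne (SchwartzMap.ext h)
      rw [hFa] at hw
      refine Set.Subset.trans ?_ (hφK w (left_ne_zero_of_mul hw))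
      have h1 : ‖ε⁻¹ • (w - ε • (latticePoint M z : E n))‖ ≤ n := by
        by_contra h
        exact right_ne_zero_of_mul hw (hΘ _ (not_le.1 h))
      rw [norm_smul, norm_inv, Real.norm_of_nonneg hε.le, inv_mul_le_iff₀ hε] at h1
      refine ball_subset_ball' ?_
      rw [dist_comm, dist_eq_norm]
      linarith
    have hone : ∀ z ∈ S, ‖g (F z)‖ₑ ≤
        C * ∫⁻ x in b z, (‖φ x‖ₑ + ENNReal.ofReal ((n + 1) * L * ε)) * G x := by
      intro z _
      have hvol : volume (b z) = ENNReal.ofReal ((ε / 2) ^ n) * volume (ball (0 : E n) 1) :=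
        volume_ball_eq _ (by positivity)
      have hv0 : volume (b z) ≠ 0 := by
        rw [hvol]
        exact mul_ne_zero (by simpa using by positivity) hV0
      have hvt : volume (b z) ≠ ∞ := by
        rw [hvol]
        exact ENNReal.mul_ne_top ENNReal.ofReal_ne_top hVt
      have h1 : ‖g (F z)‖ₑ * volume (b z) ≤ ENNReal.ofReal (2 ^ N * B * n ^ N * ε ^ n) *
          ∫⁻ x in b z, (‖φ x‖ₑ + ENNReal.ofReal ((n + 1) * L * ε)) * G x := by
        rw [← lintegral_const_mul _ (by fun_prop), ← setLIntegral_const]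
        refine setLIntegral_mono (by fun_prop) fun x hx => ?_
        refine enorm_apply_mul_dilate_le hn hB hL hε hε1 hΘ hΘB hφL (hFa z) g ?_
        have : dist x (ε • (latticePoint M z : E n)) < ε / 2 := hx
        rw [dist_comm, dist_eq_norm] at this
        linarith
      rw [← ENNReal.le_div_iff_mul_le (Or.inl hv0) (Or.inl hvt)] at h1
      refine h1.trans_eq ?_
      rw [ENNReal.div_eq_inv_mul, ← mul_assoc]
      congr 1
      rw [hvol, ENNReal.mul_inv (Or.inr hVt) (Or.inr hV0), hC,
        ← ENNReal.ofReal_inv_of_pos (by positivity), mul_right_comm, ← ENNReal.ofReal_mul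
        (by positivity)]
      congr 2
      rw [div_pow]
      field_simp
    calc ‖g φ‖ₑ = ‖∑ z ∈ S, g (F z)‖ₑ := by
          conv_lhs => rw [hφsum', map_sum]
      _ ≤ ∑ z ∈ S, ‖g (F z)‖ₑ := enorm_sum_le _ _
      _ ≤ ∑ z ∈ S, C * ∫⁻ x in b z, (‖φ x‖ₑ + ENNReal.ofReal ((n + 1) * L * ε)) * G x :=
          Finset.sum_le_sum hone
      _ = C * ∫⁻ x in ⋃ z ∈ S, b z, (‖φ x‖ₑ + ENNReal.ofReal ((n + 1) * L * ε)) * G x := by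
          rw [lintegral_biUnion_finset (latticePoint_pairwiseDisjoint hε M _)
            (fun z _ => measurableSet_ball), Finset.mul_sum]
      _ ≤ _ := mul_le_mul_right (lintegral_mono_set (Set.iUnion₂_subset hbK)) _
  -- Finiteness of the integral of `G` over `K` is what makes the error term vanish in the limit.
  have hlim : Filter.Tendsto (fun ε : ℝ => C * ((∫⁻ x in K, ‖φ x‖ₑ * G x) +
      ENNReal.ofReal ((n + 1) * L * ε) * ∫⁻ x in K, G x)) (nhdsWithin 0 (Set.Ioi 0))
      (nhds (C * ∫⁻ x in K, ‖φ x‖ₑ * G x)) := by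
    have h1 : Filter.Tendsto (fun ε : ℝ => ENNReal.ofReal ((n + 1) * L * ε))
        (nhdsWithin 0 (Set.Ioi 0)) (nhds 0) := by
      have : Filter.Tendsto (fun ε : ℝ => ENNReal.ofReal ((n + 1) * L * ε)) (nhds 0)
          (nhds (ENNReal.ofReal ((n + 1) * L * 0))) :=
        (ENNReal.continuous_ofReal.comp (continuous_const.mul continuous_id)).tendsto 0
      rw [mul_zero, ENNReal.ofReal_zero] at this
      exact this.mono_left nhdsWithin_le_nhds
    have h2 := (ENNReal.Tendsto.mul_const (b := ∫⁻ x in K, G x) h1 (Or.inr hK)).const_add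
      (∫⁻ x in K, ‖φ x‖ₑ * G x)
    rw [zero_mul, add_zero] at h2
    exact ENNReal.Tendsto.const_mul h2 (Or.inr hCt)
  refine ge_of_tendsto hlim ?_
  have h1 : ∀ᶠ ε : ℝ in nhdsWithin 0 (Set.Ioi 0), ε ∈ Set.Ioo 0 (min 1 (ρ / (n + 1))) :=
    Ioo_mem_nhdsGT (by positivity)
  filter_upwards [h1] with ε hε
  refine (key ε hε.1 (hε.2.le.trans (min_le_left _ _)) ?_).trans_eq ?_
  · have := hε.2.trans_le (min_le_right _ _)
    rw [lt_div_iff₀ (by positivity)] at this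
    linarith
  · congr 1
    simp_rw [add_mul]
    rw [lintegral_add_left (by fun_prop), lintegral_const_mul _ hGm]

end Partition

/-! ### Duality: localized distributions are functions dominated by the grand maximal function. -/

section Riesz

variable {n N : ℕ}

/-- Makes the `L¹` norm continuous on `L²` of a finite measure, so that an `L¹` bound known on a
dense subspace extends to all of `L²`. -/
theorem eLpNorm_one_le_mul_edist (μ : Measure (E n)) [IsFiniteMeasure μ] (f h : Lp ℂ 2 μ) :
    eLpNorm f 1 μ ≤ eLpNorm h 1 μ + μ Set.univ ^ ((1 : ℝ) / 2) * edist f h := by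
  have h1 : (f : E n → ℂ) = (h : E n → ℂ) + ((f : E n → ℂ) - (h : E n → ℂ)) := by abel
  have h2 : eLpNorm f 1 μ ≤ eLpNorm h 1 μ + eLpNorm ((f : E n → ℂ) - (h : E n → ℂ)) 1 μ := by
    conv_lhs => rw [h1]
    exact eLpNorm_add_le (Lp.aestronglyMeasurable h)
      ((Lp.aestronglyMeasurable f).sub (Lp.aestronglyMeasurable h)) le_rfl
  refine h2.trans (add_le_add le_rfl ?_)
  have h3 := eLpNorm_le_eLpNorm_mul_rpow_measure_univ (p := 1) (q := 2) (μ := μ)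
    (by norm_num) ((Lp.aestronglyMeasurable f).sub (Lp.aestronglyMeasurable h))
  rw [Lp.edist_def, mul_comm]
  refine h3.trans_eq ?_
  congr 2
  norm_num

/-- The duality of `L¹` and `L^∞` obtained through Hilbert space: the functional extends to `L²(μ)`,
is represented there by some `v`, and the `L¹` bound forces `|v| ≤ C` almost everywhere. -/
theorem exists_integral_eq_of_enorm_le (μ : Measure (E n)) [IsFiniteMeasure μ] (C : ℝ≥0)
    (T : 𝓢(E n, ℂ) →ₗ[ℂ] ℂ) (hT : ∀ φ, ‖T φ‖ₑ ≤ C * ∫⁻ x, ‖φ x‖ₑ ∂μ) :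
    ∃ h : E n → ℂ, StronglyMeasurable h ∧ (∀ x, ‖h x‖ₑ ≤ C) ∧ ∀ φ, T φ = ∫ x, h x * φ x ∂μ := by
  set e : 𝓢(E n, ℂ) →ₗ[ℂ] Lp ℂ 2 μ := (SchwartzMap.toLpCLM ℂ ℂ 2 μ).toLinearMap with he
  have heφ : ∀ φ, (e φ : E n → ℂ) =ᵐ[μ] φ := fun φ => φ.coeFn_toLp 2 μ
  have hdense : DenseRange e :=
    SchwartzMap.denseRange_toLpCLM (F := ℂ) (p := 2) (μ := μ) (by norm_num)
  have hT1 : ∀ φ, ‖T φ‖ₑ ≤ C * eLpNorm (e φ) 1 μ := by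
    intro φ
    rw [eLpNorm_congr_ae (heφ φ), eLpNorm_one_eq_lintegral_enorm]
    exact hT φ
  set A : ℝ≥0∞ := C * μ Set.univ ^ ((1 : ℝ) / 2) with hA
  have hAt : A ≠ ∞ := ENNReal.mul_ne_top ENNReal.coe_ne_top
    (ENNReal.rpow_ne_top_of_nonneg (by norm_num) (measure_ne_top _ _))
  have hT2 : ∃ D, ∀ φ, ‖T φ‖ ≤ D * ‖e φ‖ := by
    refine ⟨A.toReal, fun φ => ?_⟩
    have h1 := eLpNorm_one_le_mul_edist μ (e φ) 0
    have h0 : eLpNorm ((0 : Lp ℂ 2 μ) : E n → ℂ) 1 μ = 0 := by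
      rw [eLpNorm_congr_ae (Lp.coeFn_zero ℂ 2 μ), eLpNorm_zero]
    rw [h0, zero_add, edist_zero_right] at h1
    have h2 : ‖T φ‖ₑ ≤ A * ‖e φ‖ₑ := by
      refine (hT1 φ).trans ?_
      rw [hA, mul_assoc]
      exact mul_le_mul_right h1 _
    have h3 := ENNReal.toReal_mono (ENNReal.mul_ne_top hAt enorm_ne_top) h2
    rwa [ENNReal.toReal_mul, toReal_enorm, toReal_enorm] at h3
  set S : Lp ℂ 2 μ →L[ℂ] ℂ := T.extendOfNorm e with hS
  have hSe : ∀ φ, S (e φ) = T φ := LinearMap.extendOfNorm_eq hdense hT2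
  have hS1 : ∀ f : Lp ℂ 2 μ, ‖S f‖ₑ ≤ C * eLpNorm f 1 μ := by
    refine isClosed_property hdense (isClosed_le (by fun_prop) ?_) fun φ => ?_
    · have hc : Continuous fun f : Lp ℂ 2 μ => eLpNorm f 1 μ :=
        continuous_of_le_add_edist _ (ENNReal.rpow_ne_top_of_nonneg (by norm_num)
          (measure_ne_top _ _)) (eLpNorm_one_le_mul_edist μ)
      exact ENNReal.continuous_const_mul ENNReal.coe_ne_top |>.comp hc
    · rw [hSe]
      exact hT1 φ
  set v : Lp ℂ 2 μ := (InnerProductSpace.toDual ℂ (Lp ℂ 2 μ)).symm S with hv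
  have hSv : ∀ f : Lp ℂ 2 μ, S f = ∫ x, inner ℂ (v x) (f x) ∂μ := by
    intro f
    rw [← L2.inner_def, hv, InnerProductSpace.toDual_symm_apply]
  have hvm : StronglyMeasurable (v : E n → ℂ) := Lp.stronglyMeasurable v
  have hbound : (fun x => ‖v x‖ₑ) ≤ᵐ[μ] fun _ => (C : ℝ≥0∞) := by
    refine ae_le_of_forall_setLIntegral_le_of_sigmaFinite hvm.enorm fun s hs _ => ?_
    -- Testing on the phase of `v` over `s` yields `∫_s |v|` on one side and at most `C * μ s` on
    -- the other.
    set w : E n → ℂ := s.indicator fun x => v x / ‖v x‖ with hw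
    have hwm : Measurable w := by
      refine Measurable.indicator ?_ hs
      exact hvm.measurable.div (Complex.measurable_ofReal.comp hvm.measurable.norm)
    have hw1 : ∀ x, ‖w x‖ ≤ 1 := by
      intro x
      by_cases hx : x ∈ s
      · rw [hw, Set.indicator_of_mem hx, norm_div, Complex.norm_real, norm_norm]
        exact div_self_le_one _
      · rw [hw, Set.indicator_of_notMem hx, norm_zero]
        exact zero_le_one
    have hwL : MemLp w 2 μ :=
      MemLp.of_bound hwm.aestronglyMeasurable 1 (Filter.Eventually.of_forall hw1)
    have h1 : S (hwL.toLp w) = ((∫ x in s, ‖v x‖ ∂μ : ℝ) : ℂ) := by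
      rw [hSv, ← integral_complex_ofReal, ← integral_indicator hs]
      refine integral_congr_ae ?_
      filter_upwards [hwL.coeFn_toLp] with x hx
      rw [hx]
      by_cases hxs : x ∈ s
      · rw [hw, Set.indicator_of_mem hxs, Set.indicator_of_mem hxs, RCLike.inner_apply]
        rcases eq_or_ne (v x) 0 with h0 | h0
        · simp [h0]
        · have : (‖v x‖ : ℂ) ≠ 0 := by exact_mod_cast norm_ne_zero_iff.2 h0
          rw [div_mul_eq_mul_div, RCLike.mul_conj, div_eq_iff this, sq]
          rfl
      · rw [hw, Set.indicator_of_notMem hxs, Set.indicator_of_notMem hxs, inner_zero_right]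
    have hvi : Integrable (fun x => ‖v x‖) μ :=
      ((Lp.memLp v).integrable (by norm_num)).norm
    have h2 : ‖S (hwL.toLp w)‖ₑ = ∫⁻ x in s, ‖v x‖ₑ ∂μ := by
      rw [h1, ← ofReal_norm, Complex.norm_real, Real.norm_of_nonneg
        (integral_nonneg fun x => norm_nonneg _),
        ofReal_integral_eq_lintegral_ofReal hvi.integrableOn
          (Filter.Eventually.of_forall fun x => norm_nonneg _)]
      simp_rw [ofReal_norm]
    rw [← h2]
    refine (hS1 _).trans ?_
    rw [eLpNorm_congr_ae hwL.coeFn_toLp, eLpNorm_one_eq_lintegral_enorm, setLIntegral_const]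
    refine mul_le_mul_right ?_ _
    calc ∫⁻ x, ‖w x‖ₑ ∂μ ≤ ∫⁻ x, s.indicator 1 x ∂μ := by
          refine lintegral_mono fun x => ?_
          by_cases hx : x ∈ s
          · rw [Set.indicator_of_mem hx, Pi.one_apply, ← ofReal_norm]
            exact ENNReal.ofReal_le_one.2 (hw1 x)
          · rw [hw, Set.indicator_of_notMem hx, enorm_zero]
            exact zero_le
      _ = μ s := lintegral_indicator_one hs
  -- Setting the function to `0` off `D`, a null modification, makes the bound hold everywhere.
  set D : Set (E n) := {x | ‖v x‖ₑ ≤ C} with hD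
  have hDm : MeasurableSet D := measurableSet_le hvm.enorm measurable_const
  refine ⟨D.indicator fun x => (starRingEnd ℂ) (v x),
    (continuous_star.comp_stronglyMeasurable hvm).indicator hDm, fun x => ?_, fun φ => ?_⟩
  · by_cases hx : x ∈ D
    · rw [Set.indicator_of_mem hx, ← ofReal_norm, RCLike.norm_conj, ofReal_norm]
      exact hx
    · rw [Set.indicator_of_notMem hx, enorm_zero]
      exact zero_le
  · rw [← hSe, hSv]
    refine integral_congr_ae ?_
    filter_upwards [hbound, heφ φ] with x hx hx'
    rw [hx', Set.indicator_of_mem (show x ∈ D from hx), RCLike.inner_apply, mul_comm]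

/-- The duality is applied with the finite measure `G_N g dx` on `K`: the density of `Φ g` with
respect to it is bounded, and multiplying back by `G_N g` gives the function. -/
theorem exists_localization (hn : 1 ≤ n) (N : ℕ) :
    ∃ C : ℝ≥0, ∀ (g : 𝓢'(E n, ℂ)) (K : Set (E n)), MeasurableSet K →
      ∫⁻ x in K, grandMaximal N g x ≠ ∞ → ∀ Φ : 𝓢(E n, ℂ), HasCompactSupport Φ →
      (∀ x, ‖Φ x‖ ≤ 1) → ∀ ρ : ℝ, 0 < ρ → (∀ z, Φ z ≠ 0 → ball z ρ ⊆ K) →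
      ∃ f : E n → ℂ, StronglyMeasurable f ∧ (∀ x, ‖f x‖ₑ ≤ C * grandMaximal N g x) ∧
        (∀ x, x ∉ K → f x = 0) ∧
        ∀ φ : 𝓢(E n, ℂ), g (SchwartzMap.smulLeftCLM ℂ Φ φ) = ∫ x, f x * φ x := by
  obtain ⟨C, hC⟩ := exists_enorm_apply_le_lintegral hn N
  refine ⟨C, fun g K hKm hK Φ hΦ hΦ1 ρ hρ hΦK => ?_⟩
  set G := grandMaximal N g with hG
  have hGm : Measurable G := measurable_grandMaximal g
  set μ : Measure (E n) := (volume.restrict K).withDensity G with hμ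
  have : IsFiniteMeasure μ := isFiniteMeasure_withDensity hK
  have hΦt : Function.HasTemperateGrowth Φ := Φ.hasTemperateGrowth
  set T : 𝓢(E n, ℂ) →ₗ[ℂ] ℂ :=
    { toFun := fun φ => g (SchwartzMap.smulLeftCLM ℂ Φ φ)
      map_add' := fun φ ψ => by rw [map_add, map_add]
      map_smul' := fun c φ => by rw [map_smul, map_smul]; rfl } with hT
  have hTb : ∀ φ, ‖T φ‖ₑ ≤ C * ∫⁻ x, ‖φ x‖ₑ ∂μ := by
    intro φ
    have ha : ∀ x, SchwartzMap.smulLeftCLM ℂ Φ φ x = Φ x * φ x := fun x =>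
      SchwartzMap.smulLeftCLM_apply_apply hΦt φ x
    have h1 := hC g K hK (SchwartzMap.smulLeftCLM ℂ Φ φ) (by
      rw [SchwartzMap.smulLeftCLM_apply hΦt]
      exact hΦ.smul_right) ρ hρ (fun z hz => hΦK z (by
        rw [ha] at hz
        exact left_ne_zero_of_mul hz))
    refine h1.trans (mul_le_mul_right ?_ _)
    rw [hμ, lintegral_withDensity_eq_lintegral_mul _ hGm (by fun_prop)]
    refine lintegral_mono fun x => ?_
    rw [ha, enorm_mul, Pi.mul_apply, mul_comm (G x)]
    refine mul_le_mul_left ?_ _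
    refine mul_le_of_le_one_left' ?_
    rw [← ofReal_norm]
    exact ENNReal.ofReal_le_one.2 (hΦ1 x)
  obtain ⟨h, hm, hb, hh⟩ := exists_integral_eq_of_enorm_le μ C T hTb
  refine ⟨K.indicator fun x => (G x).toReal • h x, ?_, fun x => ?_, fun x hx => ?_, fun φ => ?_⟩
  · exact (hGm.ennreal_toReal.stronglyMeasurable.smul hm).indicator hKm
  · by_cases hx : x ∈ K
    · rw [Set.indicator_of_mem hx, enorm_smul, mul_comm]
      refine mul_le_mul' (hb x) ?_
      rw [Real.enorm_eq_ofReal ENNReal.toReal_nonneg]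
      exact ENNReal.ofReal_toReal_le
    · rw [Set.indicator_of_notMem hx, enorm_zero]
      exact zero_le
  · exact Set.indicator_of_notMem hx _
  · have h1 : g (SchwartzMap.smulLeftCLM ℂ Φ φ) = T φ := rfl
    rw [h1, hh, hμ, integral_withDensity_eq_integral_toReal_smul hGm
      (ae_lt_top hGm hK), ← integral_indicator hKm]
    refine integral_congr_ae (Filter.Eventually.of_forall fun x => ?_)
    by_cases hx : x ∈ K
    · simp only [Set.indicator_of_mem hx]
      rw [smul_mul_assoc]
    · simp only [Set.indicator_of_notMem hx, zero_mul]

end Riesz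

/-! ### Smooth Taylor remainders and scale-invariant derivative bounds. -/

section Taylor

variable {n : ℕ}

/-- The codomain `V` is general because the induction on `m` passes to the derivative, which takes
values in `E n →L[ℝ] V`. -/
theorem contDiff_parametric_integral {V : Type} [NormedAddCommGroup V] [NormedSpace ℝ V]
    [CompleteSpace V] (m : ℕ) {F : ℝ × E n → V} (hF : ContDiff ℝ ((⊤ : ℕ∞) : WithTop ℕ∞) F) :
    ContDiff ℝ m fun w => ∫ t in (0 : ℝ)..1, F (t, w) := by
  induction m generalizing V with
  | zero =>
    rw [Nat.cast_zero, contDiff_zero]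
    have hc : Continuous fun q : E n × ℝ => F (q.2, q.1) :=
      hF.continuous.comp (continuous_snd.prodMk continuous_fst)
    exact intervalIntegral.continuous_parametric_intervalIntegral_of_continuous' hc 0 1
  | succ m ih =>
    have hd : ContDiff ℝ ((⊤ : ℕ∞) : WithTop ℕ∞) (fderiv ℝ F) :=
      hF.fderiv_right (m := ((⊤ : ℕ∞) : WithTop ℕ∞)) (by exact_mod_cast le_top)
    set F' : ℝ × E n → E n →L[ℝ] V :=
      fun q => (fderiv ℝ F q).comp (ContinuousLinearMap.inr ℝ ℝ (E n)) with hF'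
    have hF's : ContDiff ℝ ((⊤ : ℕ∞) : WithTop ℕ∞) F' := hd.clm_comp contDiff_const
    have hdiff : ∀ t w, HasFDerivAt (fun w => F (t, w)) (F' (t, w)) w := by
      intro t w
      have h1 : HasFDerivAt F (fderiv ℝ F (t, w)) (t, w) :=
        (hF.differentiable (by simp)).differentiableAt.hasFDerivAt
      exact h1.comp w (hasFDerivAt_prodMk_right t w)
    rw [Nat.cast_add, Nat.cast_one, contDiff_succ_iff_hasFDerivAt]
    refine ⟨fun w => ∫ t in (0 : ℝ)..1, F' (t, w), ih hF's, fun w => ?_⟩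
    obtain ⟨M, hM⟩ := (isCompact_Icc (a := (0 : ℝ)) (b := 1)).prod
      (isCompact_closedBall w 1) |>.exists_bound_of_continuousOn hF's.continuous.continuousOn
    have hcF : ∀ x, Continuous fun t => F (t, x) := fun x =>
      hF.continuous.comp (continuous_id.prodMk continuous_const)
    have hcF' : ∀ x, Continuous fun t => F' (t, x) := fun x =>
      hF's.continuous.comp (continuous_id.prodMk continuous_const)
    refine intervalIntegral.hasFDerivAt_integral_of_dominated_of_fderiv_le
      (F := fun w t => F (t, w)) (F' := fun w t => F' (t, w)) (bound := fun _ => M)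
      (ball_mem_nhds w one_pos) (Filter.Eventually.of_forall fun x =>
        (hcF x).aestronglyMeasurable) ((hcF w).intervalIntegrable 0 1)
      ((hcF' w).aestronglyMeasurable) (Filter.Eventually.of_forall fun t ht x hx => ?_)
      (by simp) (Filter.Eventually.of_forall fun t _ x _ => hdiff t x)
    rw [Set.uIoc_of_le zero_le_one] at ht
    exact hM (t, x) ⟨⟨ht.1.le, ht.2⟩, ball_subset_closedBall hx⟩

theorem contDiff_top_parametric_integral {F : ℝ × E n → ℂ}
    (hF : ContDiff ℝ ((⊤ : ℕ∞) : WithTop ℕ∞) F) :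
    ContDiff ℝ ((⊤ : ℕ∞) : WithTop ℕ∞) fun w => ∫ t in (0 : ℝ)..1, F (t, w) :=
  contDiff_infty.2 fun m => contDiff_parametric_integral m hF

/-- Hadamard's lemma. -/
theorem exists_eq_add_sum_mul {f : E n → ℂ} (hf : ContDiff ℝ ((⊤ : ℕ∞) : WithTop ℕ∞) f) :
    ∃ h : Fin n → E n → ℂ, (∀ i, ContDiff ℝ ((⊤ : ℕ∞) : WithTop ℕ∞) (h i)) ∧
      ∀ w, f w = f 0 + ∑ i, (w i : ℂ) * h i w := by
  have hd : ContDiff ℝ ((⊤ : ℕ∞) : WithTop ℕ∞) (fderiv ℝ f) :=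
    hf.fderiv_right (m := ((⊤ : ℕ∞) : WithTop ℕ∞)) (by exact_mod_cast le_top)
  set F : Fin n → ℝ × E n → ℂ := fun i q =>
    fderiv ℝ f (q.1 • q.2) (EuclideanSpace.single i (1 : ℝ)) with hF
  have hFs : ∀ i, ContDiff ℝ ((⊤ : ℕ∞) : WithTop ℕ∞) (F i) := fun i =>
    (hd.comp (contDiff_fst.smul contDiff_snd)).clm_apply contDiff_const
  refine ⟨fun i w => ∫ t in (0 : ℝ)..1, F i (t, w), fun i =>
    contDiff_top_parametric_integral (hFs i), fun w => ?_⟩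
  have hFc : ∀ i, Continuous fun t => F i (t, w) := fun i =>
    (hFs i).continuous.comp (continuous_id.prodMk continuous_const)
  have h1 : ∀ t : ℝ, HasDerivAt (fun t : ℝ => f (t • w)) (∑ i, (w i : ℂ) * F i (t, w)) t := by
    intro t
    have h2 : HasFDerivAt f (fderiv ℝ f (t • w)) (t • w) :=
      (hf.differentiable (by simp)).differentiableAt.hasFDerivAt
    have h3 : HasDerivAt (fun t : ℝ => t • w) ((1 : ℝ) • w) t := (hasDerivAt_id t).smul_const w
    have h4 : HasDerivAt (fun t : ℝ => f (t • w)) (fderiv ℝ f (t • w) ((1 : ℝ) • w)) t :=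
      h2.comp_hasDerivAt t h3
    have h5 : fderiv ℝ f (t • w) ((1 : ℝ) • w) = ∑ i, (w i : ℂ) * F i (t, w) := by
      rw [one_smul]
      conv_lhs =>
        arg 2
        rw [← sum_smul_single w]
      rw [map_sum]
      refine Finset.sum_congr rfl fun i _ => ?_
      rw [map_smul, Complex.real_smul]
    rwa [h5] at h4
  have h5 := intervalIntegral.integral_eq_sub_of_hasDerivAt (a := 0) (b := 1)
    (fun t _ => h1 t) ((continuous_finsetSum _ fun i _ =>
      (continuous_const.mul (hFc i))).intervalIntegrable 0 1)
  rw [one_smul, zero_smul, intervalIntegral.integral_finsetSum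
    (f := fun i t => (w i : ℂ) * F i (t, w))
    (fun i _ => ((hFc i).intervalIntegrable 0 1).const_mul _)] at h5
  simp_rw [intervalIntegral.integral_const_mul] at h5
  rw [h5]
  ring

theorem monom_add_single (β : Fin n → ℕ) (i : Fin n) (x : E n) :
    monom (β + Pi.single i 1) x = monom β x * x i := by
  unfold monom
  simp_rw [Pi.add_apply, pow_add]
  rw [Finset.prod_mul_distrib]
  congr 1
  rw [Finset.prod_eq_single i]
  · simp
  · intro k _ hk
    simp [hk]
  · simp

/-- The multi-indices of order at most `s`. -/
def multiIndices (n s : ℕ) : Finset (Fin n → ℕ) :=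
  (Fintype.piFinset fun _ : Fin n => Finset.range (s + 1)).filter fun β => ∑ i, β i ≤ s

theorem mem_multiIndices {s : ℕ} {β : Fin n → ℕ} : β ∈ multiIndices n s ↔ ∑ i, β i ≤ s := by
  unfold multiIndices
  rw [Finset.mem_filter, Fintype.mem_piFinset]
  refine ⟨fun h => h.2, fun h => ⟨fun i => ?_, h⟩⟩
  rw [Finset.mem_range]
  have := Finset.single_le_sum (f := β) (fun k _ => Nat.zero_le _) (Finset.mem_univ i)
  omega

/-- Taylor's formula with a remainder that is a combination of monomials of order `s + 1` with
smooth coefficients. -/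
theorem exists_taylor_smooth {f : E n → ℂ} (hf : ContDiff ℝ ((⊤ : ℕ∞) : WithTop ℕ∞) f) (s : ℕ) :
    ∃ (t : (Fin n → ℕ) → ℂ) (ι : Type) (_ : Fintype ι) (b : ι → Fin n → ℕ) (h : ι → E n → ℂ),
      (∀ m, ∑ i, b m i = s + 1) ∧ (∀ m, ContDiff ℝ ((⊤ : ℕ∞) : WithTop ℕ∞) (h m)) ∧
      ∀ w, f w = ∑ β ∈ multiIndices n s, t β * (monom β w : ℂ) +
        ∑ m, (monom (b m) w : ℂ) * h m w := by
  induction s with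
  | zero =>
    obtain ⟨h, hh, hfh⟩ := exists_eq_add_sum_mul hf
    refine ⟨fun _ => f 0, Fin n, inferInstance, fun i => Pi.single i 1, h, fun m => by simp, hh,
      fun w => ?_⟩
    rw [hfh w, Finset.sum_eq_single (0 : Fin n → ℕ)]
    · congr 1
      · simp [monom]
      · refine Finset.sum_congr rfl fun i _ => ?_
        have := monom_add_single 0 i w
        rw [zero_add] at this
        rw [this]
        simp [monom]
    · intro β hβ hne
      refine absurd ?_ hne
      have := mem_multiIndices.1 hβ
      ext i
      have h2 := Finset.single_le_sum (f := β) (fun k _ => Nat.zero_le _) (Finset.mem_univ i)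
      simp only [Pi.zero_apply]
      omega
    · intro h0
      exact absurd (mem_multiIndices.2 (by simp)) h0
  | succ s ih =>
    obtain ⟨t, ι, _, b, h, hb, hh, hf⟩ := ih
    choose h' hh' hhh' using fun m => exists_eq_add_sum_mul (hh m)
    refine ⟨fun β => (if ∑ i, β i ≤ s then t β else 0) + ∑ m, if b m = β then h m 0 else 0,
      ι × Fin n, inferInstance, fun q => b q.1 + Pi.single q.2 1, fun q => h' q.1 q.2,
      fun q => ?_, fun q => hh' _ _, fun w => ?_⟩
    · simp_rw [Pi.add_apply]
      rw [Finset.sum_add_distrib, hb]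
      simp
    · rw [hf w]
      simp_rw [add_mul]
      rw [Finset.sum_add_distrib, add_assoc]
      congr 1
      · simp_rw [ite_mul, zero_mul]
        rw [← Finset.sum_filter]
        refine Finset.sum_congr ?_ fun _ _ => rfl
        ext β
        rw [Finset.mem_filter, mem_multiIndices, mem_multiIndices]
        omega
      · simp_rw [Finset.sum_mul, ite_mul, zero_mul]
        rw [Finset.sum_comm, Fintype.sum_prod_type, ← Finset.sum_add_distrib]
        refine Finset.sum_congr rfl fun m _ => ?_
        rw [Finset.sum_ite_eq, if_pos (mem_multiIndices.2 (hb m).le), hhh' m w, mul_add,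
          Finset.mul_sum, mul_comm (h m 0)]
        congr 1
        refine Finset.sum_congr rfl fun i _ => ?_
        rw [monom_add_single]
        push_cast
        ring

theorem exists_norm_iteratedFDeriv_le_of_contDiff {f : E n → ℂ}
    (hf : ContDiff ℝ ((⊤ : ℕ∞) : WithTop ℕ∞) f) (N : ℕ) :
    ∃ L : ℝ, 0 ≤ L ∧ ∀ j ≤ N, ∀ x, ‖x‖ ≤ 2 → ‖iteratedFDeriv ℝ j f x‖ ≤ L := by
  choose L hL using fun j : ℕ => (isCompact_closedBall (0 : E n) 2).exists_bound_of_continuousOn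
    (hf.continuous_iteratedFDeriv (m := j) (by exact_mod_cast le_top)).continuousOn
  have hL0 : ∀ j, 0 ≤ L j := fun j => (norm_nonneg _).trans (hL j 0 (by simp))
  refine ⟨∑ j ∈ Finset.range (N + 1), L j, Finset.sum_nonneg fun j _ => hL0 j,
    fun j hj x hx => ?_⟩
  exact (hL j x (by simpa using hx)).trans (Finset.single_le_sum (fun i _ => hL0 i)
      (Finset.mem_range.2 (Nat.lt_succ_of_le hj)))

theorem contDiff_monom (β : Fin n → ℕ) :
    ContDiff ℝ ((⊤ : ℕ∞) : WithTop ℕ∞) fun x : E n => (monom β x : ℂ) := by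
  refine Complex.ofRealCLM.contDiff.comp ?_
  have hf : ∀ i ∈ (Finset.univ : Finset (Fin n)), ContDiff ℝ ((⊤ : ℕ∞) : WithTop ℕ∞)
      fun w : E n => w i ^ β i := fun i _ =>
    (EuclideanSpace.proj i : E n →L[ℝ] ℝ).contDiff.pow _
  exact contDiff_prod hf

theorem monom_smul (β : Fin n → ℕ) (c : ℝ) (x : E n) :
    monom β (c • x) = c ^ (∑ i, β i) * monom β x := by
  unfold monom
  simp_rw [PiLp.smul_apply, smul_eq_mul, mul_pow]
  rw [Finset.prod_mul_distrib, Finset.prod_pow_eq_pow_sum]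

/-- The derivatives of order at most `N` of `f` on `closedBall 0 (2 * ρ)` are bounded as those of a
dilate by `ρ` of a fixed function, times `A`. -/
def ScaledBound (N : ℕ) (f : E n → ℂ) (ρ A : ℝ) : Prop :=
  ∀ j ≤ N, ∀ x, ‖x‖ ≤ 2 * ρ → ‖iteratedFDeriv ℝ j f x‖ ≤ A * ρ⁻¹ ^ j

/-- By homogeneity a monomial is `ρ ^ |β|` times its own dilate by `ρ`. -/
theorem exists_scaledBound_monom (β : Fin n → ℕ) (N : ℕ) :
    ∃ B : ℝ, 0 ≤ B ∧ ∀ ρ : ℝ, 0 < ρ →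
      ScaledBound N (fun x : E n => (monom β x : ℂ)) ρ (B * ρ ^ ∑ i, β i) := by
  obtain ⟨B, hB, h⟩ := exists_norm_iteratedFDeriv_le_of_contDiff (contDiff_monom β) N
  refine ⟨B, hB, fun ρ hρ j hj x hx => ?_⟩
  have h1 : (fun x : E n => (monom β x : ℂ)) = fun x =>
      (ρ ^ (∑ i, β i) : ℝ) • (fun x : E n => (monom β (ρ⁻¹ • x + 0) : ℂ)) x := by
    ext x
    beta_reduce
    rw [add_zero, monom_smul, Complex.real_smul, ← Complex.ofReal_mul, ← mul_assoc, ← mul_pow,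
      mul_inv_cancel₀ hρ.ne', one_pow, one_mul]
  have hc : ContDiff ℝ j fun x : E n => (monom β (ρ⁻¹ • x + 0) : ℂ) :=
    ((contDiff_monom β).of_le (by exact_mod_cast le_top)).comp
      ((contDiff_id.const_smul _).add contDiff_const)
  rw [h1, iteratedFDeriv_const_smul_apply' hc.contDiffAt, norm_smul,
    Real.norm_of_nonneg (by positivity)]
  have h2 := norm_iteratedFDeriv_comp_affine_le (j := j)
    ((contDiff_monom β).of_le (by exact_mod_cast le_top)) ρ⁻¹ 0 x
  rw [abs_of_pos (by positivity)] at h2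
  have h3 := h j hj (ρ⁻¹ • x + 0) (by
    rw [add_zero, norm_smul, norm_inv, Real.norm_of_nonneg hρ.le, inv_mul_le_iff₀ hρ]
    linarith)
  calc _ ≤ ρ ^ (∑ i, β i) * (ρ⁻¹ ^ j * B) := by
        gcongr
        exact h2.trans (by gcongr)
    _ = _ := by ring

theorem ScaledBound.mul {N : ℕ} {f h : E n → ℂ} {ρ A B : ℝ}
    (hf : ScaledBound N f ρ A) (hh : ScaledBound N h ρ B) (hfc : ContDiff ℝ N f)
    (hhc : ContDiff ℝ N h) (hρ : 0 ≤ ρ) (hA : 0 ≤ A) (hB : 0 ≤ B) :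
    ScaledBound N (fun x => f x * h x) ρ (2 ^ N * (A * B)) := by
  intro j hj x hx
  refine (norm_iteratedFDeriv_mul_le_of_le (hfc.of_le (by exact_mod_cast hj))
    (hhc.of_le (by exact_mod_cast hj)) hA (by positivity)
    (fun i hi => hf i (hi.trans hj) x hx) (fun i hi => hh i (hi.trans hj) x hx)).trans ?_
  gcongr
  norm_num

theorem ScaledBound.sum {N : ℕ} {ι : Type*} {s : Finset ι} {f : ι → E n → ℂ} {ρ : ℝ} {A : ι → ℝ}
    (hf : ∀ i ∈ s, ScaledBound N (f i) ρ (A i)) (hc : ∀ i ∈ s, ContDiff ℝ N (f i)) :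
    ScaledBound N (fun x => ∑ i ∈ s, f i x) ρ (∑ i ∈ s, A i) := by
  intro j hj x hx
  rw [iteratedFDeriv_fun_sum_apply fun i hi => ((hc i hi).of_le (by exact_mod_cast hj)).contDiffAt,
    Finset.sum_mul]
  exact norm_sum_le_of_le _ fun i hi => hf i hi j hj x hx

theorem ScaledBound.of_contDiff {f : E n → ℂ} (hf : ContDiff ℝ ((⊤ : ℕ∞) : WithTop ℕ∞) f)
    (N : ℕ) : ∃ L : ℝ, 0 ≤ L ∧ ∀ ρ : ℝ, 0 < ρ → ρ ≤ 1 → ScaledBound N f ρ L := by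
  obtain ⟨L, hL, h⟩ := exists_norm_iteratedFDeriv_le_of_contDiff hf N
  refine ⟨L, hL, fun ρ hρ hρ1 j hj x hx => (h j hj x (by linarith)).trans ?_⟩
  exact le_mul_of_one_le_right hL (one_le_pow₀ ((one_le_inv₀ hρ).2 hρ1))

/-- The gain `ρ ^ (s + 1)` is needed for all derivatives up to order `N`, not merely for the
supremum, because a distribution will be applied to the remainder. Writing the remainder as
monomials of order `s + 1` times smooth functions provides it. -/
theorem exists_taylor_scaledBound {f : E n → ℂ} (hf : ContDiff ℝ ((⊤ : ℕ∞) : WithTop ℕ∞) f)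
    (s N : ℕ) :
    ∃ (t : (Fin n → ℕ) → ℂ) (C : ℝ), 0 ≤ C ∧ ∀ ρ : ℝ, 0 < ρ → ρ ≤ 1 →
      ScaledBound N (fun w => f w - ∑ β ∈ multiIndices n s, t β * (monom β w : ℂ)) ρ
        (C * ρ ^ (s + 1)) := by
  obtain ⟨t, ι, _, b, h, hb, hh, hf⟩ := exists_taylor_smooth hf s
  choose L hL hLh using fun m => ScaledBound.of_contDiff (hh m) N
  choose B hB hBb using fun m => exists_scaledBound_monom (b m) N
  refine ⟨t, ∑ m, 2 ^ N * (B m * L m), Finset.sum_nonneg fun m _ => by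
    have := hB m; have := hL m; positivity, fun ρ hρ hρ1 => ?_⟩
  have h1 : (fun w => f w - ∑ β ∈ multiIndices n s, t β * (monom β w : ℂ)) =
      fun w => ∑ m, (monom (b m) w : ℂ) * h m w := by
    ext w
    rw [hf w]
    ring
  rw [h1, Finset.sum_mul]
  have hcN : ((N : ℕ) : WithTop ℕ∞) ≤ ((⊤ : ℕ∞) : WithTop ℕ∞) := by exact_mod_cast le_top
  refine ScaledBound.sum (fun m _ => ?_) fun m _ =>
    ((contDiff_monom (b m)).of_le hcN).mul ((hh m).of_le hcN)
  have h2 := (hBb m ρ hρ).mul (hLh m ρ hρ hρ1) ((contDiff_monom (b m)).of_le hcN)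
    ((hh m).of_le hcN) hρ.le (by have := hB m; positivity) (hL m)
  rw [hb m] at h2
  convert h2 using 1
  ring

end Taylor

/-! ### Bump functions dual to the monomials. -/

section DualBumps

variable {n : ℕ}

/-- A smooth bump function equal to `1` on `closedBall 0 1` and supported in `closedBall 0 2`. -/
noncomputable def baseBump (n : ℕ) : ContDiffBump (0 : E n) :=
  { rIn := 1, rOut := 2, rIn_pos := one_pos, rIn_lt_rOut := one_lt_two }

/-- A smooth bump function supported in `closedBall 0 1`. -/
noncomputable def unitBump (n : ℕ) : ContDiffBump (0 : E n) :=
  { rIn := 1 / 2, rOut := 1, rIn_pos := by norm_num, rIn_lt_rOut := by norm_num }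

/-- The ball contains a product of infinite sets, namely intervals of length `r / (n + 1)`, on which
a polynomial can vanish only if it is zero. -/
theorem eq_zero_of_sum_monom_eq_zero (s : ℕ) (c : (Fin n → ℕ) → ℝ) {r : ℝ} (hr : 0 < r)
    (h : ∀ x ∈ ball (0 : E n) r, ∑ β ∈ multiIndices n s, c β * monom β x = 0) :
    ∀ β ∈ multiIndices n s, c β = 0 := by
  set P : MvPolynomial (Fin n) ℝ := ∑ β ∈ multiIndices n s,
    MvPolynomial.monomial (Finsupp.equivFunOnFinite.symm β) (c β) with hP
  have heval : ∀ x : E n, MvPolynomial.eval (fun i => x i) P =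
      ∑ β ∈ multiIndices n s, c β * monom β x := by
    intro x
    rw [hP, map_sum]
    refine Finset.sum_congr rfl fun β _ => ?_
    rw [MvPolynomial.eval_monomial]
    congr 1
    rw [Finsupp.prod_fintype _ _ (by simp)]
    rfl
  have hP0 : P = 0 := by
    refine MvPolynomial.funext_set (fun _ => Set.Ioo 0 (r / (n + 1)))
      (fun i => Set.Ioo_infinite (by positivity)) fun x hx => ?_
    have h1 := heval (WithLp.toLp 2 x)
    simp only at h1
    rw [map_zero, h1]
    apply h
    rw [mem_ball_zero_iff]
    refine (norm_le_sum_abs _).trans_lt ?_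
    calc ∑ i, |x i| ≤ ∑ _i : Fin n, r / (n + 1) := by
          refine Finset.sum_le_sum fun i _ => ?_
          have := hx i (Set.mem_univ i)
          rw [abs_of_pos this.1]
          exact this.2.le
      _ = n * (r / (n + 1)) := by simp
      _ < r := by
          rw [mul_div_assoc', div_lt_iff₀ (by positivity)]
          nlinarith
  intro β hβ
  have h2 : MvPolynomial.coeff (Finsupp.equivFunOnFinite.symm β) P = c β := by
    rw [hP, MvPolynomial.coeff_sum, Finset.sum_eq_single β]
    · rw [MvPolynomial.coeff_monomial, if_pos rfl]
    · intro γ _ hne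
      rw [MvPolynomial.coeff_monomial, if_neg]
      exact fun h => hne (Finsupp.equivFunOnFinite.symm.injective h)
    · exact fun h => absurd hβ h
  rw [← h2, hP0, MvPolynomial.coeff_zero]

/-- The Gram matrix of the monomials with a bump `ρ` as weight is invertible: a kernel vector gives
a polynomial `q` with `∫ ρ q² = 0`, hence `q = 0` on the unit ball. The inverse matrix applied to
the functions `ρ x^γ` gives the dual system. -/
theorem exists_dual_bumps (n s : ℕ) :
    ∃ η : (Fin n → ℕ) → E n → ℝ, (∀ β, Continuous (η β)) ∧ (∀ β x, 1 < ‖x‖ → η β x = 0) ∧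
      ∀ β ∈ multiIndices n s, ∀ γ ∈ multiIndices n s,
        ∫ x, η β x * monom γ x = if β = γ then 1 else 0 := by
  set ρ := unitBump n with hρ
  have hρc : Continuous ρ := ρ.continuous
  have hρs : ∀ x : E n, 1 < ‖x‖ → ρ x = 0 := fun x hx =>
    ρ.zero_of_le_dist (by rw [dist_zero_right]; exact hx.le)
  have hfi : ∀ f : E n → ℝ, Continuous f → Integrable fun x => ρ x * f x := fun f hf =>
    (hρc.mul hf).integrable_of_hasCompactSupport ρ.hasCompactSupport.mul_right
  have hfi₂ : ∀ f h : E n → ℝ, Continuous f → Continuous h →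
      Integrable fun x => ρ x * (f x * h x) := fun f h hf hh => hfi _ (hf.mul hh)
  set M : Matrix (multiIndices n s) (multiIndices n s) ℝ := Matrix.of fun β γ =>
    ∫ x, ρ x * (monom β.1 x * monom γ.1 x) with hM
  have hM_apply : ∀ β γ, M β γ = ∫ x, ρ x * (monom β.1 x * monom γ.1 x) := fun _ _ => rfl
  have hMunit : IsUnit M := by
    rw [← Matrix.mulVec_injective_iff_isUnit]
    have hker : ∀ v, M.mulVec v = 0 → v = 0 := by
      intro v hv
      set c : (Fin n → ℕ) → ℝ := fun β => if h : β ∈ multiIndices n s then v ⟨β, h⟩ else 0 with hc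
      set q : E n → ℝ := fun x => ∑ β : multiIndices n s, v β * monom β.1 x with hq
      have hqc : Continuous q := continuous_finsetSum _ fun β _ =>
        continuous_const.mul (continuous_monom _)
      have h1 : ∫ x, ρ x * (q x * q x) = 0 := by
        have h2 : ∀ β : multiIndices n s, ∫ x, ρ x * (monom β.1 x * q x) = 0 := by
          intro β
          have h3 := congrFun hv β
          rw [Pi.zero_apply] at h3
          rw [← h3]
          have h0 : M.mulVec v β = ∑ γ, M β γ * v γ := rfl
          rw [h0]
          have h4 : (fun x => ρ x * (monom β.1 x * q x)) = fun x =>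
              ∑ γ : multiIndices n s, ρ x * (monom β.1 x * monom γ.1 x) * v γ := by
            ext x
            rw [hq, Finset.mul_sum, Finset.mul_sum]
            exact Finset.sum_congr rfl fun γ _ => by ring
          rw [h4, integral_finsetSum _ fun γ _ => (hfi₂ _ _
            (continuous_monom _) (continuous_monom _)).mul_const _]
          exact Finset.sum_congr rfl fun γ _ => by rw [integral_mul_const, hM_apply]
        have h5 : (fun x => ρ x * (q x * q x)) = fun x =>
            ∑ β : multiIndices n s, v β * (ρ x * (monom β.1 x * q x)) := by
          ext x
          conv_lhs => rw [hq]
          beta_reduce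
          rw [Finset.sum_mul, Finset.mul_sum]
          exact Finset.sum_congr rfl fun γ _ => by ring
        rw [h5, integral_finsetSum _ fun β _ => (hfi₂ _ _
          (continuous_monom _) hqc).const_mul _]
        refine Finset.sum_eq_zero fun β _ => ?_
        rw [integral_const_mul, h2, mul_zero]
      have h6 : (fun x => ρ x * (q x * q x)) = 0 := by
        rw [integral_eq_zero_iff_of_nonneg
          (fun x => mul_nonneg ρ.nonneg (mul_self_nonneg _)) (hfi₂ _ _ hqc hqc)] at h1
        exact (Continuous.ae_eq_iff_eq volume (hρc.mul (hqc.mul hqc)) continuous_const).1 h1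
      have h7 := eq_zero_of_sum_monom_eq_zero s c one_pos fun x hx => by
        have h8 : ρ x * (q x * q x) = 0 := congrFun h6 x
        have h9 : 0 < ρ x := ρ.pos_of_mem_ball hx
        have h10 : q x = 0 := mul_self_eq_zero.1 ((mul_eq_zero.1 h8).resolve_left h9.ne')
        rw [← h10, hq, ← Finset.sum_coe_sort]
        refine Finset.sum_congr rfl fun β _ => ?_
        rw [hc]
        simp
      ext β
      have := h7 β.1 β.2
      rw [hc] at this
      simpa using this
    intro v w hvw
    rw [← sub_eq_zero]
    apply hker
    rw [Matrix.mulVec_sub, sub_eq_zero]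
    exact hvw
  set η : (Fin n → ℕ) → E n → ℝ := fun β x => if h : β ∈ multiIndices n s then
    ∑ γ : multiIndices n s, M⁻¹ ⟨β, h⟩ γ * (ρ x * monom γ.1 x) else 0 with hη
  refine ⟨η, fun β => ?_, fun β x hx => ?_, fun β hβ γ hγ => ?_⟩
  · by_cases h : β ∈ multiIndices n s
    · simp only [hη, dif_pos h]
      exact continuous_finsetSum _ fun γ _ => continuous_const.mul (hρc.mul (continuous_monom _))
    · simp only [hη, dif_neg h]
      exact continuous_const
  · by_cases h : β ∈ multiIndices n s
    · simp only [hη, dif_pos h, hρs x hx, zero_mul, mul_zero, Finset.sum_const_zero]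
    · simp only [hη, dif_neg h]
  · have h1 : (fun x => η β x * monom γ x) = fun x => ∑ δ : multiIndices n s,
        M⁻¹ ⟨β, hβ⟩ δ * (ρ x * (monom δ.1 x * monom γ x)) := by
      ext x
      simp only [hη, dif_pos hβ]
      rw [Finset.sum_mul]
      exact Finset.sum_congr rfl fun δ _ => by ring
    rw [h1, integral_finsetSum _ fun δ _ => (hfi₂ _ _
      (continuous_monom _) (continuous_monom _)).const_mul _]
    simp_rw [integral_const_mul]
    have h2 : (M⁻¹ * M) ⟨β, hβ⟩ ⟨γ, hγ⟩ = if β = γ then 1 else 0 := by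
      rw [Matrix.nonsing_inv_mul _ ((Matrix.isUnit_iff_isUnit_det M).1 hMunit), Matrix.one_apply]
      simp
    rw [← h2, Matrix.mul_apply]
    exact Finset.sum_congr rfl fun δ _ => by rw [hM_apply]

end DualBumps

/-! ### Cutoffs at dyadic scales and telescoping sums over the integers. -/

section Cutoff

variable {n N : ℕ}

/-- The smooth cutoff function, equal to `1` on `closedBall 0 (2 ^ k)` and supported in
`closedBall 0 (2 * 2 ^ k)`. -/
noncomputable def cutFn (n : ℕ) (k : ℤ) (x : E n) : ℂ := (baseBump n (((2 : ℝ) ^ k)⁻¹ • x) : ℂ)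

theorem two_zpow_pos (k : ℤ) : (0 : ℝ) < 2 ^ k := zpow_pos two_pos k

theorem contDiff_baseBump :
    ContDiff ℝ ((⊤ : ℕ∞) : WithTop ℕ∞) fun x : E n => (baseBump n x : ℂ) :=
  Complex.ofRealCLM.contDiff.comp (baseBump n).contDiff

theorem contDiff_cutFn (k : ℤ) : ContDiff ℝ ((⊤ : ℕ∞) : WithTop ℕ∞) (cutFn n k) :=
  contDiff_baseBump.comp (contDiff_id.const_smul _)

theorem norm_inv_smul (k : ℤ) (x : E n) : ‖((2 : ℝ) ^ k)⁻¹ • x‖ = ‖x‖ / 2 ^ k := by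
  rw [norm_smul, norm_inv, Real.norm_of_nonneg (two_zpow_pos k).le]
  ring

theorem cutFn_eq_one {k : ℤ} {x : E n} (hx : ‖x‖ ≤ 2 ^ k) : cutFn n k x = 1 := by
  unfold cutFn
  rw [ContDiffBump.one_of_mem_closedBall, Complex.ofReal_one]
  rw [mem_closedBall_zero_iff, norm_inv_smul]
  exact (div_le_one (two_zpow_pos k)).2 hx

theorem cutFn_eq_zero {k : ℤ} {x : E n} (hx : 2 * 2 ^ k ≤ ‖x‖) : cutFn n k x = 0 := by
  unfold cutFn
  rw [ContDiffBump.zero_of_le_dist, Complex.ofReal_zero]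
  rw [dist_zero_right, norm_inv_smul]
  exact (le_div_iff₀ (two_zpow_pos k)).2 hx

theorem cutFn_nonneg_le_one (k : ℤ) (x : E n) :
    ∃ r : ℝ, cutFn n k x = r ∧ 0 ≤ r ∧ r ≤ 1 :=
  ⟨_, rfl, (baseBump n).nonneg, (baseBump n).le_one⟩

theorem hasCompactSupport_cutFn_mul (k : ℤ) (h : E n → ℂ) :
    HasCompactSupport fun x => cutFn n k x * h x := by
  refine HasCompactSupport.of_support_subset_isCompact
    (isCompact_closedBall (0 : E n) (2 * 2 ^ k)) fun x hx => ?_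
  rw [mem_closedBall_zero_iff]
  by_contra hlt
  apply hx
  change cutFn n k x * h x = 0
  rw [cutFn_eq_zero (not_le.1 hlt).le, zero_mul]

/-- The product of the cutoff function and a smooth function, as a Schwartz function. -/
noncomputable def cut (k : ℤ) (h : E n → ℂ) (hh : ContDiff ℝ ((⊤ : ℕ∞) : WithTop ℕ∞) h) :
    𝓢(E n, ℂ) :=
  (hasCompactSupport_cutFn_mul k h).toSchwartzMap ((contDiff_cutFn k).mul hh)

theorem cut_apply (k : ℤ) (h : E n → ℂ) (hh : ContDiff ℝ ((⊤ : ℕ∞) : WithTop ℕ∞) h) (x : E n) :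
    cut k h hh x = cutFn n k x * h x := rfl

theorem exists_norm_iteratedFDeriv_cutFn_le (n N : ℕ) :
    ∃ B : ℝ, 0 < B ∧ ∀ k : ℤ, ∀ j ≤ N, ∀ x,
      ‖iteratedFDeriv ℝ j (cutFn n k) x‖ ≤ B * ((2 : ℝ) ^ k)⁻¹ ^ j := by
  have hc : HasCompactSupport fun x : E n => (baseBump n x : ℂ) :=
    (baseBump n).hasCompactSupport.comp_left Complex.ofReal_zero
  obtain ⟨B, hB, h⟩ := exists_norm_iteratedFDeriv_le (hc.toSchwartzMap contDiff_baseBump) N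
  refine ⟨B, hB, fun k j hj x => ?_⟩
  have h1 : cutFn n k = fun x => (hc.toSchwartzMap contDiff_baseBump)
      (((2 : ℝ) ^ k)⁻¹ • x + 0) := by
    ext x
    rw [add_zero]
    rfl
  rw [h1]
  refine (norm_iteratedFDeriv_comp_affine_le
    ((hc.toSchwartzMap contDiff_baseBump).smooth j) _ 0 x).trans ?_
  rw [abs_of_pos (inv_pos.2 (two_zpow_pos k)), mul_comm]
  have := two_zpow_pos k
  gcongr
  exact h j hj _

/-- A function cut off at scale `2 ^ k` is a bump centred at `0`, and `0` lies in the cone of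
aperture `2 ^ k` over every `x` in `B_k`. -/
theorem exists_enorm_apply_cut_le (n N : ℕ) :
    ∃ C : ℝ, 0 < C ∧ ∀ (g : 𝓢'(E n, ℂ)) (k : ℤ) (h : E n → ℂ)
      (hh : ContDiff ℝ ((⊤ : ℕ∞) : WithTop ℕ∞) h) (A : ℝ), 0 < A →
      ScaledBound N h ((2 : ℝ) ^ k) A → ∀ x ∈ ball (0 : E n) (2 ^ k),
        ‖g (cut k h hh)‖ₑ ≤ ENNReal.ofReal (C * A * ((2 : ℝ) ^ k) ^ n) * grandMaximal N g x := by
  obtain ⟨B, hB, hcut⟩ := exists_norm_iteratedFDeriv_cutFn_le n N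
  refine ⟨2 ^ N * B * 2 ^ N, by positivity, fun g k h hh A hA hbd x hx => ?_⟩
  have hk := two_zpow_pos k
  have hcN : ((N : ℕ) : WithTop ℕ∞) ≤ ((⊤ : ℕ∞) : WithTop ℕ∞) := by exact_mod_cast le_top
  have hsupp : ∀ z : E n, 2 * 2 ^ k < ‖z - 0‖ → cut k h hh z = 0 := by
    intro z hz
    rw [sub_zero] at hz
    rw [cut_apply, cutFn_eq_zero hz.le, zero_mul]
  have hder : ∀ j ≤ N, ∀ z, ‖iteratedFDeriv ℝ j (cut k h hh) z‖ ≤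
      2 ^ N * (B * A) * (((2 : ℝ) ^ k) ^ j)⁻¹ := by
    intro j hj z
    rcases le_or_gt ‖z‖ (2 * 2 ^ k) with hz | hz
    · have h1 : ScaledBound N (cutFn n k) ((2 : ℝ) ^ k) B := fun j hj x _ => hcut k j hj x
      have h2 := (h1.mul hbd ((contDiff_cutFn k).of_le hcN) (hh.of_le hcN) hk.le hB.le hA.le)
        j hj z hz
      rw [← inv_pow]
      exact h2
    · rw [iteratedFDeriv_eq_zero_of_lt hsupp j (by rwa [sub_zero]), norm_zero]
      positivity
  have := enorm_apply_le_of_bump (N := N) g (cut k h hh) one_le_two hk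
    (A := 2 ^ N * (B * A)) (by positivity) (x := x) (y := 0)
    (by rw [zero_sub, norm_neg]; simpa using hx) hsupp hder
  refine this.trans_eq ?_
  congr 2
  ring

theorem exists_norm_apply_le_sum_seminorm (g : 𝓢'(E n, ℂ)) :
    ∃ (S : Finset (ℕ × ℕ)) (C : ℝ), 0 ≤ C ∧
      ∀ φ, ‖g φ‖ ≤ C * ∑ i ∈ S, SchwartzMap.seminorm ℂ i.1 i.2 φ := by
  set L : 𝓢(E n, ℂ) →ₗ[ℂ] ℂ :=
    { toFun := fun φ => g φ
      map_add' := fun φ ψ => map_add g φ ψ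
      map_smul' := fun c φ => map_smul g c φ } with hL
  have hc : Continuous ((normSeminorm ℂ ℂ).comp L) := by
    have : Continuous fun φ => g φ := g.continuous
    exact this.norm
  obtain ⟨S, C, -, h⟩ := Seminorm.bound_of_continuous (schwartz_withSeminorms ℂ (E n) ℂ) _ hc
  refine ⟨S, C, C.2, fun φ => ?_⟩
  have h1 := h φ
  refine h1.trans ?_
  rw [smul_apply, NNReal.smul_def, smul_eq_mul]
  refine mul_le_mul_of_nonneg_left ?_ C.2
  have h2 := Seminorm.finset_sup_le_sum (schwartzSeminormFamily ℂ (E n) ℂ) S φ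
  refine h2.trans_eq ?_
  rw [sum_apply]
  rfl

/-- The difference vanishes inside `B_k`; outside, one spare power of `‖x‖` in the decay of `φ` is
worth a factor `2 ^ (-k)`. -/
theorem exists_seminorm_sub_cut_le (φ : 𝓢(E n, ℂ)) (a b : ℕ) :
    ∃ C : ℝ, 0 ≤ C ∧ ∀ k : ℤ, 0 ≤ k →
      SchwartzMap.seminorm ℂ a b (φ - cut k φ φ.smooth') ≤ C * ((2 : ℝ) ^ k)⁻¹ := by
  obtain ⟨B, hB, hcut⟩ := exists_norm_iteratedFDeriv_cutFn_le n b
  choose L hL using fun j => φ.decay (a + 1) j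
  set M := ∑ j ∈ Finset.range (b + 1), L j with hM
  have hM0 : 0 ≤ M := Finset.sum_nonneg fun j _ => (hL j).1.le
  have hMb : ∀ j ≤ b, ∀ x, ‖x‖ ^ (a + 1) * ‖iteratedFDeriv ℝ j φ x‖ ≤ M := fun j hj x =>
    ((hL j).2 x).trans (Finset.single_le_sum (f := L) (fun i _ => (hL i).1.le)
      (Finset.mem_range.2 (Nat.lt_succ_of_le hj)))
  refine ⟨(1 + 2 ^ b * B) * M, by positivity, fun k hk => ?_⟩
  have hk0 := two_zpow_pos k
  have hk1 : (1 : ℝ) ≤ 2 ^ k := one_le_zpow₀ one_le_two hk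
  refine SchwartzMap.seminorm_le_bound ℂ a b _ (by positivity) fun x => ?_
  rcases lt_or_ge ‖x‖ (2 ^ k) with hx | hx
  · have h1 : ((φ - cut k φ φ.smooth' : 𝓢(E n, ℂ)) : E n → ℂ) =ᶠ[nhds x] (fun _ => (0 : ℂ)) := by
      filter_upwards [isOpen_ball.mem_nhds (mem_ball_zero_iff.2 hx)] with y hy
      rw [sub_apply, cut_apply, cutFn_eq_one (mem_ball_zero_iff.1 hy).le, one_mul,
        sub_self]
    rw [(h1.iteratedFDeriv ℝ b).eq_of_nhds]
    rw [iteratedFDeriv_fun_zero]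
    simp only [Pi.zero_apply, norm_zero, mul_zero]
    positivity
  · have hx0 : 0 < ‖x‖ := hk0.trans_le hx
    have hφ : ∀ j ≤ b, ‖iteratedFDeriv ℝ j φ x‖ ≤ M / ‖x‖ ^ (a + 1) := fun j hj => by
      rw [le_div_iff₀' (by positivity)]
      exact hMb j hj x
    have h1 : iteratedFDeriv ℝ b (φ - cut k φ φ.smooth' : 𝓢(E n, ℂ)) x =
        iteratedFDeriv ℝ b φ x - iteratedFDeriv ℝ b (cut k φ φ.smooth') x :=
      iteratedFDeriv_sub_apply (φ.smooth b).contDiffAt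
        ((cut k φ φ.smooth').smooth b).contDiffAt
    have h2 : ‖iteratedFDeriv ℝ b (cut k φ φ.smooth') x‖ ≤
        2 ^ b * (B * (M / ‖x‖ ^ (a + 1))) * 1 ^ b := by
      have hcb : ((b : ℕ) : WithTop ℕ∞) ≤ ((⊤ : ℕ∞) : WithTop ℕ∞) := by exact_mod_cast le_top
      refine norm_iteratedFDeriv_mul_le_of_le ((contDiff_cutFn k).of_le hcb) (φ.smooth b) hB.le
        zero_le_one (fun i hi => (hcut k i hi x).trans ?_)
        fun i hi => by rw [one_pow, mul_one]; exact hφ i hi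
      gcongr
      exact inv_le_one_of_one_le₀ hk1
    rw [h1]
    calc ‖x‖ ^ a * ‖iteratedFDeriv ℝ b φ x - iteratedFDeriv ℝ b (cut k φ φ.smooth') x‖
        ≤ ‖x‖ ^ a * (M / ‖x‖ ^ (a + 1) + 2 ^ b * (B * (M / ‖x‖ ^ (a + 1))) * 1 ^ b) := by
          gcongr
          exact (norm_sub_le _ _).trans (add_le_add (hφ b le_rfl) h2)
      _ = (1 + 2 ^ b * B) * M * ‖x‖⁻¹ := by
          rw [one_pow, pow_succ]
          field_simp
      _ ≤ _ := by gcongr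

theorem exists_norm_sub_cut_le (g : 𝓢'(E n, ℂ)) (φ : 𝓢(E n, ℂ)) :
    ∃ C : ℝ, 0 ≤ C ∧ ∀ k : ℤ, 0 ≤ k →
      ‖g φ - g (cut k φ φ.smooth')‖ ≤ C * ((2 : ℝ) ^ k)⁻¹ := by
  obtain ⟨S, C, hC, h⟩ := exists_norm_apply_le_sum_seminorm g
  choose D hD hDb using fun i : ℕ × ℕ => exists_seminorm_sub_cut_le φ i.1 i.2
  refine ⟨C * ∑ i ∈ S, D i, mul_nonneg hC (Finset.sum_nonneg fun i _ => hD i), fun k hk => ?_⟩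
  rw [← map_sub, mul_assoc, Finset.sum_mul]
  exact (h _).trans (mul_le_mul_of_nonneg_left (Finset.sum_le_sum fun i _ => hDb i k hk) hC)

/-- The geometric rates at both ends make the telescoping series absolutely convergent, so it sums
unconditionally over `ℤ` and not only along symmetric partial sums. -/
theorem hasSum_sub_of_geometric {D : ℤ → ℂ} {L : ℂ} {C r : ℝ} (hr0 : 0 ≤ r) (hr : r < 1)
    (hpos : ∀ k : ℕ, ‖L - D k‖ ≤ C * r ^ k) (hneg : ∀ k : ℕ, ‖D (-k)‖ ≤ C * r ^ k) :
    HasSum (fun k => D k - D (k - 1)) L := by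
  have hsum : Summable fun k : ℕ => C * r ^ k := (summable_geometric_of_lt_one hr0 hr).mul_left C
  have hlim : Filter.Tendsto (fun k : ℕ => C * r ^ k) Filter.atTop (nhds 0) := by
    have := (tendsto_pow_atTop_nhds_zero_of_lt_one hr0 hr).const_mul C
    rwa [mul_zero] at this
  have hC : 0 ≤ C := by simpa using (norm_nonneg _).trans (hpos 0)
  have h1 : HasSum (fun k : ℕ => D (k + 1) - D k) (L - D 0) := by
    have hs : Summable fun k : ℕ => D (k + 1) - D k := by
      refine Summable.of_norm_bounded (g := fun k : ℕ => C * r ^ k + C * r ^ k) (hsum.add hsum)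
        fun k => ?_
      have h2 : D (k + 1) - D k = (L - D k) - (L - D ((k + 1 : ℕ) : ℤ)) := by push_cast; ring
      rw [h2]
      refine (norm_sub_le _ _).trans (add_le_add (hpos k) ((hpos _).trans ?_))
      exact mul_le_mul_of_nonneg_left (pow_le_pow_of_le_one hr0 hr.le (Nat.le_succ k)) hC
    rw [hs.hasSum_iff_tendsto_nat]
    have h3 : ∀ m : ℕ, ∑ k ∈ Finset.range m, (D (k + 1) - D k) = D m - D 0 := by
      intro m
      have := Finset.sum_range_sub (fun k : ℕ => D k) m
      push_cast at this
      exact this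
    simp_rw [h3]
    refine Filter.Tendsto.sub_const ?_ _
    rw [tendsto_iff_norm_sub_tendsto_zero]
    refine squeeze_zero (fun _ => norm_nonneg _) (fun k => ?_) hlim
    rw [norm_sub_rev]
    exact hpos k
  have h2 : HasSum (fun k : ℕ => D (-k) - D (-k - 1)) (D 0) := by
    have hs : Summable fun k : ℕ => D (-k) - D (-k - 1) := by
      refine Summable.of_norm_bounded (g := fun k : ℕ => C * r ^ k + C * r ^ k) (hsum.add hsum)
        fun k => ?_
      have h2 : (-k - 1 : ℤ) = -((k + 1 : ℕ) : ℤ) := by push_cast; ring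
      rw [h2]
      refine (norm_sub_le _ _).trans (add_le_add (hneg k) ((hneg _).trans ?_))
      exact mul_le_mul_of_nonneg_left (pow_le_pow_of_le_one hr0 hr.le (Nat.le_succ k)) hC
    rw [hs.hasSum_iff_tendsto_nat]
    have h3 : ∀ m : ℕ, ∑ k ∈ Finset.range m, (D (-k) - D (-k - 1)) = D 0 - D (-m) := by
      intro m
      have := Finset.sum_range_sub' (fun k : ℕ => D (-k)) m
      push_cast at this
      simp only [neg_zero] at this
      rw [← this]
      refine Finset.sum_congr rfl fun k _ => ?_
      congr 2
      ring
    simp_rw [h3]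
    have h4 : Filter.Tendsto (fun m : ℕ => D (-m)) Filter.atTop (nhds 0) :=
      squeeze_zero_norm hneg hlim
    simpa using h4.const_sub (D 0)
  have h4 : HasSum (fun k : ℤ => D (k + 1) - D k) L := by
    have h5 := HasSum.of_nat_of_neg_add_one (f := fun k : ℤ => D (k + 1) - D k) h1
      (m' := D 0) (by
        convert h2 using 2 with k
        congr 2 <;> ring)
    rwa [sub_add_cancel] at h5
  have h6 := (Equiv.subRight (1 : ℤ)).hasSum_iff.2 h4
  convert h6 using 2 with k
  simp

end Cutoff

/-! ### Minimum and norm of the grand maximal function over an annulus. -/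

section Annuli

variable {n N s : ℕ} {p : E n → ℝ}

/-- The infimum of the grand maximal function over an annulus. -/
noncomputable def annMin (N : ℕ) (g : 𝓢'(E n, ℂ)) (k : ℤ) : ℝ≥0∞ :=
  ⨅ x ∈ annulus n k, grandMaximal N g x

/-- The norm of the grand maximal function over an annulus. -/
noncomputable def annNorm (p : E n → ℝ) (N : ℕ) (g : 𝓢'(E n, ℂ)) (k : ℤ) : ℝ≥0∞ :=
  luxNorm p fun x => grandMaximal N g x * chi (annulus n k) x

theorem volume_annulus_ne_top (k : ℤ) : volume (annulus n k) ≠ ∞ :=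
  ((measure_mono (annulus_subset k)).trans_lt measure_ball_lt_top).ne

theorem setLIntegral_annulus_le (hp : ClassP p) {g : 𝓢'(E n, ℂ)} {k : ℤ}
    (h : annNorm p N g k ≠ ∞) :
    ∫⁻ x in annulus n k, grandMaximal N g x ≤
      2 * annNorm p N g k * luxNorm (conjExp p) (chi (annulus n k)) := by
  have h1 := setLIntegral_le_luxNorm_mul hp (measurableSet_annulus k) (volume_annulus_ne_top k)
    (fun x => grandMaximal N g x * chi (annulus n k) x) h
  refine le_trans (le_of_eq ?_) h1
  refine setLIntegral_congr_fun (measurableSet_annulus k) fun x hx => ?_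
  rw [chi_of_mem hx, mul_one]

theorem setLIntegral_annulus_ne_top (hp : ClassP p) {g : 𝓢'(E n, ℂ)} {k : ℤ}
    (h : annNorm p N g k ≠ ∞) : ∫⁻ x in annulus n k, grandMaximal N g x ≠ ∞ := by
  refine ((setLIntegral_annulus_le hp h).trans_lt (ENNReal.mul_lt_top
    (ENNReal.mul_lt_top (by norm_num) h.lt_top) ?_)).ne
  exact (luxNorm_chi_ne_top (measurableSet_annulus k) hp.conjExp.one_le
    (volume_annulus_ne_top k)).lt_top

theorem annMin_mul_volume_le (g : 𝓢'(E n, ℂ)) (k : ℤ) :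
    annMin N g k * volume (annulus n k) ≤ ∫⁻ x in annulus n k, grandMaximal N g x := by
  rw [← setLIntegral_const]
  exact setLIntegral_mono (measurable_grandMaximal g) fun x hx => iInf₂_le x hx

theorem exists_ofReal_mul_annMin_le (hn : 1 ≤ n) (N : ℕ) :
    ∃ C : ℝ≥0, ∀ (g : 𝓢'(E n, ℂ)) (k : ℤ),
      ENNReal.ofReal (((2 : ℝ) ^ k) ^ n) * annMin N g k ≤
        C * ∫⁻ x in annulus n k, grandMaximal N g x := by
  have hV0 : volume (ball (0 : E n) 1) ≠ 0 := volume_unitBall_ne_zero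
  have hVt : volume (ball (0 : E n) 1) ≠ ∞ := volume_unitBall_ne_top
  have hCt : 2 * (volume (ball (0 : E n) 1))⁻¹ ≠ ∞ :=
    ENNReal.mul_ne_top (by norm_num) (ENNReal.inv_ne_top.2 hV0)
  refine ⟨(2 * (volume (ball (0 : E n) 1))⁻¹).toNNReal, fun g k => ?_⟩
  rw [ENNReal.coe_toNNReal hCt]
  have h1 : ENNReal.ofReal (((2 : ℝ) ^ k) ^ n) * volume (ball (0 : E n) 1) ≤
      2 * volume (annulus n k) := by
    rw [← volume_ball_eq (0 : E n) (two_zpow_pos k)]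
    exact volume_dyadicBall_le_volume_annulus hn k
  have h2 := annMin_mul_volume_le (N := N) g k
  calc ENNReal.ofReal (((2 : ℝ) ^ k) ^ n) * annMin N g k
      = (ENNReal.ofReal (((2 : ℝ) ^ k) ^ n) * volume (ball (0 : E n) 1)) *
        (volume (ball (0 : E n) 1))⁻¹ * annMin N g k := by
        rw [mul_assoc (ENNReal.ofReal _), ENNReal.mul_inv_cancel hV0 hVt, mul_one]
    _ ≤ (2 * volume (annulus n k)) * (volume (ball (0 : E n) 1))⁻¹ * annMin N g k :=
        mul_le_mul_left (mul_le_mul_left h1 _) _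
    _ = 2 * (volume (ball (0 : E n) 1))⁻¹ * (annMin N g k * volume (annulus n k)) := by ring
    _ ≤ _ := mul_le_mul_right h2 _

theorem annMin_ne_top (hn : 1 ≤ n) (hp : ClassP p) {g : 𝓢'(E n, ℂ)} {k : ℤ}
    (h : annNorm p N g k ≠ ∞) : annMin N g k ≠ ∞ := by
  intro htop
  have h1 := annMin_mul_volume_le (N := N) g k
  rw [htop, ENNReal.top_mul (volume_annulus_ne_zero hn k), top_le_iff] at h1
  exact setLIntegral_annulus_ne_top hp h h1

/-- On the annulus the constant `annMin` lies below `G_N g`, and the annulus has norm comparable to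
the larger ball. The index `k + 1` leaves room for functions supported in the closed ball of radius
`2 ^ k`. -/
theorem exists_annMin_mul_luxNorm_le (hn : 1 ≤ n) (hp : ClassB p) (N : ℕ) :
    ∃ C : ℝ≥0, ∀ (g : 𝓢'(E n, ℂ)) (k : ℤ), annNorm p N g k ≠ ∞ →
      annMin N g k * luxNorm p (chi (dyadicBall n (k + 1))) ≤ C * annNorm p N g k := by
  obtain ⟨C, hC⟩ := hp.exists_luxNorm_chi_ball_mul_volume_le
  refine ⟨C * (2 ^ n * 2), fun g k h => ?_⟩
  have hm := annMin_ne_top hn hp.1 h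
  set F := annulus n k with hF
  have hFs : F ⊆ ball 0 ((2 : ℝ) ^ (k + 1)) :=
    (annulus_subset k).trans (dyadicBall_subset (by omega))
  have h1 := hC ((2 : ℝ) ^ (k + 1)) (two_zpow_pos _) F (measurableSet_annulus k) hFs
  have h2 : volume (ball (0 : E n) ((2 : ℝ) ^ (k + 1))) ≤ 2 ^ n * 2 * volume F := by
    have h3 : volume (ball (0 : E n) ((2 : ℝ) ^ (k + 1))) =
        2 ^ n * volume (ball (0 : E n) ((2 : ℝ) ^ k)) := by
      have hof : ENNReal.ofReal ((2 : ℝ) ^ n) = 2 ^ n := by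
        rw [ENNReal.ofReal_pow zero_le_two, ENNReal.ofReal_ofNat]
      rw [volume_ball_eq _ (two_zpow_pos _), volume_ball_eq _ (two_zpow_pos _),
        zpow_add_one₀ two_ne_zero, mul_pow, ENNReal.ofReal_mul (by positivity), hof]
      ring
    rw [h3, mul_assoc]
    exact mul_le_mul_right (volume_dyadicBall_le_volume_annulus hn k) _
  have h4 : luxNorm p (chi (ball (0 : E n) ((2 : ℝ) ^ (k + 1)))) ≤
      C * (2 ^ n * 2) * luxNorm p (chi F) := by
    have hv0 := volume_annulus_ne_zero hn k
    have hvt := volume_annulus_ne_top (n := n) k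
    rw [← ENNReal.mul_le_mul_iff_left hv0 hvt]
    calc luxNorm p (chi (ball (0 : E n) ((2 : ℝ) ^ (k + 1)))) * volume F
        ≤ C * volume (ball (0 : E n) ((2 : ℝ) ^ (k + 1))) * luxNorm p (chi F) := h1
      _ ≤ C * (2 ^ n * 2 * volume F) * luxNorm p (chi F) :=
          mul_le_mul_left (mul_le_mul_right h2 _) _
      _ = _ := by ring
  have h5 : annMin N g k * luxNorm p (chi F) ≤ annNorm p N g k := by
    rcases eq_or_ne (annMin N g k) 0 with h0 | h0
    · rw [h0, zero_mul]
      exact zero_le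
    · obtain ⟨m, hm'⟩ : ∃ m : ℝ≥0, (m : ℝ≥0∞) = annMin N g k := ⟨_, ENNReal.coe_toNNReal hm⟩
      rw [← hm'] at h0 ⊢
      rw [← luxNorm_const_mul hp.1.pos (by exact_mod_cast h0)]
      refine luxNorm_mono hp.1.nonneg fun x => ?_
      by_cases hx : x ∈ F
      · rw [hm']
        exact mul_le_mul_left (iInf₂_le x hx) _
      · rw [chi_of_notMem hx, mul_zero]
        exact zero_le
  calc annMin N g k * luxNorm p (chi (dyadicBall n (k + 1)))
      ≤ annMin N g k * (C * (2 ^ n * 2) * luxNorm p (chi F)) := mul_le_mul_right h4 _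
    _ = C * (2 ^ n * 2) * (annMin N g k * luxNorm p (chi F)) := by ring
    _ ≤ _ := by
        push_cast
        exact mul_le_mul_right h5 _

/-- The pointwise bound holds at every point of the annulus, so it holds with the infimum, which is
in turn controlled by integrals and norms over the annulus. -/
theorem exists_enorm_apply_cut_le_annMin (n N : ℕ) :
    ∃ C : ℝ, 0 < C ∧ ∀ (g : 𝓢'(E n, ℂ)) (k : ℤ) (h : E n → ℂ)
      (hh : ContDiff ℝ ((⊤ : ℕ∞) : WithTop ℕ∞) h) (A : ℝ), 0 < A →
      ScaledBound N h ((2 : ℝ) ^ k) A →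
        ‖g (cut k h hh)‖ₑ ≤ ENNReal.ofReal (C * A * ((2 : ℝ) ^ k) ^ n) * annMin N g k := by
  obtain ⟨C, hC, h⟩ := exists_enorm_apply_cut_le n N
  refine ⟨C, hC, fun g k f hf A hA hb => ?_⟩
  have hk := two_zpow_pos k
  have h0 : ENNReal.ofReal (C * A * ((2 : ℝ) ^ k) ^ n) ≠ 0 := by
    simpa using by positivity
  unfold annMin
  rw [ENNReal.mul_iInf_of_ne h0 ENNReal.ofReal_ne_top]
  refine le_iInf fun x => ?_
  rw [ENNReal.mul_iInf_of_ne h0 ENNReal.ofReal_ne_top]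
  exact le_iInf fun hx => h g k f hf A hA hb x (annulus_subset k hx)

theorem ScaledBound.mono {f : E n → ℂ} {ρ A B : ℝ} (hρ : 0 ≤ ρ) (hf : ScaledBound N f ρ A)
    (h : A ≤ B) : ScaledBound N f ρ B := fun j hj x hx =>
  (hf j hj x hx).trans (mul_le_mul_of_nonneg_right h (by positivity))

theorem exists_enorm_apply_cut_monom_le (n N s : ℕ) :
    ∃ C : ℝ, 0 < C ∧ ∀ (g : 𝓢'(E n, ℂ)) (k : ℤ), ∀ β ∈ multiIndices n s,
      ‖g (cut k _ (contDiff_monom β))‖ₑ ≤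
        ENNReal.ofReal (C * ((2 : ℝ) ^ k) ^ (n + ∑ i, β i)) * annMin N g k := by
  obtain ⟨C, hC, h⟩ := exists_enorm_apply_cut_le_annMin n N
  choose B hB hBb using fun β : Fin n → ℕ => exists_scaledBound_monom β N
  have hsum0 : 0 ≤ ∑ β ∈ multiIndices n s, B β := Finset.sum_nonneg fun β _ => hB β
  refine ⟨C * (∑ β ∈ multiIndices n s, B β + 1), by positivity, fun g k β hβ => ?_⟩
  have hk := two_zpow_pos k
  have h1 := h g k _ (contDiff_monom β)
    ((∑ β ∈ multiIndices n s, B β + 1) * ((2 : ℝ) ^ k) ^ ∑ i, β i) (by positivity)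
    ((hBb β _ hk).mono hk.le (by
      gcongr
      have := Finset.single_le_sum (f := B) (fun γ _ => hB γ) hβ
      linarith))
  refine h1.trans_eq ?_
  congr 2
  rw [pow_add]
  ring

end Annuli

/-! ### Functions carrying the low-order moments of the cut-off distribution. -/

section Projection

variable {n N s : ℕ} {p : E n → ℝ} {η : (Fin n → ℕ) → E n → ℝ}

/-- Continuous functions supported in the unit ball, dual to the monomials of order at most `s`. -/
structure IsDualSystem (s : ℕ) (η : (Fin n → ℕ) → E n → ℝ) : Prop where
  continuous : ∀ β, Continuous (η β)
  eq_zero : ∀ β x, 1 < ‖x‖ → η β x = 0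
  integral_mul_monom : ∀ β ∈ multiIndices n s, ∀ γ ∈ multiIndices n s,
    ∫ x, η β x * monom γ x = if β = γ then 1 else 0

/-- The dual system at scale `2 ^ k`. -/
noncomputable def scaledDual (η : (Fin n → ℕ) → E n → ℝ) (k : ℤ) (β : Fin n → ℕ) (x : E n) : ℝ :=
  ((2 : ℝ) ^ k)⁻¹ ^ (n + ∑ i, β i) * η β (((2 : ℝ) ^ k)⁻¹ • x)

theorem IsDualSystem.continuous_scaledDual (hη : IsDualSystem s η) (k : ℤ) (β : Fin n → ℕ) :
    Continuous (scaledDual η k β) :=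
  continuous_const.mul ((hη.continuous β).comp (continuous_const_smul _))

theorem IsDualSystem.scaledDual_eq_zero (hη : IsDualSystem s η) {k : ℤ} (β : Fin n → ℕ) {x : E n}
    (hx : 2 ^ k < ‖x‖) : scaledDual η k β x = 0 := by
  unfold scaledDual
  rw [hη.eq_zero, mul_zero]
  rw [norm_inv_smul]
  exact (one_lt_div (two_zpow_pos k)).2 hx

theorem IsDualSystem.integral_scaledDual_mul_monom (hη : IsDualSystem s η) (k : ℤ)
    {β γ : Fin n → ℕ} (hβ : β ∈ multiIndices n s) (hγ : γ ∈ multiIndices n s) :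
    ∫ x, scaledDual η k β x * monom γ x = if β = γ then 1 else 0 := by
  have hk := two_zpow_pos k
  set ρ : ℝ := (2 : ℝ) ^ k with hρ
  have h1 : (fun x => scaledDual η k β x * monom γ x) = fun x =>
      ρ⁻¹ ^ (n + ∑ i, β i) * ρ ^ (∑ i, γ i) * (fun w => η β w * monom γ w) (ρ⁻¹ • x) := by
    ext x
    unfold scaledDual
    beta_reduce
    rw [monom_smul, ← hρ, inv_pow ρ (∑ i, γ i)]
    field_simp
  have h2 : |((ρ⁻¹ ^ n)⁻¹)| = ρ ^ n := by
    rw [inv_pow, inv_inv, abs_of_pos (by positivity)]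
  rw [h1, integral_const_mul, Measure.integral_comp_smul volume (fun w => η β w * monom γ w), hη.integral_mul_monom β hβ γ hγ,
    finrank_euclideanSpace_fin, h2]
  split_ifs with h
  · rw [h, smul_eq_mul, mul_one, pow_add, inv_pow, inv_pow]
    field_simp
  · simp

theorem IsDualSystem.exists_abs_scaledDual_le (hη : IsDualSystem s η) :
    ∃ H : ℝ, 0 < H ∧ ∀ (k : ℤ), ∀ β ∈ multiIndices n s, ∀ x,
      |scaledDual η k β x| ≤ H * ((2 : ℝ) ^ k)⁻¹ ^ (n + ∑ i, β i) := by
  have h1 : ∀ β, ∃ H : ℝ, ∀ x, ‖η β x‖ ≤ H := fun β => by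
    refine HasCompactSupport.exists_bound_of_continuous
      (HasCompactSupport.of_support_subset_isCompact (isCompact_closedBall (0 : E n) 1)
        fun x hx => ?_) (hη.continuous β)
    rw [mem_closedBall_zero_iff]
    by_contra h
    exact hx (hη.eq_zero β x (not_le.1 h))
  choose H hH using h1
  have hH0 : ∀ β, 0 ≤ H β := fun β => (norm_nonneg _).trans (hH β 0)
  have hsum0 : 0 ≤ ∑ β ∈ multiIndices n s, H β := Finset.sum_nonneg fun β _ => hH0 β
  refine ⟨∑ β ∈ multiIndices n s, H β + 1, by positivity, fun k β hβ x => ?_⟩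
  have hk := two_zpow_pos k
  unfold scaledDual
  rw [abs_mul, abs_of_pos (by positivity), mul_comm]
  gcongr
  have := Finset.single_le_sum (f := H) (fun γ _ => hH0 γ) hβ
  have h2 := hH β (((2 : ℝ) ^ k)⁻¹ • x)
  rw [Real.norm_eq_abs] at h2
  linarith

/-- The function with the same moments of order at most `s` as the localization of `g` to the
ball of radius `2 ^ k`. -/
noncomputable def projFn (g : 𝓢'(E n, ℂ)) (η : (Fin n → ℕ) → E n → ℝ) (s : ℕ) (k : ℤ)
    (x : E n) : ℂ :=
  ∑ β ∈ multiIndices n s, g (cut k _ (contDiff_monom β)) * (scaledDual η k β x : ℂ)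

theorem IsDualSystem.continuous_projFn (hη : IsDualSystem s η) (g : 𝓢'(E n, ℂ)) (k : ℤ) :
    Continuous (projFn g η s k) :=
  continuous_finsetSum _ fun β _ => continuous_const.mul
    (Complex.continuous_ofReal.comp (hη.continuous_scaledDual k β))

theorem IsDualSystem.projFn_eq_zero (hη : IsDualSystem s η) (g : 𝓢'(E n, ℂ)) {k : ℤ} {x : E n}
    (hx : 2 ^ k < ‖x‖) : projFn g η s k x = 0 := by
  unfold projFn
  refine Finset.sum_eq_zero fun β _ => ?_
  rw [hη.scaledDual_eq_zero β hx, Complex.ofReal_zero, mul_zero]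

theorem IsDualSystem.hasCompactSupport_projFn (hη : IsDualSystem s η) (g : 𝓢'(E n, ℂ)) (k : ℤ) :
    HasCompactSupport (projFn g η s k) := by
  refine HasCompactSupport.of_support_subset_isCompact (isCompact_closedBall (0 : E n) (2 ^ k))
    fun x hx => ?_
  rw [mem_closedBall_zero_iff]
  by_contra h
  exact hx (hη.projFn_eq_zero g (not_le.1 h))

theorem IsDualSystem.integrable_projFn_mul (hη : IsDualSystem s η) (g : 𝓢'(E n, ℂ)) (k : ℤ)
    {φ : E n → ℂ} (hφ : Continuous φ) : Integrable fun x => projFn g η s k x * φ x :=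
  ((hη.continuous_projFn g k).mul hφ).integrable_of_hasCompactSupport
    (hη.hasCompactSupport_projFn g k).mul_right

theorem IsDualSystem.integral_projFn_mul_monom (hη : IsDualSystem s η) (g : 𝓢'(E n, ℂ)) (k : ℤ)
    {γ : Fin n → ℕ} (hγ : γ ∈ multiIndices n s) :
    ∫ x, projFn g η s k x * (monom γ x : ℂ) = g (cut k _ (contDiff_monom γ)) := by
  have h1 : (fun x => projFn g η s k x * (monom γ x : ℂ)) = fun x => ∑ β ∈ multiIndices n s,
      g (cut k _ (contDiff_monom β)) * ((scaledDual η k β x * monom γ x : ℝ) : ℂ) := by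
    ext x
    unfold projFn
    rw [Finset.sum_mul]
    refine Finset.sum_congr rfl fun β _ => ?_
    push_cast
    ring
  have hfi : ∀ β, Integrable fun x => scaledDual η k β x * monom γ x := fun β => by
    refine ((hη.continuous_scaledDual k β).mul
      (continuous_monom γ)).integrable_of_hasCompactSupport ?_
    refine HasCompactSupport.of_support_subset_isCompact (isCompact_closedBall (0 : E n) (2 ^ k))
      fun x hx => ?_
    rw [mem_closedBall_zero_iff]
    by_contra h
    apply hx
    change scaledDual η k β x * monom γ x = 0
    rw [hη.scaledDual_eq_zero β (not_le.1 h), zero_mul]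
  rw [h1, integral_finsetSum _ fun β _ => (hfi β).ofReal.const_mul _]
  rw [Finset.sum_eq_single γ]
  · rw [integral_const_mul, integral_complex_ofReal, hη.integral_scaledDual_mul_monom k hγ hγ,
      if_pos rfl, Complex.ofReal_one, mul_one]
  · intro β hβ hne
    rw [integral_const_mul, integral_complex_ofReal, hη.integral_scaledDual_mul_monom k hβ hγ,
      if_neg hne, Complex.ofReal_zero, mul_zero]
  · exact fun h => absurd hγ h

/-- The moment of order `β` contributes `2 ^ (k (n + |β|))` and the dual function its inverse, so
every term has size `annMin`. -/
theorem IsDualSystem.exists_enorm_projFn_le (hη : IsDualSystem s η) (N : ℕ) :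
    ∃ C : ℝ≥0, ∀ (g : 𝓢'(E n, ℂ)) (k : ℤ) (x : E n),
      ‖projFn g η s k x‖ₑ ≤ C * annMin N g k * chi (dyadicBall n (k + 1)) x := by
  obtain ⟨H, hH, hηH⟩ := hη.exists_abs_scaledDual_le
  obtain ⟨C, hC, hcut⟩ := exists_enorm_apply_cut_monom_le n N s
  refine ⟨(multiIndices n s).card * (C * H).toNNReal, fun g k x => ?_⟩
  have hk := two_zpow_pos k
  by_cases hx : x ∈ dyadicBall n (k + 1)
  · rw [chi_of_mem hx, mul_one]
    unfold projFn
    refine (enorm_sum_le _ _).trans ?_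
    have h1 : ∀ β ∈ multiIndices n s,
        ‖g (cut k _ (contDiff_monom β)) * (scaledDual η k β x : ℂ)‖ₑ ≤
          ENNReal.ofReal (C * H) * annMin N g k := by
      intro β hβ
      rw [enorm_mul]
      have h2 : ‖(scaledDual η k β x : ℂ)‖ₑ ≤
          ENNReal.ofReal (H * ((2 : ℝ) ^ k)⁻¹ ^ (n + ∑ i, β i)) := by
        rw [← ofReal_norm, Complex.norm_real, Real.norm_eq_abs]
        exact ENNReal.ofReal_le_ofReal (hηH k β hβ x)
      refine (mul_le_mul' (hcut g k β hβ) h2).trans_eq ?_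
      rw [mul_right_comm, ← ENNReal.ofReal_mul (by positivity)]
      congr 2
      rw [inv_pow]
      field_simp
    refine (Finset.sum_le_card_nsmul _ _ _ h1).trans_eq ?_
    rw [nsmul_eq_mul]
    push_cast
    rw [ENNReal.ofReal]
    ring
  · rw [hη.projFn_eq_zero, enorm_zero]
    · exact zero_le
    · have h1 : ¬ ‖x‖ < 2 ^ (k + 1) := fun h => hx (mem_ball_zero_iff.2 h)
      rw [zpow_add_one₀ two_ne_zero] at h1
      linarith

theorem IsDualSystem.exists_luxNorm_projFn_le (hη : IsDualSystem s η) (hn : 1 ≤ n)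
    (hp : ClassB p) (N : ℕ) :
    ∃ C : ℝ≥0, ∀ (g : 𝓢'(E n, ℂ)) (k : ℤ), annNorm p N g k ≠ ∞ →
      luxNorm p (fun x => ‖projFn g η s k x‖ₑ) ≤ C * annNorm p N g k := by
  obtain ⟨C, hC⟩ := hη.exists_enorm_projFn_le N
  obtain ⟨D, hD⟩ := exists_annMin_mul_luxNorm_le hn hp N
  refine ⟨C * D, fun g k h => ?_⟩
  obtain ⟨m, hm⟩ : ∃ m : ℝ≥0, (m : ℝ≥0∞) = annMin N g k :=
    ⟨_, ENNReal.coe_toNNReal (annMin_ne_top hn hp.1 h)⟩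
  have h1 := hD g k h
  rw [← hm] at h1
  calc luxNorm p (fun x => ‖projFn g η s k x‖ₑ)
      ≤ luxNorm p (fun x => ((C * m : ℝ≥0) : ℝ≥0∞) * chi (dyadicBall n (k + 1)) x) := by
        refine luxNorm_mono hp.1.nonneg fun x => ?_
        push_cast
        rw [hm]
        exact hC g k x
    _ ≤ ((C * m : ℝ≥0) : ℝ≥0∞) * luxNorm p (chi (dyadicBall n (k + 1))) :=
        luxNorm_const_mul_le hp.1.pos _ _
    _ = C * (m * luxNorm p (chi (dyadicBall n (k + 1)))) := by
        push_cast
        ring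
    _ ≤ C * (D * annNorm p N g k) := mul_le_mul_right h1 _
    _ = _ := by
        push_cast
        ring

/-- The difference between the localization of `g` to the ball of radius `2 ^ k` and the function
with the same moments, tested against a smooth function. -/
noncomputable def tailPart (g : 𝓢'(E n, ℂ)) (η : (Fin n → ℕ) → E n → ℝ) (s : ℕ) (k : ℤ)
    (h : E n → ℂ) (hh : ContDiff ℝ ((⊤ : ℕ∞) : WithTop ℕ∞) h) : ℂ :=
  g (cut k h hh) - ∫ x, projFn g η s k x * h x

/-- The cut-off distribution and `projFn` agree on monomials of order at most `s`, so a polynomial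
of that degree may be subtracted from the test function. -/
theorem IsDualSystem.tailPart_eq (hη : IsDualSystem s η) (g : 𝓢'(E n, ℂ)) (k : ℤ) {h R : E n → ℂ}
    (hh : ContDiff ℝ ((⊤ : ℕ∞) : WithTop ℕ∞) h) (hR : ContDiff ℝ ((⊤ : ℕ∞) : WithTop ℕ∞) R)
    {t : (Fin n → ℕ) → ℂ}
    (heq : ∀ x, R x = h x - ∑ β ∈ multiIndices n s, t β * (monom β x : ℂ)) :
    tailPart g η s k h hh = tailPart g η s k R hR := by
  unfold tailPart
  have h1 : cut k R hR =
      cut k h hh - ∑ β ∈ multiIndices n s, t β • cut k _ (contDiff_monom β) := by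
    ext x
    rw [sub_apply, sum_apply, cut_apply, cut_apply, heq, mul_sub, Finset.mul_sum]
    congr 1
    refine Finset.sum_congr rfl fun β _ => ?_
    rw [smul_apply, cut_apply, smul_eq_mul]
    ring
  have hm : ∀ β, Continuous fun x : E n => (monom β x : ℂ) := fun β => (contDiff_monom β).continuous
  have hfi : ∀ β, Integrable fun x => t β * (projFn g η s k x * (monom β x : ℂ)) := fun β =>
    (hη.integrable_projFn_mul g k (hm β)).const_mul _
  have h2 : ∫ x, projFn g η s k x * R x = (∫ x, projFn g η s k x * h x) -
      ∑ β ∈ multiIndices n s, t β * g (cut k _ (contDiff_monom β)) := by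
    have h3 : (fun x => projFn g η s k x * R x) = fun x => projFn g η s k x * h x -
        ∑ β ∈ multiIndices n s, t β * (projFn g η s k x * (monom β x : ℂ)) := by
      ext x
      rw [heq, mul_sub, Finset.mul_sum]
      congr 1
      exact Finset.sum_congr rfl fun β _ => by ring
    rw [h3, integral_sub (hη.integrable_projFn_mul g k hh.continuous)
      (integrable_finsetSum _ fun β _ => hfi β), integral_finsetSum _ fun β _ => hfi β]
    congr 1
    refine Finset.sum_congr rfl fun β hβ => ?_
    rw [integral_const_mul, hη.integral_projFn_mul_monom g k hβ]
  rw [h1, h2, map_sub, map_sum]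
  simp_rw [map_smul, smul_eq_mul]
  ring

/-- The test function may be replaced by its Taylor remainder at `0`, which is of size `2 ^ (k (s +
1))` at scales `2 ^ k ≤ 1`. This drives the telescoping limit at `-∞`. -/
theorem IsDualSystem.exists_enorm_tailPart_le (hη : IsDualSystem s η) (φ : 𝓢(E n, ℂ)) (N : ℕ) :
    ∃ C : ℝ≥0, ∀ (g : 𝓢'(E n, ℂ)) (k : ℤ), k ≤ 0 →
      ‖tailPart g η s k φ φ.smooth'‖ₑ ≤
        C * ENNReal.ofReal (((2 : ℝ) ^ k) ^ (s + 1)) *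
          (ENNReal.ofReal (((2 : ℝ) ^ k) ^ n) * annMin N g k) := by
  obtain ⟨t, C₁, hC₁, ht⟩ := exists_taylor_scaledBound φ.smooth' s N
  obtain ⟨C₂, hC₂, hcut⟩ := exists_enorm_apply_cut_le_annMin n N
  obtain ⟨C₃, hC₃⟩ := hη.exists_enorm_projFn_le N
  set R : E n → ℂ := fun w => φ w - ∑ β ∈ multiIndices n s, t β * (monom β w : ℂ) with hR
  have hRs : ContDiff ℝ ((⊤ : ℕ∞) : WithTop ℕ∞) R :=
    φ.smooth'.sub (ContDiff.sum fun β _ => contDiff_const.mul (contDiff_monom β))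
  have hVt : volume (ball (0 : E n) 1) ≠ ∞ := volume_unitBall_ne_top
  refine ⟨(C₂ * (C₁ + 1)).toNNReal +
    C₃ * (C₁ + 1).toNNReal * 2 ^ n * (volume (ball (0 : E n) 1)).toNNReal, fun g k hk => ?_⟩
  have hk0 := two_zpow_pos k
  have hk1 : (2 : ℝ) ^ k ≤ 1 := zpow_le_one_of_nonpos₀ one_le_two hk
  set ρ : ℝ := (2 : ℝ) ^ k with hρ
  have hRb : ScaledBound N R ρ ((C₁ + 1) * ρ ^ (s + 1)) :=
    (ht ρ hk0 hk1).mono hk0.le (by gcongr; linarith)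
  have h1 : ‖g (cut k R hRs)‖ₑ ≤ ENNReal.ofReal (C₂ * (C₁ + 1)) * ENNReal.ofReal (ρ ^ (s + 1)) *
      (ENNReal.ofReal (ρ ^ n) * annMin N g k) := by
    refine (hcut g k R hRs _ (by positivity) hRb).trans_eq ?_
    rw [← ENNReal.ofReal_mul (by positivity), ← mul_assoc (ENNReal.ofReal _)
      (ENNReal.ofReal _), ← ENNReal.ofReal_mul (by positivity)]
    congr 2
    ring
  have hRpt : ∀ x, ‖x‖ ≤ 2 * ρ → ‖R x‖ₑ ≤ ENNReal.ofReal ((C₁ + 1) * ρ ^ (s + 1)) := by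
    intro x hx
    have h2 := hRb 0 (Nat.zero_le N) x hx
    rw [norm_iteratedFDeriv_zero, pow_zero, mul_one] at h2
    rw [← ofReal_norm]
    exact ENNReal.ofReal_le_ofReal h2
  have h3 : ‖∫ x, projFn g η s k x * R x‖ₑ ≤ C₃ * ENNReal.ofReal (C₁ + 1) * 2 ^ n *
      volume (ball (0 : E n) 1) * ENNReal.ofReal (ρ ^ (s + 1)) *
      (ENNReal.ofReal (ρ ^ n) * annMin N g k) := by
    calc ‖∫ x, projFn g η s k x * R x‖ₑ ≤ ∫⁻ x, ‖projFn g η s k x * R x‖ₑ :=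
          enorm_integral_le_lintegral_enorm _
      _ ≤ ∫⁻ x, (C₃ * annMin N g k * ENNReal.ofReal ((C₁ + 1) * ρ ^ (s + 1))) *
            chi (dyadicBall n (k + 1)) x := by
          refine lintegral_mono fun x => ?_
          rw [enorm_mul]
          by_cases hx : x ∈ dyadicBall n (k + 1)
          · have h4 := hC₃ g k x
            rw [chi_of_mem hx, mul_one] at h4 ⊢
            refine mul_le_mul' h4 (hRpt x ?_)
            have h5 : ‖x‖ < 2 ^ (k + 1) := mem_ball_zero_iff.1 hx
            rw [zpow_add_one₀ two_ne_zero] at h5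
            linarith
          · have h4 := hC₃ g k x
            rw [chi_of_notMem hx, mul_zero] at h4 ⊢
            rw [nonpos_iff_eq_zero.1 h4, zero_mul]
      _ = (C₃ * annMin N g k * ENNReal.ofReal ((C₁ + 1) * ρ ^ (s + 1))) *
            volume (dyadicBall n (k + 1)) := by
          have hms : MeasurableSet (dyadicBall n (k + 1)) := measurableSet_ball
          rw [lintegral_const_mul _ (measurable_chi hms)]
          unfold chi
          rw [lintegral_indicator_one hms]
      _ = _ := by
          have hof : ENNReal.ofReal ((2 : ℝ) ^ n) = 2 ^ n := by
            rw [ENNReal.ofReal_pow zero_le_two, ENNReal.ofReal_ofNat]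
          unfold dyadicBall
          rw [volume_ball_eq _ (two_zpow_pos _), zpow_add_one₀ two_ne_zero, ← hρ, mul_pow,
            ENNReal.ofReal_mul (by positivity), ENNReal.ofReal_mul (by positivity), hof]
          ring
  have h6 : tailPart g η s k φ φ.smooth' = tailPart g η s k R hRs :=
    hη.tailPart_eq g k φ.smooth' hRs (t := t) (fun x => rfl)
  rw [h6]
  unfold tailPart
  refine (enorm_sub_le).trans ((add_le_add h1 h3).trans_eq ?_)
  push_cast
  rw [ENNReal.coe_toNNReal hVt, ENNReal.ofReal, ENNReal.ofReal, ENNReal.ofReal, ENNReal.ofReal]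
  ring

/-- Used as `k → ∞`: `projFn` is uniformly of size `annMin` and `φ` is integrable, so smallness of
`annMin` suffices. -/
theorem IsDualSystem.exists_enorm_integral_projFn_mul_le (hη : IsDualSystem s η)
    (φ : 𝓢(E n, ℂ)) (N : ℕ) :
    ∃ C : ℝ≥0, ∀ (g : 𝓢'(E n, ℂ)) (k : ℤ),
      ‖∫ x, projFn g η s k x * φ x‖ₑ ≤ C * annMin N g k := by
  obtain ⟨C, hC⟩ := hη.exists_enorm_projFn_le N
  have hφ : ∫⁻ x, ‖φ x‖ₑ ≠ ∞ := (φ.integrable (μ := volume)).2.ne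
  refine ⟨C * (∫⁻ x, ‖φ x‖ₑ).toNNReal, fun g k => ?_⟩
  calc ‖∫ x, projFn g η s k x * φ x‖ₑ ≤ ∫⁻ x, ‖projFn g η s k x * φ x‖ₑ :=
        enorm_integral_le_lintegral_enorm _
    _ ≤ ∫⁻ x, C * annMin N g k * ‖φ x‖ₑ := by
        refine lintegral_mono fun x => ?_
        rw [enorm_mul]
        refine mul_le_mul_left ((hC g k x).trans ?_) _
        refine mul_le_of_le_one_right' ?_
        exact Set.indicator_le_self' (fun _ _ => zero_le) x
    _ = C * annMin N g k * ∫⁻ x, ‖φ x‖ₑ := lintegral_const_mul _ (by fun_prop)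
    _ = _ := by
        push_cast
        rw [ENNReal.coe_toNNReal hφ]
        ring

end Projection

/-! ### Blocks with vanishing moments on dyadic rings. -/

section Blocks

variable {n N s : ℕ} {p : E n → ℝ} {η : (Fin n → ℕ) → E n → ℝ}

theorem exists_mem_annulus {k : ℤ} {x : E n} (hx : x ∈ dyadicBall n (k + 2) \ dyadicBall n (k - 2)) :
    ∃ l ∈ Finset.Icc (-1 : ℤ) 2, x ∈ annulus n (k + l) := by
  have h1 : ‖x‖ < 2 ^ (k + 2) := mem_ball_zero_iff.1 hx.1
  have h2 : (2 : ℝ) ^ (k - 2) ≤ ‖x‖ := not_lt.1 fun h => hx.2 (mem_ball_zero_iff.2 h)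
  rcases lt_or_ge ‖x‖ (2 ^ (k - 1)) with h3 | h3
  · refine ⟨-1, by simp, mem_annulus.2 ?_⟩
    rw [show k + -1 - 1 = k - 2 by ring, show k + -1 = k - 1 by ring]
    exact ⟨h2, h3⟩
  rcases lt_or_ge ‖x‖ (2 ^ k) with h4 | h4
  · refine ⟨0, by simp, mem_annulus.2 ?_⟩
    rw [add_zero]
    exact ⟨h3, h4⟩
  rcases lt_or_ge ‖x‖ (2 ^ (k + 1)) with h5 | h5
  · refine ⟨1, by simp, mem_annulus.2 ?_⟩
    rw [add_sub_cancel_right]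
    exact ⟨h4, h5⟩
  · refine ⟨2, by simp, mem_annulus.2 ?_⟩
    rw [show k + 2 - 1 = k + 1 by ring]
    exact ⟨h5, h1⟩

theorem setLIntegral_ring_ne_top (hp : ClassP p) {g : 𝓢'(E n, ℂ)}
    (h : ∀ k, annNorm p N g k ≠ ∞) (k : ℤ) :
    ∫⁻ x in dyadicBall n (k + 2) \ dyadicBall n (k - 2), grandMaximal N g x ≠ ∞ := by
  have hsub : dyadicBall n (k + 2) \ dyadicBall n (k - 2) ⊆
      ⋃ l : Finset.Icc (-1 : ℤ) 2, annulus n (k + l) := by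
    intro x hx
    obtain ⟨l, hl, hxl⟩ := exists_mem_annulus hx
    exact Set.mem_iUnion.2 ⟨⟨l, hl⟩, hxl⟩
  refine ne_top_of_le_ne_top ?_ ((lintegral_mono_set hsub).trans (lintegral_iUnion_le _ _))
  rw [tsum_fintype]
  exact ENNReal.sum_ne_top.2 fun l _ => setLIntegral_annulus_ne_top hp (h _)

theorem luxNorm_le_sum_annNorm (hp : ClassP p) {g : 𝓢'(E n, ℂ)} {k : ℤ} {C : ℝ≥0} {f : E n → ℂ}
    (hf : ∀ x, ‖f x‖ₑ ≤ C * grandMaximal N g x)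
    (hf0 : ∀ x, x ∉ dyadicBall n (k + 2) \ dyadicBall n (k - 2) → f x = 0) :
    luxNorm p (fun x => ‖f x‖ₑ) ≤ C * ∑ l ∈ Finset.Icc (-1 : ℤ) 2, annNorm p N g (k + l) := by
  have h1 : ∀ x, ‖f x‖ₑ ≤ C * ∑' l : Finset.Icc (-1 : ℤ) 2,
      grandMaximal N g x * chi (annulus n (k + l)) x := by
    intro x
    by_cases hx : x ∈ dyadicBall n (k + 2) \ dyadicBall n (k - 2)
    · obtain ⟨l, hl, hxl⟩ := exists_mem_annulus hx
      refine (hf x).trans (mul_le_mul_right ?_ _)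
      refine le_trans (le_of_eq ?_) (ENNReal.le_tsum (⟨l, hl⟩ : Finset.Icc (-1 : ℤ) 2))
      rw [chi_of_mem hxl, mul_one]
    · rw [hf0 x hx, enorm_zero]
      exact zero_le
  have hm : ∀ l : Finset.Icc (-1 : ℤ) 2,
      Measurable fun x => grandMaximal N g x * chi (annulus n (k + l)) x := fun l =>
    (measurable_grandMaximal g).mul (measurable_chi (measurableSet_annulus _))
  refine (luxNorm_mono hp.nonneg h1).trans ((luxNorm_const_mul_le hp.pos _ _).trans ?_)
  refine mul_le_mul_right ((luxNorm_tsum_le hp.measurable hp.one_le _ hm).trans_eq ?_) _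
  rw [tsum_fintype]
  exact Finset.sum_coe_sort (Finset.Icc (-1 : ℤ) 2) fun l => annNorm p N g (k + l)

/-- The difference of two consecutive cutoff functions. -/
noncomputable def ringCut (n : ℕ) (k : ℤ) : 𝓢(E n, ℂ) :=
  cut k (fun _ => 1) contDiff_const - cut (k - 1) (fun _ => 1) contDiff_const

theorem ringCut_apply (k : ℤ) (x : E n) : ringCut n k x = cutFn n k x - cutFn n (k - 1) x := by
  unfold ringCut
  rw [sub_apply, cut_apply, cut_apply, mul_one, mul_one]

theorem norm_ringCut_le_one (k : ℤ) (x : E n) : ‖ringCut n k x‖ ≤ 1 := by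
  rw [ringCut_apply]
  obtain ⟨a, ha, ha0, ha1⟩ := cutFn_nonneg_le_one (n := n) k x
  obtain ⟨b, hb, hb0, hb1⟩ := cutFn_nonneg_le_one (n := n) (k - 1) x
  rw [ha, hb, ← Complex.ofReal_sub, Complex.norm_real, Real.norm_eq_abs, abs_le]
  constructor <;> linarith

theorem hasCompactSupport_ringCut (k : ℤ) : HasCompactSupport (ringCut n k) :=
  (hasCompactSupport_cutFn_mul k _).sub (hasCompactSupport_cutFn_mul (k - 1) _)

/-- The ring cutoff lives where `2 ^ (k - 1) < ‖z‖ < 2 ^ (k + 1)`; a margin `2 ^ (k - 2)` keeps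
clear of the inner ball and inside `B_{k+2}`. -/
theorem ball_subset_of_ringCut_ne_zero {k : ℤ} {z : E n} (hz : ringCut n k z ≠ 0) :
    ball z (2 ^ (k - 2)) ⊆ dyadicBall n (k + 2) \ dyadicBall n (k - 2) := by
  have e1 : (2 : ℝ) ^ (k - 1) = 2 * 2 ^ (k - 2) := by
    rw [← zpow_one_add₀ two_ne_zero]; congr 1; ring
  have e2 : (2 : ℝ) ^ k = 2 * 2 ^ (k - 1) := by
    rw [← zpow_one_add₀ two_ne_zero]; congr 1; ring
  have e3 : (2 : ℝ) ^ (k + 2) = 4 * 2 ^ k := by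
    rw [zpow_add₀ two_ne_zero]; norm_num; ring
  have hpos := two_zpow_pos (k - 2)
  have h1 : (2 : ℝ) ^ (k - 1) < ‖z‖ := by
    by_contra! h
    apply hz
    rw [ringCut_apply, cutFn_eq_one (by linarith), cutFn_eq_one h, sub_self]
  have h2 : ‖z‖ < 2 * 2 ^ k := by
    by_contra! h
    apply hz
    rw [ringCut_apply, cutFn_eq_zero h, cutFn_eq_zero (by linarith), sub_self]
  intro x hx
  rw [mem_ball, dist_eq_norm] at hx
  have h3 : ‖x‖ ≤ ‖z‖ + ‖x - z‖ := by
    rw [add_comm, ← sub_le_iff_le_add]; exact norm_sub_norm_le _ _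
  have h4 : ‖z‖ ≤ ‖x‖ + ‖x - z‖ := by
    rw [add_comm, ← sub_le_iff_le_add, norm_sub_rev]; exact norm_sub_norm_le _ _
  refine ⟨mem_ball_zero_iff.2 (by linarith), fun h => ?_⟩
  have := mem_ball_zero_iff.1 h
  linarith

theorem smulLeftCLM_ringCut (k : ℤ) (φ : 𝓢(E n, ℂ)) :
    SchwartzMap.smulLeftCLM ℂ (ringCut n k) φ =
      cut k φ φ.smooth' - cut (k - 1) φ φ.smooth' := by
  ext x
  rw [SchwartzMap.smulLeftCLM_apply_apply (ringCut n k).hasTemperateGrowth, ringCut_apply,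
    sub_apply, cut_apply, cut_apply, smul_eq_mul, sub_mul]

/-- A monomial is not a Schwartz function; cutting it at scale `k + 2`, where the cutoff is still
`1` on the support of `ringCut`, gives an admissible substitute. -/
theorem smulLeftCLM_ringCut_monom (k : ℤ) (γ : Fin n → ℕ) :
    SchwartzMap.smulLeftCLM ℂ (ringCut n k) (cut (k + 2) _ (contDiff_monom γ)) =
      cut k _ (contDiff_monom γ) - cut (k - 1) _ (contDiff_monom γ) := by
  ext x
  rw [SchwartzMap.smulLeftCLM_apply_apply (ringCut n k).hasTemperateGrowth, ringCut_apply,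
    sub_apply, cut_apply, cut_apply, cut_apply, smul_eq_mul, ← sub_mul]
  rcases le_total ‖x‖ (2 ^ (k + 2)) with h | h
  · rw [cutFn_eq_one h, one_mul]
  · have e2 : (2 : ℝ) ^ k = 2 * 2 ^ (k - 1) := by
      rw [← zpow_one_add₀ two_ne_zero]; congr 1; ring
    have e3 : (2 : ℝ) ^ (k + 2) = 4 * 2 ^ k := by
      rw [zpow_add₀ two_ne_zero]; norm_num; ring
    have hpos := two_zpow_pos (k - 1)
    rw [cutFn_eq_zero (k := k) (by linarith), cutFn_eq_zero (k := k - 1) (by linarith), sub_self,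
      zero_mul, zero_mul]

/-- The block is the localized function minus `projFn` at `k` plus `projFn` at `k - 1`. Localizing
produces the moments of `cut k` minus those of `cut (k - 1)`, which the two corrections cancel. The
same regrouping shows that the blocks telescope. -/
theorem IsDualSystem.exists_blocks (hη : IsDualSystem s η) (hn : 1 ≤ n) (hp : ClassB p) (N : ℕ) :
    ∃ C : ℝ≥0, ∀ g : 𝓢'(E n, ℂ), (∀ k, annNorm p N g k ≠ ∞) →
      ∃ b : ℤ → E n → ℂ, (∀ k, StronglyMeasurable (b k)) ∧
        (∀ k x, (2 : ℝ) ^ (k + 2) ≤ ‖x‖ → b k x = 0) ∧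
        (∀ k, luxNorm p (fun x => ‖b k x‖ₑ) ≤
          C * ∑ l ∈ Finset.Icc (-1 : ℤ) 2, annNorm p N g (k + l)) ∧
        (∀ k, ∀ β ∈ multiIndices n s, ∫ x, b k x * (monom β x : ℂ) = 0) ∧
        ∀ k (φ : 𝓢(E n, ℂ)), ∫ x, b k x * φ x =
          tailPart g η s k φ φ.smooth' - tailPart g η s (k - 1) φ φ.smooth' := by
  obtain ⟨C₁, hC₁⟩ := exists_localization hn N
  obtain ⟨C₂, hC₂⟩ := hη.exists_luxNorm_projFn_le hn hp N
  refine ⟨C₁ + (C₂ + C₂), fun g hg => ?_⟩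
  choose f hfm hfG hf0 hfg using fun k : ℤ => hC₁ g (dyadicBall n (k + 2) \ dyadicBall n (k - 2))
    (measurableSet_ball.diff measurableSet_ball) (setLIntegral_ring_ne_top hp.1 hg k)
    (ringCut n k) (hasCompactSupport_ringCut k) (norm_ringCut_le_one k) (2 ^ (k - 2))
    (two_zpow_pos _) fun z hz => ball_subset_of_ringCut_ne_zero hz
  have hfz : ∀ k x, (2 : ℝ) ^ (k + 2) ≤ ‖x‖ → f k x = 0 := fun k x hx =>
    hf0 k x fun h => absurd (mem_ball_zero_iff.1 h.1) (not_lt.2 hx)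
  have hfi : ∀ k, Integrable (f k) := by
    intro k
    refine ⟨(hfm k).aestronglyMeasurable, ?_⟩
    have hK : MeasurableSet (dyadicBall n (k + 2) \ dyadicBall n (k - 2)) :=
      measurableSet_ball.diff measurableSet_ball
    calc ∫⁻ x, ‖f k x‖ₑ ≤ ∫⁻ x, (dyadicBall n (k + 2) \ dyadicBall n (k - 2)).indicator
          (fun x => C₁ * grandMaximal N g x) x := by
          refine lintegral_mono fun x => ?_
          by_cases hx : x ∈ dyadicBall n (k + 2) \ dyadicBall n (k - 2)
          · rw [Set.indicator_of_mem hx]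
            exact hfG k x
          · rw [Set.indicator_of_notMem hx, hf0 k x hx, enorm_zero]
      _ = C₁ * ∫⁻ x in dyadicBall n (k + 2) \ dyadicBall n (k - 2), grandMaximal N g x := by
          rw [lintegral_indicator hK, lintegral_const_mul _ (measurable_grandMaximal g)]
      _ < ∞ := ENNReal.mul_lt_top ENNReal.coe_lt_top
          (setLIntegral_ring_ne_top hp.1 hg k).lt_top
  have hfφ : ∀ k (φ : E n → ℂ), Continuous φ → Integrable fun x => f k x * φ x := fun k φ hφ =>
    integrable_mul_of_support (hfi k) (fun z hz => hfz k z hz.le) hφ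
  have hsplit : ∀ k (φ : E n → ℂ), Continuous φ →
      ∫ x, (f k x - projFn g η s k x + projFn g η s (k - 1) x) * φ x =
        (∫ x, f k x * φ x) - (∫ x, projFn g η s k x * φ x) +
          ∫ x, projFn g η s (k - 1) x * φ x := by
    intro k φ hφ
    simp_rw [add_mul, sub_mul]
    have hsub : Integrable fun x => f k x * φ x - projFn g η s k x * φ x :=
      (hfφ k φ hφ).sub (hη.integrable_projFn_mul g k hφ)
    rw [integral_add hsub (hη.integrable_projFn_mul g (k - 1) hφ), integral_sub (hfφ k φ hφ)
      (hη.integrable_projFn_mul g k hφ)]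
  refine ⟨fun k x => f k x - projFn g η s k x + projFn g η s (k - 1) x, fun k => ?_,
    fun k x hx => ?_, fun k => ?_, fun k β hβ => ?_, fun k φ => ?_⟩
  · exact ((hfm k).sub (hη.continuous_projFn g k).stronglyMeasurable).add
      (hη.continuous_projFn g (k - 1)).stronglyMeasurable
  · have e1 : (2 : ℝ) ^ k < 2 ^ (k + 2) := zpow_lt_zpow_right₀ one_lt_two (by omega)
    have e2 : (2 : ℝ) ^ (k - 1) < 2 ^ (k + 2) := zpow_lt_zpow_right₀ one_lt_two (by omega)
    beta_reduce
    rw [hfz k x hx, hη.projFn_eq_zero g (e1.trans_le hx), hη.projFn_eq_zero g (e2.trans_le hx)]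
    simp
  · have hmf := (hfm k).enorm
    have hmq : ∀ k, Measurable fun x => ‖projFn g η s k x‖ₑ := fun k =>
      (hη.continuous_projFn g k).measurable.enorm
    set S := ∑ l ∈ Finset.Icc (-1 : ℤ) 2, annNorm p N g (k + l) with hS
    have hS1 : annNorm p N g k ≤ S := by
      have := Finset.single_le_sum (f := fun l : ℤ => annNorm p N g (k + l))
        (fun l _ => zero_le) (show (0 : ℤ) ∈ Finset.Icc (-1 : ℤ) 2 by simp)
      simpa using this
    have hS2 : annNorm p N g (k - 1) ≤ S :=
      Finset.single_le_sum (f := fun l : ℤ => annNorm p N g (k + l))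
        (fun l _ => zero_le) (show (-1 : ℤ) ∈ Finset.Icc (-1 : ℤ) 2 by simp)
    calc luxNorm p (fun x => ‖f k x - projFn g η s k x + projFn g η s (k - 1) x‖ₑ)
        ≤ luxNorm p (fun x => ‖f k x‖ₑ +
            (‖projFn g η s k x‖ₑ + ‖projFn g η s (k - 1) x‖ₑ)) := by
          refine luxNorm_mono hp.1.nonneg fun x => ?_
          rw [← add_assoc]
          exact (enorm_add_le _ _).trans (add_le_add enorm_sub_le le_rfl)
      _ ≤ luxNorm p (fun x => ‖f k x‖ₑ) + (luxNorm p (fun x => ‖projFn g η s k x‖ₑ) +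
            luxNorm p (fun x => ‖projFn g η s (k - 1) x‖ₑ)) :=
          (luxNorm_add_le hp.1.measurable hp.1.one_le hmf ((hmq k).add (hmq (k - 1)))).trans
            (add_le_add le_rfl (luxNorm_add_le hp.1.measurable hp.1.one_le (hmq k) (hmq (k - 1))))
      _ ≤ C₁ * S + (C₂ * S + C₂ * S) := by
          refine add_le_add (luxNorm_le_sum_annNorm hp.1 (hfG k) (hf0 k)) (add_le_add ?_ ?_)
          · exact (hC₂ g k (hg k)).trans (mul_le_mul_right hS1 _)
          · exact (hC₂ g (k - 1) (hg _)).trans (mul_le_mul_right hS2 _)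
      _ = _ := by
          push_cast
          ring
  · have h1 : ∫ x, f k x * (monom β x : ℂ) =
        g (cut k _ (contDiff_monom β)) - g (cut (k - 1) _ (contDiff_monom β)) := by
      rw [← map_sub, ← smulLeftCLM_ringCut_monom, hfg]
      refine integral_congr_ae (Filter.Eventually.of_forall fun x => ?_)
      beta_reduce
      rcases le_total ‖x‖ (2 ^ (k + 2)) with h | h
      · rw [cut_apply, cutFn_eq_one h, one_mul]
      · rw [hfz k x h, zero_mul, zero_mul]
    rw [hsplit k _ (contDiff_monom β).continuous, h1, hη.integral_projFn_mul_monom g k hβ,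
      hη.integral_projFn_mul_monom g (k - 1) hβ]
    ring
  · rw [hsplit k _ φ.continuous, ← hfg, smulLeftCLM_ringCut, map_sub]
    unfold tailPart
    change _ = g (cut k φ _) - (∫ x, projFn g η s k x * φ x) -
      (g (cut (k - 1) φ _) - ∫ x, projFn g η s (k - 1) x * φ x)
    ring

end Blocks

/-! ### Convergence of the telescoping series to `g`. -/

section Decomposition

variable {n N s : ℕ} {p α : E n → ℝ} {αinf δ₂ u θ Γ : ℝ} {η : (Fin n → ℕ) → E n → ℝ}

/-- The coefficients of the grand maximal function in the Herz–Morrey norm. -/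
noncomputable def herzCoeff (α p : E n → ℝ) (N : ℕ) (g : 𝓢'(E n, ℂ)) (k : ℤ) : ℝ≥0∞ :=
  luxNorm p fun x => (2 : ℝ≥0∞) ^ ((k : ℝ) * α x) * grandMaximal N g x * chi (annulus n k) x

theorem hardyNorm_eq (g : 𝓢'(E n, ℂ)) :
    hardyNorm N α p u θ Γ g = grandMorreyNorm u θ Γ (herzCoeff α p N g) := rfl

theorem exists_annNorm_le_herzCoeff (hp : ClassP p) (hα_zero : LogHolderAtOrigin α)
    (hα_inf : LogHolderAtInfinity α αinf) (N : ℕ) :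
    ∃ A : ℝ≥0, ∀ (g : 𝓢'(E n, ℂ)) (k : ℤ), annNorm p N g k ≤
      A * 2 ^ (-((k : ℝ) * alphaAt α αinf ((2 : ℝ) ^ k))) * herzCoeff α p N g k := by
  obtain ⟨A, -, hA⟩ := exists_two_rpow_mul_comparable hα_zero hα_inf
  refine ⟨A, fun g k => ?_⟩
  set q : ℝ := (k : ℝ) * alphaAt α αinf ((2 : ℝ) ^ k) with hq
  obtain ⟨m, hm⟩ : ∃ m : ℝ≥0, (m : ℝ≥0∞) = A * 2 ^ (-q) :=
    ⟨_, ENNReal.coe_toNNReal (ENNReal.mul_ne_top ENNReal.coe_ne_top (two_rpow_ne_top _))⟩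
  rw [← hm]
  refine le_trans (luxNorm_mono hp.nonneg fun x => ?_) (luxNorm_const_mul_le hp.pos m _)
  by_cases hx : x ∈ annulus n k
  · rw [chi_of_mem hx, mul_one, mul_one, hm]
    have h1 := (hA k x hx).2
    calc grandMaximal N g x = 2 ^ (-q) * 2 ^ q * grandMaximal N g x := by
          rw [two_rpow_neg_mul_self, one_mul]
      _ ≤ 2 ^ (-q) * (A * 2 ^ ((k : ℝ) * α x)) * grandMaximal N g x :=
          mul_le_mul_left (mul_le_mul_right h1 _) _
      _ = _ := by ring
  · rw [chi_of_notMem hx, mul_zero]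
    exact zero_le

theorem exists_annNorm_le_hardyNorm (hu : 0 < u) (hp : ClassP p)
    (hα_zero : LogHolderAtOrigin α) (hα_inf : LogHolderAtInfinity α αinf) (N : ℕ) :
    ∃ A : ℝ≥0, ∀ (g : 𝓢'(E n, ℂ)) (k : ℤ), annNorm p N g k ≤
      A * 2 ^ ((k : ℝ) * (Γ - alphaAt α αinf ((2 : ℝ) ^ k))) * hardyNorm N α p u θ Γ g := by
  obtain ⟨A, hA⟩ := exists_annNorm_le_herzCoeff hp hα_zero hα_inf N
  refine ⟨A, fun g k => (hA g k).trans ?_⟩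
  have h1 := le_two_rpow_mul_grandMorreyNorm (θ := θ) (Γ := Γ) hu (herzCoeff α p N g) k
  refine (mul_le_mul_right h1 _).trans_eq ?_
  rw [hardyNorm_eq, ← mul_assoc, mul_assoc (A : ℝ≥0∞), ← two_rpow_add]
  congr 3
  ring

theorem norm_le_of_enorm_le {z : ℂ} {C : ℝ≥0∞} (hC : C ≠ ∞) {a : ℝ} (h : ‖z‖ₑ ≤ C * 2 ^ a) :
    ‖z‖ ≤ C.toReal * (2 : ℝ) ^ a := by
  have h1 := ENNReal.toReal_mono (ENNReal.mul_ne_top hC (two_rpow_ne_top a)) h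
  rwa [toReal_enorm, ENNReal.toReal_mul, ← ofReal_two_rpow,
    ENNReal.toReal_ofReal (by positivity)] at h1

theorem ofReal_two_zpow_pow (k : ℤ) (m : ℕ) :
    ENNReal.ofReal (((2 : ℝ) ^ k) ^ m) = 2 ^ ((k : ℝ) * m) := by
  rw [← ofReal_two_rpow, Real.rpow_mul zero_le_two, Real.rpow_natCast, Real.rpow_intCast]

/-- Hölder on the annulus bounds the integral of `G_N g` by its `p`-norm times the `p'`-norm of the
annulus, and comparison with the unit ball through `δ₂` makes the latter `O(2 ^ (k n δ₂))`. -/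
theorem exists_mul_annMin_le_of_nonpos (hn : 1 ≤ n) (hu : 0 < u) (hp : ClassB p)
    (hδ₂ : IsDeltaTwo p δ₂) (hα_zero : LogHolderAtOrigin α)
    (hα_inf : LogHolderAtInfinity α αinf) (N : ℕ) :
    ∃ C : ℝ≥0, ∀ (g : 𝓢'(E n, ℂ)), hardyNorm N α p u θ Γ g ≠ ∞ → ∀ k : ℤ, k ≤ 0 →
      ENNReal.ofReal (((2 : ℝ) ^ k) ^ n) * annMin N g k ≤
        C * hardyNorm N α p u θ Γ g * 2 ^ ((k : ℝ) * (Γ - α 0 + n * δ₂)) := by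
  obtain ⟨C₁, hC₁⟩ := exists_ofReal_mul_annMin_le hn N
  obtain ⟨A, hA⟩ := exists_annNorm_le_hardyNorm (θ := θ) (Γ := Γ) hu hp.1 hα_zero hα_inf N
  obtain ⟨hδ0, -, C₂, hC₂⟩ := hδ₂
  have hV0 : volume (ball (0 : E n) 1) ≠ 0 := volume_unitBall_ne_zero
  have hVt : volume (ball (0 : E n) 1) ≠ ∞ := volume_unitBall_ne_top
  have hXt : luxNorm (conjExp p) (chi (ball (0 : E n) 1)) ≠ ∞ :=
    luxNorm_chi_ne_top measurableSet_ball hp.1.conjExp.one_le hVt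
  set X := luxNorm (conjExp p) (chi (ball (0 : E n) 1)) with hX
  refine ⟨C₁ * (2 * A * (C₂ * X.toNNReal)), fun g hg k hk => ?_⟩
  set H := hardyNorm N α p u θ Γ g with hH
  -- At `k = 0` the exponent is `αinf` rather than `α 0`, but the factor `k` makes this harmless.
  have hkα : (k : ℝ) * (Γ - alphaAt α αinf ((2 : ℝ) ^ k)) = k * (Γ - α 0) := by
    rw [alphaAt_two_zpow]
    rcases hk.lt_or_eq with h | h
    · rw [if_pos h]
    · rw [h]
      simp
  have h1 := hA g k
  rw [hkα] at h1
  have hfin : annNorm p N g k ≠ ∞ := ne_top_of_le_ne_top (ENNReal.mul_ne_top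
    (ENNReal.mul_ne_top ENNReal.coe_ne_top (two_rpow_ne_top _)) hg) h1
  have h2 : luxNorm (conjExp p) (chi (annulus n k)) ≤ C₂ * 2 ^ ((k : ℝ) * (n * δ₂)) * X := by
    have hsub : annulus n k ⊆ ball 0 1 := (annulus_subset k).trans (by
      have := dyadicBall_subset (n := n) hk
      unfold dyadicBall at this ⊢
      rwa [zpow_zero] at this)
    refine (hC₂ 0 1 one_pos _ (measurableSet_annulus k) hsub).trans ?_
    refine mul_le_mul_left (mul_le_mul_right ?_ _) _
    rw [← mul_assoc, ENNReal.rpow_mul]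
    refine ENNReal.rpow_le_rpow ?_ hδ0.le
    refine ENNReal.div_le_of_le_mul ?_
    rw [← volume_dyadicBall]
    exact measure_mono (annulus_subset k)
  calc ENNReal.ofReal (((2 : ℝ) ^ k) ^ n) * annMin N g k
      ≤ C₁ * ∫⁻ x in annulus n k, grandMaximal N g x := hC₁ g k
    _ ≤ C₁ * (2 * annNorm p N g k * luxNorm (conjExp p) (chi (annulus n k))) :=
        mul_le_mul_right (setLIntegral_annulus_le hp.1 hfin) _
    _ ≤ C₁ * (2 * (A * 2 ^ ((k : ℝ) * (Γ - α 0)) * H) * (C₂ * 2 ^ ((k : ℝ) * (n * δ₂)) * X)) :=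
        mul_le_mul_right (mul_le_mul' (mul_le_mul_right h1 _) h2) _
    _ = C₁ * (2 * A * (C₂ * X)) * H *
          (2 ^ ((k : ℝ) * (Γ - α 0)) * 2 ^ ((k : ℝ) * (n * δ₂))) := by ring
    _ = _ := by
        rw [← two_rpow_add]
        push_cast
        rw [ENNReal.coe_toNNReal hXt]
        congr 2
        ring

/-- At large scales it is enough that the norm of `B_{k+1}` is at least that of the unit ball. -/
theorem exists_annMin_le_of_nonneg (hn : 1 ≤ n) (hu : 0 < u) (hp : ClassB p)
    (hα_zero : LogHolderAtOrigin α) (hα_inf : LogHolderAtInfinity α αinf) (N : ℕ) :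
    ∃ C : ℝ≥0, ∀ (g : 𝓢'(E n, ℂ)), hardyNorm N α p u θ Γ g ≠ ∞ → ∀ k : ℤ, 0 ≤ k →
      annMin N g k ≤ C * hardyNorm N α p u θ Γ g * 2 ^ ((k : ℝ) * (Γ - αinf)) := by
  obtain ⟨C, hC⟩ := exists_annMin_mul_luxNorm_le hn hp N
  obtain ⟨A, hA⟩ := exists_annNorm_le_hardyNorm (θ := θ) (Γ := Γ) hu hp.1 hα_zero hα_inf N
  have hms : MeasurableSet (dyadicBall n 0) := measurableSet_ball
  have hX0 : luxNorm p (chi (dyadicBall n 0)) ≠ 0 :=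
    luxNorm_chi_ne_zero hms hp.1.one_le (measure_ball_pos volume _ (two_zpow_pos _)).ne'
  have hXt : luxNorm p (chi (dyadicBall n 0)) ≠ ∞ :=
    luxNorm_chi_ne_top hms hp.1.one_le measure_ball_lt_top.ne
  set X := luxNorm p (chi (dyadicBall n 0)) with hX
  refine ⟨C * A * X⁻¹.toNNReal, fun g hg k hk => ?_⟩
  have hkα : alphaAt α αinf ((2 : ℝ) ^ k) = αinf := by
    rw [alphaAt_two_zpow, if_neg (not_lt.2 hk)]
  have h1 := hA g k
  rw [hkα] at h1
  have hfin : annNorm p N g k ≠ ∞ := ne_top_of_le_ne_top (ENNReal.mul_ne_top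
    (ENNReal.mul_ne_top ENNReal.coe_ne_top (two_rpow_ne_top _)) hg) h1
  have h2 : annMin N g k * X ≤ C * (A * 2 ^ ((k : ℝ) * (Γ - αinf)) * hardyNorm N α p u θ Γ g) :=
    (mul_le_mul_right (luxNorm_mono hp.1.nonneg
      (chi_le_chi (dyadicBall_subset (by omega)))) _).trans
      ((hC g k hfin).trans (mul_le_mul_right h1 _))
  rw [← ENNReal.le_div_iff_mul_le (Or.inl hX0) (Or.inl hXt)] at h2
  refine h2.trans_eq ?_
  push_cast
  rw [ENNReal.coe_toNNReal (ENNReal.inv_ne_top.2 hX0), ENNReal.div_eq_inv_mul]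
  ring

theorem IsDualSystem.hasSum_tailPart_sub (hη : IsDualSystem s η) (hn : 1 ≤ n) (hu : 0 < u)
    (hΓ : 0 ≤ Γ) (hp : ClassB p) (hδ₂ : IsDeltaTwo p δ₂) (hα_zero : LogHolderAtOrigin α)
    (hα_inf : LogHolderAtInfinity α αinf) (hΓ_inf : Γ < αinf) (hs : α 0 - n * δ₂ < s + 1)
    {g : 𝓢'(E n, ℂ)} (hg : hardyNorm N α p u θ Γ g ≠ ∞) (φ : 𝓢(E n, ℂ)) :
    HasSum (fun k => tailPart g η s k φ φ.smooth' - tailPart g η s (k - 1) φ φ.smooth')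
      (g φ) := by
  obtain ⟨C₁, hC₁, hpos⟩ := exists_norm_sub_cut_le g φ
  obtain ⟨C₂, hproj⟩ := hη.exists_enorm_integral_projFn_mul_le φ N
  obtain ⟨C₃, htail⟩ := hη.exists_enorm_tailPart_le φ N
  obtain ⟨C₄, hneg⟩ := exists_mul_annMin_le_of_nonpos (θ := θ) (Γ := Γ) hn hu hp hδ₂ hα_zero
    hα_inf N
  obtain ⟨C₅, hnn⟩ := exists_annMin_le_of_nonneg (θ := θ) (Γ := Γ) hn hu hp hα_zero hα_inf N
  set H := hardyNorm N α p u θ Γ g with hH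
  set e₁ : ℝ := s + 1 + (Γ - α 0 + n * δ₂) with he₁
  have he₁0 : 0 < e₁ := by linarith
  -- The three rates are those of the Schwartz tail of `φ`, of the Taylor remainder as `k → -∞`, and
  -- of `projFn` as `k → ∞`.
  set e : ℝ := min 1 (min e₁ (αinf - Γ)) with he
  have he0 : 0 < e := lt_min one_pos (lt_min he₁0 (by linarith))
  have hea : e ≤ 1 := min_le_left _ _
  have heb : e ≤ e₁ := (min_le_right _ _).trans (min_le_left _ _)
  have hec : e ≤ αinf - Γ := (min_le_right _ _).trans (min_le_right _ _)
  set r : ℝ := (2 : ℝ) ^ (-e) with hr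
  have hr0 : 0 ≤ r := by positivity
  have hr1 : r < 1 := Real.rpow_lt_one_of_one_lt_of_neg one_lt_two (by linarith)
  have hrk : ∀ k : ℕ, r ^ k = (2 : ℝ) ^ (-((k : ℝ) * e)) := by
    intro k
    rw [hr, ← Real.rpow_natCast, ← Real.rpow_mul zero_le_two]
    congr 1
    ring
  have hmono : ∀ (k : ℕ) {q : ℝ}, e ≤ q → (2 : ℝ) ^ (-((k : ℝ) * q)) ≤ r ^ k := by
    intro k q hq
    rw [hrk]
    refine Real.rpow_le_rpow_of_exponent_le one_le_two ?_
    have : (0 : ℝ) ≤ k := Nat.cast_nonneg k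
    nlinarith
  set D₁ : ℝ≥0∞ := C₂ * (C₅ * H) with hD₁
  have hD₁t : D₁ ≠ ∞ :=
    ENNReal.mul_ne_top ENNReal.coe_ne_top (ENNReal.mul_ne_top ENNReal.coe_ne_top hg)
  set D₂ : ℝ≥0∞ := C₃ * (C₄ * H) with hD₂
  have hD₂t : D₂ ≠ ∞ :=
    ENNReal.mul_ne_top ENNReal.coe_ne_top (ENNReal.mul_ne_top ENNReal.coe_ne_top hg)
  have hD₁0 : 0 ≤ D₁.toReal := ENNReal.toReal_nonneg
  have hD₂0 : 0 ≤ D₂.toReal := ENNReal.toReal_nonneg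
  refine hasSum_sub_of_geometric (D := fun k => tailPart g η s k φ φ.smooth')
    (C := C₁ + D₁.toReal + D₂.toReal) hr0 hr1 (fun k => ?_) fun k => ?_
  · have hk : (0 : ℤ) ≤ k := Int.natCast_nonneg k
    have h1 : ‖∫ x, projFn g η s k x * φ x‖ ≤ D₁.toReal * (2 : ℝ) ^ (-((k : ℝ) * (αinf - Γ))) := by
      refine norm_le_of_enorm_le hD₁t ((hproj g k).trans
        ((mul_le_mul_right (hnn g hg k hk) _).trans_eq ?_))
      rw [← mul_assoc]
      congr 2
      push_cast
      ring
    have h2 := hpos k hk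
    have h3 : ((2 : ℝ) ^ (k : ℤ))⁻¹ = (2 : ℝ) ^ (-((k : ℝ) * 1)) := by
      rw [mul_one, Real.rpow_neg zero_le_two, Real.rpow_natCast, zpow_natCast]
    have h4 : g φ - tailPart g η s k φ φ.smooth' =
        (g φ - g (cut k φ φ.smooth')) + ∫ x, projFn g η s k x * φ x := by
      unfold tailPart
      change g φ - (g (cut k φ _) - ∫ x, projFn g η s k x * φ x) = _
      ring
    rw [h4]
    refine (norm_add_le _ _).trans ?_
    rw [h3] at h2
    have h5 := hmono k hea
    have h6 := hmono k hec
    have hrk0 : 0 ≤ r ^ k := pow_nonneg hr0 k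
    calc _ ≤ C₁ * r ^ k + D₁.toReal * r ^ k :=
          add_le_add (h2.trans (mul_le_mul_of_nonneg_left h5 hC₁))
            (h1.trans (mul_le_mul_of_nonneg_left h6 hD₁0))
      _ ≤ (C₁ + D₁.toReal + D₂.toReal) * r ^ k := by nlinarith
  · have hk : (-k : ℤ) ≤ 0 := by omega
    have h1 : ‖tailPart g η s (-k) φ φ.smooth'‖ ≤ D₂.toReal * (2 : ℝ) ^ (-((k : ℝ) * e₁)) := by
      refine norm_le_of_enorm_le hD₂t ((htail g (-k) hk).trans
        ((mul_le_mul_right (hneg g hg (-k) hk) _).trans_eq ?_))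
      rw [ofReal_two_zpow_pow, mul_mul_mul_comm, mul_assoc, mul_comm ((C₄ : ℝ≥0∞) * H), ← mul_assoc]
      have h2 : -((k : ℝ) * e₁) = (((-k : ℤ) : ℝ) * ((s + 1 : ℕ) : ℝ)) +
          ((-k : ℤ) : ℝ) * (Γ - α 0 + n * δ₂) := by
        rw [he₁]
        push_cast
        ring
      rw [h2, two_rpow_add, hD₂]
      ring
    have h5 := hmono k heb
    have hrk0 : 0 ≤ r ^ k := pow_nonneg hr0 k
    calc _ ≤ D₂.toReal * r ^ k := h1.trans (mul_le_mul_of_nonneg_left h5 hD₂0)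
      _ ≤ (C₁ + D₁.toReal + D₂.toReal) * r ^ k := by nlinarith

end Decomposition

/-! ### Normalizing the blocks into atoms and bounding the coefficients. -/

section Synthesis

variable {n N s : ℕ} {p α : E n → ℝ} {αinf δ₂ u θ Γ : ℝ}

/-- The strict inequality `r < R` places the closed support in the open ball. For `c = 0` the
inverse is `0`, and the atom is the zero function. -/
theorem isCentralAtom_inv_mul (hp : ClassP p) {b : E n → ℂ} {c : ℝ≥0} {r R : ℝ} (hrR : r < R)
    (hb : StronglyMeasurable b) (hsupp : ∀ x, r ≤ ‖x‖ → b x = 0)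
    (hnorm : luxNorm p (fun x => ‖b x‖ₑ) ≤
      c * volume (ball (0 : E n) R) ^ (-alphaAt α αinf R / (n : ℝ)))
    (hmom : ∀ β ∈ multiIndices n s, ∫ x, b x * (monom β x : ℂ) = 0) :
    IsCentralAtom α αinf p s R (fun x => ((c⁻¹ : ℝ≥0) : ℂ) * b x) where
  aestronglyMeasurable := (hb.const_mul _).aestronglyMeasurable
  tsupport_subset := by
    have h1 : tsupport (fun x => ((c⁻¹ : ℝ≥0) : ℂ) * b x) ⊆ closedBall (0 : E n) r := by
      refine closure_minimal (fun x hx => ?_) isClosed_closedBall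
      rw [mem_closedBall_zero_iff]
      by_contra! hcon
      exact hx (by simp [hsupp x hcon.le])
    exact h1.trans (closedBall_subset_ball hrR)
  norm_le := by
    have h1 : ∀ x, ‖((c⁻¹ : ℝ≥0) : ℂ) * b x‖ₑ = ((c⁻¹ : ℝ≥0) : ℝ≥0∞) * ‖b x‖ₑ := fun x => by
      rw [enorm_mul]
      congr 1
      rw [enorm_eq_nnnorm]
      norm_cast
      ext
      simp
    simp_rw [h1]
    refine (luxNorm_const_mul_le hp.pos _ _).trans ((mul_le_mul_right hnorm _).trans ?_)
    rw [← mul_assoc, ← ENNReal.coe_mul]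
    refine mul_le_of_le_one_left zero_le ?_
    exact_mod_cast inv_mul_le_one
  moment_eq_zero β hβ := by
    simp_rw [mul_assoc]
    rw [integral_const_mul, hmom β (mem_multiIndices.2 hβ), mul_zero]

/-- For `c ≠ 0` the factors cancel. For `c = 0` the norm bound forces `b = 0` almost everywhere, so
both sides vanish. -/
theorem mul_integral_inv_mul (hp : ClassP p) {b : E n → ℂ} {c : ℝ≥0} {r : ℝ}
    (hb : StronglyMeasurable b) (hsupp : ∀ x, r ≤ ‖x‖ → b x = 0)
    {V : ℝ≥0∞} (hnorm : luxNorm p (fun x => ‖b x‖ₑ) ≤ c * V) (φ : E n → ℂ) :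
    (c : ℂ) * ∫ x, ((c⁻¹ : ℝ≥0) : ℂ) * b x * φ x = ∫ x, b x * φ x := by
  rcases eq_or_ne c 0 with rfl | hc
  · rw [ENNReal.coe_zero, zero_mul, nonpos_iff_eq_zero] at hnorm
    have h1 := setLIntegral_le_luxNorm_mul hp measurableSet_ball
      (measure_ball_lt_top (x := (0 : E n)) (r := r)).ne (fun x => ‖b x‖ₑ) (by simp [hnorm])
    rw [hnorm, mul_zero, zero_mul, nonpos_iff_eq_zero, lintegral_eq_zero_iff hb.enorm] at h1
    have h2 := (ae_restrict_iff' measurableSet_ball).1 h1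
    have h3 : (fun x => b x * φ x) =ᵐ[volume] 0 := by
      filter_upwards [h2] with x hx
      by_cases hxr : r ≤ ‖x‖
      · simp [hsupp x hxr]
      · have := hx (mem_ball_zero_iff.2 (not_le.1 hxr))
        simp only [Pi.zero_apply, enorm_eq_zero] at this
        simp [this]
    rw [integral_congr_ae h3]
    simp
  · simp_rw [mul_assoc]
    rw [integral_const_mul, ← mul_assoc]
    have : (c : ℂ) * ((c⁻¹ : ℝ≥0) : ℂ) = 1 := by
      have hc' : (c : ℂ) ≠ 0 := by exact_mod_cast hc
      simp [hc']
    rw [this, one_mul]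

/-- On the finite set `F` the convolution kernel is bounded below, so its reciprocal can be absorbed
into the constant `A`. -/
theorem exists_grandMorreyNorm_sum_shift_le (hu : 0 < u) (F : Finset ℤ) :
    ∃ C : ℝ≥0, ∀ c : ℤ → ℝ≥0∞,
      grandMorreyNorm u θ Γ (fun j => ∑ l ∈ F, c (j + l)) ≤ C * grandMorreyNorm u θ Γ c := by
  obtain ⟨C, hC⟩ := exists_grandMorreyNorm_conv_le (u := u) (θ := θ) (Γ := Γ) hu one_pos
  set A : ℝ≥0 := ∑ l ∈ F, (2 : ℝ≥0) ^ (1 * |(l : ℝ)| + Γ * l) with hA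
  have hA' : ∀ l ∈ F, (2 : ℝ≥0∞) ^ (1 * |(l : ℝ)| + Γ * l) ≤ A := fun l hl => by
    have h := Finset.single_le_sum (f := fun l : ℤ => (2 : ℝ≥0) ^ (1 * |(l : ℝ)| + Γ * l))
      (fun _ _ => zero_le) hl
    rw [show (2 : ℝ≥0∞) = ((2 : ℝ≥0) : ℝ≥0∞) from rfl, ← ENNReal.coe_rpow_of_ne_zero two_ne_zero]
    exact ENNReal.coe_le_coe.2 h
  refine ⟨A * C, fun c => ?_⟩
  set d : ℤ → ℝ≥0∞ := fun j => ∑' l : ℤ, 2 ^ (-(1 * |(l : ℝ)|) - Γ * l) * c (j + l) with hd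
  calc grandMorreyNorm u θ Γ (fun j => ∑ l ∈ F, c (j + l))
      ≤ grandMorreyNorm u θ Γ (fun j => A * d j) := by
        refine grandMorreyNorm_mono hu fun j => ?_
        refine le_trans ?_ (mul_le_mul_right (ENNReal.sum_le_tsum F) _)
        rw [Finset.mul_sum]
        refine Finset.sum_le_sum fun l hl => ?_
        rw [← mul_assoc]
        refine le_mul_of_one_le_left zero_le ?_
        refine le_of_eq_of_le ?_ (mul_le_mul_left (hA' l hl) _)
        rw [← two_rpow_add, ← ENNReal.rpow_zero (x := 2)]
        congr 1
        ring
    _ ≤ A * grandMorreyNorm u θ Γ d := grandMorreyNorm_const_mul_le hu _ _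
    _ ≤ A * (C * grandMorreyNorm u θ Γ c) := mul_le_mul_right (hC c d fun _ => le_rfl) _
    _ = _ := by rw [ENNReal.coe_mul, mul_assoc]

/-- Every element of the Hardy space has an atomic decomposition with controlled coefficients. -/
theorem exists_atomicDecomposition (hn : 1 ≤ n) (hu : 0 < u) (hΓ : 0 ≤ Γ) (hp : ClassB p)
    (hδ₂ : IsDeltaTwo p δ₂) (hα_zero : LogHolderAtOrigin α)
    (hα_inf : LogHolderAtInfinity α αinf) (hΓ_inf : Γ < αinf) (hs : α 0 - n * δ₂ < s + 1)
    (N : ℕ) :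
    ∃ C : ℝ≥0, ∀ g : 𝓢'(E n, ℂ), hardyNorm N α p u θ Γ g ≠ ∞ →
      ∃ (c : ℤ → ℂ) (a : ℤ → E n → ℂ), IsAtomicDecomposition α αinf p s g c a ∧
        coeffNorm u θ Γ c ≤ C * hardyNorm N α p u θ Γ g := by
  have hP := hp.1
  obtain ⟨η, hη1, hη2, hη3⟩ := exists_dual_bumps n s
  have hη : IsDualSystem s η := ⟨hη1, hη2, hη3⟩
  obtain ⟨C₁, hC₁⟩ := hη.exists_blocks hn hp N
  obtain ⟨A, hA⟩ := exists_annNorm_le_herzCoeff (α := α) (αinf := αinf) hP hα_zero hα_inf N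
  obtain ⟨K, -, hK⟩ := exists_volume_rpow_alphaAt_comparable hn α αinf
  -- The atom for `B_j` will come from the block `j - 3`, so the four annuli `-1, …, 2` around the
  -- block become `-4, …, -1` relative to `j`.
  obtain ⟨C₂, hC₂⟩ := exists_grandMorreyNorm_sum_shift_le (u := u) (θ := θ) (Γ := Γ) hu
    (Finset.Icc (-4 : ℤ) (-1))
  set M : ℝ := max |α 0| |αinf| with hM
  have hM0 : 0 ≤ M := (abs_nonneg _).trans (le_max_left _ _)
  -- The factor `2 ^ (M * 4)` pays for replacing the weight at index `j + l` by that at `j` when `-4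
  -- ≤ l`.
  obtain ⟨D, hD⟩ : ∃ D : ℝ≥0, (D : ℝ≥0∞) = C₁ * A * 2 ^ (M * 4) * K :=
    ⟨_, ENNReal.coe_toNNReal (ENNReal.mul_ne_top (ENNReal.mul_ne_top (ENNReal.mul_ne_top
      ENNReal.coe_ne_top ENNReal.coe_ne_top) (two_rpow_ne_top _)) ENNReal.coe_ne_top)⟩
  refine ⟨D * C₂, fun g hg => ?_⟩
  set H := herzCoeff α p N g with hH
  have hHt : ∀ k, H k ≠ ∞ := fun k => ne_top_of_le_ne_top
    (ENNReal.mul_ne_top (two_rpow_ne_top _) hg)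
    (le_two_rpow_mul_grandMorreyNorm (θ := θ) (Γ := Γ) hu H k)
  obtain ⟨b, hb1, hb2, hb3, hb4, hb5⟩ := hC₁ g fun k => ne_top_of_le_ne_top
    (ENNReal.mul_ne_top (ENNReal.mul_ne_top ENNReal.coe_ne_top (two_rpow_ne_top _)) (hHt k))
    (hA g k)
  choose c hc using fun j : ℤ =>
    (⟨_, ENNReal.coe_toNNReal (ENNReal.mul_ne_top (ENNReal.coe_ne_top (r := D))
      (ENNReal.sum_ne_top.2 fun l _ => hHt (j + l)))⟩ :
      ∃ c : ℝ≥0, (c : ℝ≥0∞) = D * ∑ l ∈ Finset.Icc (-4 : ℤ) (-1), H (j + l))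
  have hshift : ∀ (f : ℤ → ℝ≥0∞) (j : ℤ), ∑ l ∈ Finset.Icc (-1 : ℤ) 2, f (j - 3 + l) =
      ∑ l ∈ Finset.Icc (-4 : ℤ) (-1), f (j + l) := fun f j => by
    refine Finset.sum_bij' (fun l _ => l - 3) (fun l _ => l + 3) ?_ ?_ ?_ ?_ ?_
    · intro l hl
      rw [Finset.mem_Icc] at hl ⊢
      omega
    · intro l hl
      rw [Finset.mem_Icc] at hl ⊢
      omega
    · simp
    · simp
    · intro l _
      congr 1
      ring
  have hnorm : ∀ j : ℤ, luxNorm p (fun x => ‖b (j - 3) x‖ₑ) ≤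
      c j * volume (ball (0 : E n) ((2 : ℝ) ^ j)) ^ (-alphaAt α αinf ((2 : ℝ) ^ j) / (n : ℝ)) := by
    intro j
    refine (hb3 (j - 3)).trans ?_
    rw [hshift (annNorm p N g), hc, hD]
    set W := volume (ball (0 : E n) ((2 : ℝ) ^ j)) ^ (-alphaAt α αinf ((2 : ℝ) ^ j) / (n : ℝ))
    have hterm : ∀ l ∈ Finset.Icc (-4 : ℤ) (-1), annNorm p N g (j + l) ≤
        A * 2 ^ (M * 4) * K * W * H (j + l) := fun l hl => by
      rw [Finset.mem_Icc] at hl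
      refine (hA g (j + l)).trans (mul_le_mul_left ?_ _)
      have h1 := mul_alphaAt_sub_le_of_le (α := α) (αinf := αinf) (M := M)
        ((le_abs_self _).trans (le_max_left _ _)) ((le_abs_self _).trans (le_max_right _ _))
        (show j + l ≤ j by omega)
      have hl4 : (-4 : ℝ) ≤ l := by exact_mod_cast hl.1
      have h2 : -(((j + l : ℤ) : ℝ) * alphaAt α αinf ((2 : ℝ) ^ (j + l))) ≤
          M * 4 + -((j : ℝ) * alphaAt α αinf ((2 : ℝ) ^ j)) := by
        have : M * ((j : ℝ) - ((j + l : ℤ) : ℝ)) ≤ M * 4 := by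
          refine mul_le_mul_of_nonneg_left ?_ hM0
          push_cast
          linarith
        linarith
      calc (A : ℝ≥0∞) * 2 ^ (-(((j + l : ℤ) : ℝ) * alphaAt α αinf ((2 : ℝ) ^ (j + l))))
          ≤ A * (2 ^ (M * 4) * (K * W)) := by
            refine mul_le_mul_right ((two_rpow_le h2).trans ?_) _
            rw [two_rpow_add]
            exact mul_le_mul_right (hK j).2 _
        _ = _ := by ring
    calc (C₁ : ℝ≥0∞) * ∑ l ∈ Finset.Icc (-4 : ℤ) (-1), annNorm p N g (j + l)
        ≤ C₁ * ∑ l ∈ Finset.Icc (-4 : ℤ) (-1), A * 2 ^ (M * 4) * K * W * H (j + l) :=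
          mul_le_mul_right (Finset.sum_le_sum hterm) _
      _ = _ := by
          rw [← Finset.mul_sum]
          ring
  -- The block `j - 3` vanishes beyond radius `2 ^ (j - 1)`, strictly inside `B_j`.
  have hsupp : ∀ (j : ℤ) (x : E n), (2 : ℝ) ^ (j - 1) ≤ ‖x‖ → b (j - 3) x = 0 := fun j x hx =>
    hb2 (j - 3) x (by rwa [show j - 3 + 2 = j - 1 by ring])
  refine ⟨fun j => ((c j : ℝ≥0) : ℂ), fun j x => (((c j)⁻¹ : ℝ≥0) : ℂ) * b (j - 3) x,
    ⟨fun j => ?_, fun φ => ?_⟩, ?_⟩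
  · exact isCentralAtom_inv_mul hP (zpow_lt_zpow_right₀ one_lt_two (by omega)) (hb1 _) (hsupp j)
      (hnorm j) (hb4 _)
  · have h1 := hη.hasSum_tailPart_sub hn hu hΓ hp hδ₂ hα_zero hα_inf hΓ_inf hs hg φ
    have h2 := (Equiv.subRight (3 : ℤ)).hasSum_iff.2 h1
    convert h2 using 1
    ext j
    beta_reduce
    rw [mul_integral_inv_mul hP (hb1 _) (hsupp j) (hnorm j), hb5]
    rfl
  · have h1 : ∀ j, ‖((c j : ℝ≥0) : ℂ)‖ₑ = c j := fun j => by
      rw [enorm_eq_nnnorm]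
      norm_cast
      ext
      simp
    unfold coeffNorm
    simp_rw [h1, hc]
    refine (grandMorreyNorm_const_mul_le hu _ _).trans ?_
    rw [ENNReal.coe_mul, mul_assoc, hardyNorm_eq]
    exact mul_le_mul_right (hC₂ H) _

end Synthesis

end HerzMorreyHardy

/-! ### The atomic characterization. -/

theorem theorem2p3 {n : ℕ} (hn : 1 ≤ n) (p α : HerzMorreyHardy.E n → ℝ)
    (αinf δ₂ u θ Γ : ℝ) (N s : ℕ)
    (hu : 0 < u) (hθ : 0 < θ) (hΓ : 0 ≤ Γ)
    (hp : HerzMorreyHardy.ClassB p)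
    (hδ₂ : HerzMorreyHardy.IsDeltaTwo p δ₂)
    (hα : MemLp α ∞ volume)
    (hα_zero : HerzMorreyHardy.LogHolderAtOrigin α)
    (hα_inf : HerzMorreyHardy.LogHolderAtInfinity α αinf)
    (hΓα : ∀ᵐ x, 2 * Γ ≤ α x)
    (h_zero : n * δ₂ ≤ α 0) (h_inf : n * δ₂ ≤ αinf)
    (hs_zero : ⌊α 0 - n * δ₂⌋ ≤ (s : ℤ)) (hs_inf : ⌊αinf - n * δ₂⌋ ≤ (s : ℤ))
    (hN : n + 1 < N)
    (hN_zero : n + (α 0 - n * δ₂) < N) (hN_inf : n + (αinf - n * δ₂) < N) :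
    (∀ g : 𝓢'(HerzMorreyHardy.E n, ℂ),
      g ∈ HerzMorreyHardy.hardySpace N α p u θ Γ ↔
        ∃ (c : ℤ → ℂ) (a : ℤ → HerzMorreyHardy.E n → ℂ),
          HerzMorreyHardy.IsAtomicDecomposition α αinf p s g c a ∧
            HerzMorreyHardy.coeffNorm u θ Γ c < ∞) ∧
    ∃ C : ℝ≥0, 0 < C ∧ ∀ g ∈ HerzMorreyHardy.hardySpace N α p u θ Γ,
      HerzMorreyHardy.hardyNorm N α p u θ Γ g ≤
          C * HerzMorreyHardy.atomicNorm α αinf p s u θ Γ g ∧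
        HerzMorreyHardy.atomicNorm α αinf p s u θ Γ g ≤
          C * HerzMorreyHardy.hardyNorm N α p u θ Γ g := by
  obtain ⟨hΓ₀, hΓ₁⟩ := HerzMorreyHardy.le_alphaAt_of_ae_le hn hα_zero hα_inf hΓα
  have hnδ : 0 < n * δ₂ := mul_pos (by exact_mod_cast hn) hδ₂.1
  -- If `Γ > 0` then `Γ < 2Γ ≤ α 0`; if `Γ = 0` then `0 < n * δ₂ ≤ α 0`.
  have hΓ_zero : Γ < α 0 := by
    rcases hΓ.eq_or_lt with h | h <;> linarith
  have hΓ_inf : Γ < αinf := by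
    rcases hΓ.eq_or_lt with h | h <;> linarith
  have hs₀ : α 0 - n * δ₂ < s + 1 := by
    have h := (Int.lt_floor_add_one (α 0 - n * δ₂)).trans_le
      (add_le_add_left (Int.cast_le.2 hs_zero) 1)
    exact_mod_cast h
  have hs₁ : αinf - n * δ₂ < s + 1 := by
    have h := (Int.lt_floor_add_one (αinf - n * δ₂)).trans_le
      (add_le_add_left (Int.cast_le.2 hs_inf) 1)
    exact_mod_cast h
  obtain ⟨m, hms, hmN, hm₀, hm₁⟩ : ∃ m : ℕ, m ≤ s ∧ n + (m + 1) ≤ N ∧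
      α 0 - n * δ₂ < m + 1 ∧ αinf - n * δ₂ < m + 1 := by
    rcases le_total (n + (s + 1)) N with h | h
    · exact ⟨s, le_rfl, h, hs₀, hs₁⟩
    · obtain ⟨m, rfl⟩ : ∃ m, N = n + (m + 1) := ⟨N - n - 1, by omega⟩
      push_cast at hN_zero hN_inf
      exact ⟨m, by omega, le_rfl, by linarith, by linarith⟩
  obtain ⟨C₁, hC₁⟩ := HerzMorreyHardy.exists_hardyNorm_le_coeffNorm (u := u) (θ := θ) (N := N)
    hn hu hΓ hp hδ₂ hα_zero hα_inf hΓ_zero hΓ_inf hms hmN hm₀ hm₁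
  obtain ⟨C₂, hC₂⟩ := HerzMorreyHardy.exists_atomicDecomposition (u := u) (θ := θ) (s := s)
    hn hu hΓ hp hδ₂ hα_zero hα_inf hΓ_inf hs₀ N
  refine ⟨fun g => ⟨fun hg => ?_, fun ⟨c, a, hca, hc⟩ => ?_⟩,
    -- Adding `1` keeps the constant positive even if `C₁` and `C₂` both vanish.
    C₁ + C₂ + 1, by positivity, fun g hg => ⟨?_, ?_⟩⟩
  · obtain ⟨c, a, hca, hc⟩ := hC₂ g (ne_of_lt hg)
    exact ⟨c, a, hca, hc.trans_lt (ENNReal.mul_lt_top ENNReal.coe_lt_top hg)⟩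
  · exact (hC₁ g c a hca).trans_lt (ENNReal.mul_lt_top ENNReal.coe_lt_top hc)
  · have h0 : ((C₁ + C₂ + 1 : ℝ≥0) : ℝ≥0∞) ≠ 0 := by
      exact_mod_cast (show 0 < C₁ + C₂ + 1 by positivity).ne'
    rw [← ENNReal.inv_mul_le_iff h0 ENNReal.coe_ne_top]
    refine le_iInf fun c => le_iInf fun a => le_iInf fun hca => ?_
    rw [ENNReal.inv_mul_le_iff h0 ENNReal.coe_ne_top]
    refine (hC₁ g c a hca).trans (mul_le_mul_left (ENNReal.coe_le_coe.2 ?_) _)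
    rw [add_assoc]
    exact le_self_add
  · obtain ⟨c, a, hca, hc⟩ := hC₂ g (ne_of_lt hg)
    refine iInf_le_of_le c (iInf_le_of_le a (iInf_le_of_le hca
      (hc.trans (mul_le_mul_left (ENNReal.coe_le_coe.2 ?_) _))))
    rw [add_right_comm]
    exact le_add_self
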